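/- **Conventions.** Manifolds are smooth ($C^\infty$), finite dimensional, of pure dimension and without boundary; no Hausdorff or countability assumption is made. A Lie groupoid $G \rightrightarrows X$ is a groupoid whose sets of arrows $G$ and of objects $X$ are manifolds, whose source and target maps are submersions, and whose multiplication (defined on $\{(g,h) : s(g)=t(h)\}$), unit and inverse maps are smooth. A *double Lie groupoid* is a square of Lie groupoids $D \rightrightarrows H$ (with $s_H,t_H,\cdot_H$), $D\rightrightarrows V$ (with $s_V,t_V,\cdot_V$), $H\rightrightarrows M$ and $V \rightrightarrows M$ (each with $s,t,\cdot$) such that 1. $s s_H = s s_V$, $\ t t_H = t t_V$, $\ t s_H = s t_V$, $\ s t_H = t s_V$; 2. $s_V(\alpha\cdot_H\beta) = s_V\alpha\cdot s_V\beta$ and $t_V(\alpha\cdot_H\beta) = t_V\alpha\cdot t_V\beta$ whenever $s_H\alpha=t_H\beta$, and likewise with the roles of $H$ and $V$ interchanged; 3. $(\alpha_{11}\cdot_H\alpha_{12})\cdot_V(\alpha_{21}\cdot_H\alpha_{22}) = (\alpha_{11}\cdot_V\alpha_{21})\cdot_H(\alpha_{12}\cdot_V\alpha_{22})$ whenever $s_H\alpha_{i1}=t_H\alpha_{i2}$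 and $s_V\alpha_{1i}=t_V\alpha_{2i}$ for $i=1,2$; 4. the double-source map $(s_V,s_H): D\to \{(\theta,\eta)\in V\times H : s(\theta)=s(\eta)\}$ is a submersion. It is *full* if its double-source map is surjective. The *nerve* of a groupoid $G\rightrightarrows X$ is the simplicial set with $X$ in degree $0$ and, in degree $n>0$, the strings $(g_1,\dots,g_n)$ with $s(g_i)=t(g_{i+1})$; in degree $n \ge 2$ the face $f_0$ drops $g_1$, $f_n$ drops $g_n$, and $f_i$ replaces $g_i,g_{i+1}$ by $g_ig_{i+1}$ for $0<i<n$; in degree $1$, $f_0=s$ and $f_1=t$; the degeneracies insert units. The *double nerve* $ND$ has $N_{p,q}D$ (for $p,q>0$) the set of arrays $(\alpha_{ij})_{1\le i\le p,\,1\le j\le q}$ in $D$ with $s_H(\alpha_{ij})=t_H(\alpha_{i(j+1)})$ and $s_V(\alpha_{ij})=t_V(\alpha_{(i+1)j})$, while $N_{0,q}D$ and $N_{p,0}D$ are the sets of composable $q$-strings in $V$ and $p$-strings in $H$, and $N_{0,0}D=M$. Its horizontal faces and degeneracies $h_i,\eta_i$ (changing $p$) are those of the nerve of the groupoid of horizontally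 composable $q$-strings in $D$ over composable $q$-strings in $V$; its vertical ones $v_i,\mu_i$ (changing $q$) are those of the nerve of the groupoid of vertically composable $p$-strings in $D$ over composable $p$-strings in $H$. The *bar construction* $\overline W_r ND$ is the set of tuples $(x_0,\dots,x_r)$ with $x_i\in N_{i,r-i}D$ and $v_0(x_i)=h_{i+1}(x_{i+1})$ for $0\le i<r$, with $$f_i(x_0,\dots,x_r)=(v_ix_0,v_{i-1}x_1,\dots,v_1x_{i-1},h_ix_{i+1},\dots,h_ix_r),$$ $$\delta_i(x_0,\dots,x_r)=(\mu_ix_0,\mu_{i-1}x_1,\dots,\mu_0x_i,\eta_ix_i,\dots,\eta_ix_r).$$ A *simplicial manifold* is a simplicial set whose levels are manifolds, whose faces are surjective submersions and whose degeneracies are embeddings. For $q\ge1$ and $0\le k\le q$, its space of horns $\Lambda_{q,k}X$ is the set of tuples $(x_i)_{0\le i\le q,\,i\neq k}$ in $X_{q-1}$ with $f_ix_j=f_{j-1}x_i$ for $i<j$ (no condition when $q=1$), and the horn map is $\lambda_{q,k}:X_q\to\Lambda_{q,k}X$, $x\mapsto(f_ix)_{i\ne k}$. A *Lie $n$-groupoid*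 is a simplicial manifold whose horn spaces are embedded submanifolds of products of copies of $X_{q-1}$ and whose horn maps $\lambda_{q,k}$ are surjective submersions for all $q\ge1$ and diffeomorphisms for all $q>n$. A *local Lie $n$-groupoid* is defined in the same way, with horn maps that are submersions for all $q\ge1$ and injective étale maps (local diffeomorphisms) for all $q>n$. **Theorem.** Let $D$ be a double Lie groupoid. Then the spaces $N_{p,q}D$ and $\overline W_rND$ are embedded submanifolds of the products in which they are defined by the equations above, and with these smooth structures $\overline W ND$ is a local Lie $2$-groupoid. If moreover $D$ is full, then $\overline W ND$ is a Lie $2$-groupoid. -/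

import Mathlib

open scoped Manifold ContDiff

universe u

/-- A smooth structure on the set `X`: a topology together with a smooth atlas modelled on some
finite-dimensional real vector space (so `X` becomes a smooth manifold without boundary, of pure
dimension). No Hausdorff or countability condition is imposed. -/
structure SmoothStructure (X : Type u) where
  E : Type
  [normed : NormedAddCommGroup E]
  [space : NormedSpace ℝ E]
  [finDim : FiniteDimensional ℝ E]
  [top : TopologicalSpace X]
  [charted : ChartedSpace E X]
  [mfd : IsManifold 𝓘(ℝ, E) ∞ X]

namespace SmoothStructure

attribute [instance] normed space finDim

variable {X Y : Type u}

/-- `f` is a smooth map. -/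
def Smooth (σ : SmoothStructure X) (τ : SmoothStructure Y) (f : X → Y) : Prop :=
  @ContMDiff ℝ _ σ.E _ _ σ.E _ 𝓘(ℝ, σ.E) X σ.top σ.charted
    τ.E _ _ τ.E _ 𝓘(ℝ, τ.E) Y τ.top τ.charted ∞ f

/-- `f` is a smooth submersion. -/
def Submersion (σ : SmoothStructure X) (τ : SmoothStructure Y) (f : X → Y) : Prop :=
  letI := σ.top; letI := σ.charted; letI := τ.top; letI := τ.charted
  Manifold.IsSubmersion 𝓘(ℝ, σ.E) 𝓘(ℝ, τ.E) ∞ f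

/-- `f` is a smooth embedding. -/
def Embedding (σ : SmoothStructure X) (τ : SmoothStructure Y) (f : X → Y) : Prop :=
  letI := σ.top; letI := σ.charted; letI := τ.top; letI := τ.charted
  Manifold.IsSmoothEmbedding 𝓘(ℝ, σ.E) 𝓘(ℝ, τ.E) ∞ f

/-- `f` is étale, i.e. a local diffeomorphism. -/
def Etale (σ : SmoothStructure X) (τ : SmoothStructure Y) (f : X → Y) : Prop :=
  letI := σ.top; letI := σ.charted; letI := τ.top; letI := τ.charted
  IsLocalDiffeomorph 𝓘(ℝ, σ.E) 𝓘(ℝ, τ.E) ∞ f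

/-- `f` is a diffeomorphism. -/
def Diffeo (σ : SmoothStructure X) (τ : SmoothStructure Y) (f : X → Y) : Prop :=
  letI := σ.top; letI := σ.charted; letI := τ.top; letI := τ.charted
  ∃ Φ : Diffeomorph 𝓘(ℝ, σ.E) 𝓘(ℝ, τ.E) X Y ∞, ⇑Φ = f

/-- The product of two manifolds. -/
noncomputable def prod (σ : SmoothStructure X) (τ : SmoothStructure Y) : SmoothStructure (X × Y) :=
  letI := σ.top; letI := σ.charted; letI := τ.top; letI := τ.charted
  haveI := σ.mfd; haveI := τ.mfd
  { E := σ.E × τ.E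
    charted := prodChartedSpace σ.E X τ.E Y
    mfd := by
      rw [modelWithCornersSelf_prod]
      exact IsManifold.prod X Y }

theorem pi_isManifold {ι : Type} [Fintype ι] (E : ι → Type) [∀ i, NormedAddCommGroup (E i)]
    [∀ i, NormedSpace ℝ (E i)] (X : ι → Type u) [∀ i, TopologicalSpace (X i)]
    [∀ i, ChartedSpace (E i) (X i)] [∀ i, IsManifold 𝓘(ℝ, E i) ∞ (X i)] :
    @IsManifold ℝ _ (∀ i, E i) _ _ (∀ i, E i) _ 𝓘(ℝ, ∀ i, E i) ∞ (∀ i, X i) _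
      (piChartedSpace E X) := by
  let _ : ChartedSpace (∀ i, E i) (∀ i, X i) := piChartedSpace E X
  refine isManifold_of_contDiffOn _ _ _ ?_
  rintro e e' he he'
  obtain ⟨f, hf, rfl⟩ := he
  obtain ⟨g, hg, rfl⟩ := he'
  rw [contDiffOn_pi]
  intro i
  have h := HasGroupoid.compatible (G := contDiffGroupoid ∞ 𝓘(ℝ, E i)) (hf i trivial) (hg i trivial)
  rw [contDiffGroupoid, mem_groupoid_of_pregroupoid] at h
  refine h.1.comp (t := _) (ContinuousLinearMap.proj (R := ℝ) (φ := E) i).contDiff.contDiffOn ?_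
  rintro x ⟨⟨hx, hx'⟩, -⟩
  exact ⟨⟨hx i trivial, hx' i trivial⟩, x i, rfl⟩

/-- The product of a finite family of manifolds. -/
noncomputable def pi {ι : Type} [Fintype ι] {X : ι → Type u} (σ : ∀ i, SmoothStructure (X i)) :
    SmoothStructure (∀ i, X i) :=
  letI := fun i => (σ i).top; letI := fun i => (σ i).charted
  haveI := fun i => (σ i).mfd
  { E := ∀ i, (σ i).E
    charted := piChartedSpace (fun i => (σ i).E) X
    mfd := pi_isManifold (fun i => (σ i).E) X }

/-- `X` as a discrete, zero-dimensional manifold. -/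
noncomputable def discrete (X : Type u) : SmoothStructure X :=
  letI : TopologicalSpace X := ⊥
  haveI : DiscreteTopology X := ⟨rfl⟩
  { E := PUnit
    charted := ChartedSpace.ofDiscreteTopology
    mfd := IsManifold.of_discreteTopology ∞ }

/-- `S` is an embedded submanifold of `X`: it carries a smooth structure for which the inclusion
is a smooth embedding. -/
def IsSubmanifold (σ : SmoothStructure X) (S : Set X) : Prop :=
  ∃ τ : SmoothStructure S, Embedding τ σ Subtype.val

open Classical in
/-- The smooth structure of an embedded submanifold `S` of `X`. It is unique up to the identity
diffeomorphism. (Where `S` is not an embedded submanifold, the value is irrelevant.) -/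
noncomputable def sub (σ : SmoothStructure X) (S : Set X) : SmoothStructure S :=
  if h : σ.IsSubmanifold S then h.choose else discrete S

end SmoothStructure

/-- A groupoid `G ⇉ X` (in the sense of its algebraic structure), with set of arrows `G` and set of
objects `X`. The product `g · h` is defined when the source of `g` is the target of `h`. -/
structure Gpd (G X : Type u) where
  src : G → X
  tgt : G → X
  mul : (g h : G) → src g = tgt h → G
  one : X → G
  inv : G → G
  src_mul : ∀ g h e, src (mul g h e) = src h
  tgt_mul : ∀ g h e, tgt (mul g h e) = tgt g
  src_one : ∀ x, src (one x) = x
  tgt_one : ∀ x, tgt (one x) = x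
  src_inv : ∀ g, src (inv g) = tgt g
  tgt_inv : ∀ g, tgt (inv g) = src g
  mul_assoc : ∀ g h k (e : src g = tgt h) (e' : src h = tgt k),
    mul (mul g h e) k ((src_mul g h e).trans e') = mul g (mul h k e') (e.trans (tgt_mul h k e').symm)
  one_mul : ∀ g, mul (one (tgt g)) g (src_one _) = g
  mul_one : ∀ g, mul g (one (src g)) (tgt_one _).symm = g
  mul_inv : ∀ g, mul g (inv g) (tgt_inv g).symm = one (tgt g)
  inv_mul : ∀ g, mul (inv g) g (src_inv g) = one (src g)

/-- A simplicial structure on a sequence of sets `obj n`: face maps `f_i : obj (n + 1) → obj n` for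
`0 ≤ i ≤ n + 1` and degeneracy maps `δ_i : obj n → obj (n + 1)` for `0 ≤ i ≤ n`, subject to the
simplicial identities. -/
structure SimplicialStructure (obj : ℕ → Type u) where
  face : (n i : ℕ) → i ≤ n + 1 → obj (n + 1) → obj n
  degen : (n i : ℕ) → i ≤ n → obj n → obj (n + 1)
  face_face : ∀ (n i j : ℕ) (hij : i ≤ j) (hj : j ≤ n + 1) (x : obj (n + 2)),
    face n i (by omega) (face (n + 1) (j + 1) (by omega) x) =
      face n j hj (face (n + 1) i (by omega) x)
  degen_degen : ∀ (n i j : ℕ) (hij : i ≤ j) (hj : j ≤ n) (x : obj n),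
    degen (n + 1) i (by omega) (degen n j hj x) =
      degen (n + 1) (j + 1) (by omega) (degen n i (by omega) x)
  face_degen_lt : ∀ (n i j : ℕ) (hij : i ≤ j) (hj : j ≤ n) (x : obj (n + 1)),
    face (n + 1) i (by omega) (degen (n + 1) (j + 1) (by omega) x) =
      degen n j hj (face n i (by omega) x)
  face_degen_self : ∀ (n i : ℕ) (hi : i ≤ n) (x : obj n),
    face n i (by omega) (degen n i hi x) = x
  face_degen_succ : ∀ (n i : ℕ) (hi : i ≤ n) (x : obj n),
    face n (i + 1) (by omega) (degen n i hi x) = x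
  face_degen_gt : ∀ (n i j : ℕ) (hij : j < i) (hi : i ≤ n + 1) (x : obj (n + 1)),
    face (n + 1) (i + 1) (by omega) (degen (n + 1) j (by omega) x) =
      degen n j (by omega) (face n i hi x)

namespace SimplicialStructure

variable {obj : ℕ → Type u} (S : SimplicialStructure obj) {n i j k l : ℕ}

theorem face_face' (hij : i ≤ j) (hk : k = j + 1) (hl : l = i) (h1 : i ≤ n + 1) (h2 : k ≤ n + 2)
    {h3 : j ≤ n + 1} {h4 : l ≤ n + 2} {x : obj (n + 2)} :
    S.face n i h1 (S.face (n + 1) k h2 x) = S.face n j h3 (S.face (n + 1) l h4 x) := by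
  subst hk hl; exact S.face_face _ _ _ hij _ _

theorem degen_degen' (hij : i ≤ j) (hk : k = j + 1) (hl : l = i) (h1 : i ≤ n + 1) (h2 : j ≤ n)
    {h3 : k ≤ n + 1} {h4 : l ≤ n} {x : obj n} :
    S.degen (n + 1) i h1 (S.degen n j h2 x) = S.degen (n + 1) k h3 (S.degen n l h4 x) := by
  subst hk hl; exact S.degen_degen _ _ _ hij _ _

theorem face_degen_lt' (hij : i ≤ j) (hk : k = j + 1) (hl : l = i) (h1 : i ≤ n + 2)
    (h2 : k ≤ n + 1) {h3 : j ≤ n} {h4 : l ≤ n + 1} {x : obj (n + 1)} :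
    S.face (n + 1) i h1 (S.degen (n + 1) k h2 x) = S.degen n j h3 (S.face n l h4 x) := by
  subst hk hl; exact S.face_degen_lt _ _ _ hij _ _

theorem face_degen_self' (h : i = j ∨ i = j + 1) (h1 : i ≤ n + 1) (h2 : j ≤ n) {x : obj n} :
    S.face n i h1 (S.degen n j h2 x) = x := by
  rcases h with rfl | rfl
  · exact S.face_degen_self _ _ _ _
  · exact S.face_degen_succ _ _ _ _

theorem face_degen_gt' (hij : j < l) (hk : k = l + 1) (hl : i = j) (h1 : k ≤ n + 2)
    (h2 : j ≤ n + 1) {h3 : i ≤ n} {h4 : l ≤ n + 1} {x : obj (n + 1)} :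
    S.face (n + 1) k h1 (S.degen (n + 1) j h2 x) = S.degen n i h3 (S.face n l h4 x) := by
  subst hk hl; exact S.face_degen_gt _ _ _ hij _ _

end SimplicialStructure

namespace Gpd

variable {G X : Type u} (γ : Gpd G X)

/-- The string `(g_1, …, g_n)` is composable. -/
def Composable {n : ℕ} (g : Fin n → G) : Prop :=
  ∀ (k : ℕ) (hk : k + 1 < n), γ.src (g ⟨k, by omega⟩) = γ.tgt (g ⟨k + 1, hk⟩)

/-- The `n`-simplices of the nerve: objects for `n = 0`, composable `n`-strings for `n > 0`. -/
def Nerve : ℕ → Type u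
  | 0 => X
  | n + 1 => {g : Fin (n + 1) → G // γ.Composable g}

/-- The `i`-th vertex of a string. -/
def vertex {n : ℕ} (g : Fin (n + 1) → G) (i : ℕ) (hi : i ≤ n + 1) : X :=
  if i = 0 then γ.tgt (g 0) else γ.src (g ⟨i - 1, by omega⟩)

variable {γ} in
theorem src_eq {n : ℕ} (g : Fin (n + 1) → G) (k : ℕ) (hk : k < n + 1) :
    γ.src (g ⟨k, hk⟩) = γ.vertex g (k + 1) (by omega) := by
  simp [vertex]

variable {γ} in
theorem Composable.tgt_eq {n : ℕ} {g : Fin (n + 1) → G} (hg : γ.Composable g) (k : ℕ)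
    (hk : k < n + 1) : γ.tgt (g ⟨k, hk⟩) = γ.vertex g k (by omega) := by
  cases k with
  | zero => rfl
  | succ k => simp [vertex, hg k hk]

/-- Delete the `i`-th vertex of a string of length at least two: drop the first arrow (`i = 0`),
drop the last arrow (`i = n + 2`), or compose two neighbours. -/
def faceFun {n : ℕ} (i : ℕ) (g : Fin (n + 2) → G) (hg : γ.Composable g) (k : Fin (n + 1)) : G :=
  if k.1 + 1 < i then g ⟨k, by omega⟩
  else if k.1 + 1 = i then γ.mul (g ⟨k, by omega⟩) (g ⟨k + 1, by omega⟩) (hg k (by omega))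
  else g ⟨k + 1, by omega⟩

/-- Repeat the `i`-th vertex of a string. -/
def degenFun {n : ℕ} (i : ℕ) (hi : i ≤ n + 1) (g : Fin (n + 1) → G) (k : Fin (n + 2)) : G :=
  if h : k.1 < i then g ⟨k, by omega⟩
  else if k.1 = i then γ.one (γ.vertex g i hi)
  else g ⟨k - 1, by have := k.2; omega⟩

theorem src_faceFun {n : ℕ} (i : ℕ) (g : Fin (n + 2) → G) (hg : γ.Composable g) (k : ℕ)
    (hk : k < n + 1) : γ.src (γ.faceFun i g hg ⟨k, hk⟩) =
      if k + 1 < i then γ.vertex g (k + 1) (by omega) else γ.vertex g (k + 2) (by omega) := by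
  unfold faceFun
  dsimp only
  split_ifs <;> simp [src_mul, src_eq]

theorem tgt_faceFun {n : ℕ} (i : ℕ) (g : Fin (n + 2) → G) (hg : γ.Composable g) (k : ℕ)
    (hk : k < n + 1) : γ.tgt (γ.faceFun i g hg ⟨k, hk⟩) =
      if k < i then γ.vertex g k (by omega) else γ.vertex g (k + 1) (by omega) := by
  unfold faceFun
  dsimp only
  split_ifs <;> first | omega | simp [tgt_mul, hg.tgt_eq]

theorem faceFun_composable {n : ℕ} (i : ℕ) (g : Fin (n + 2) → G) (hg : γ.Composable g) :
    γ.Composable (γ.faceFun i g hg) := by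
  intro k hk
  rw [src_faceFun, tgt_faceFun]

theorem vertex_faceFun {n : ℕ} (i : ℕ) (g : Fin (n + 2) → G) (hg : γ.Composable g) (k : ℕ)
    (hk : k ≤ n + 1) : γ.vertex (γ.faceFun i g hg) k hk =
      if k < i then γ.vertex g k (by omega) else γ.vertex g (k + 1) (by omega) := by
  cases k with
  | zero => exact γ.tgt_faceFun i g hg 0 (by omega)
  | succ k =>  rw [← src_eq _ _ (by omega), src_faceFun]

theorem src_degenFun {n : ℕ} (i : ℕ) (hi : i ≤ n + 1) (g : Fin (n + 1) → G) (k : ℕ)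
    (hk : k < n + 2) : γ.src (γ.degenFun i hi g ⟨k, hk⟩) =
      if h : k < i then γ.vertex g (k + 1) (by omega) else γ.vertex g k (by omega) := by
  unfold degenFun
  dsimp only
  split_ifs with h1 h2
  · simp [src_eq]
  · simp [src_one, h2]
  · obtain ⟨k, rfl⟩ : ∃ l, k = l + 1 := ⟨k - 1, by omega⟩
    simp [src_eq]

theorem tgt_degenFun {n : ℕ} (i : ℕ) (hi : i ≤ n + 1) (g : Fin (n + 1) → G)
    (hg : γ.Composable g) (k : ℕ) (hk : k < n + 2) : γ.tgt (γ.degenFun i hi g ⟨k, hk⟩) =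
      if h : k ≤ i then γ.vertex g k (by omega) else γ.vertex g (k - 1) (by omega) := by
  unfold degenFun
  dsimp only
  split_ifs with h1 h2 h3 h4 h5
  · simp [hg.tgt_eq]
  · omega
  · simp [tgt_one, h3]
  · omega
  · omega
  · simp [hg.tgt_eq]

theorem degenFun_composable {n : ℕ} (i : ℕ) (hi : i ≤ n + 1) (g : Fin (n + 1) → G)
    (hg : γ.Composable g) : γ.Composable (γ.degenFun i hi g) := by
  intro k hk
  rw [src_degenFun, tgt_degenFun _ _ _ _ hg]
  split_ifs <;> first | omega | rfl

theorem vertex_degenFun {n : ℕ} (i : ℕ) (hi : i ≤ n + 1) (g : Fin (n + 1) → G)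
    (hg : γ.Composable g) (k : ℕ) (hk : k ≤ n + 2) : γ.vertex (γ.degenFun i hi g) k hk =
      if h : k ≤ i then γ.vertex g k (by omega) else γ.vertex g (k - 1) (by omega) := by
  cases k with
  | zero => exact γ.tgt_degenFun i hi g hg 0 (by omega)
  | succ k =>  
    rw [← src_eq _ _ (by omega), src_degenFun]
    split_ifs <;> first | omega | rfl

/-- The face maps of the nerve. -/
def face : (n i : ℕ) → i ≤ n + 1 → γ.Nerve (n + 1) → γ.Nerve n
  | 0, 0, _, g => γ.src (g.1 0)
  | 0, _ + 1, _, g => γ.tgt (g.1 0)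
  | _ + 1, i, _, g => ⟨γ.faceFun i g.1 g.2, γ.faceFun_composable i g.1 g.2⟩

/-- The degeneracy maps of the nerve. -/
def degen : (n i : ℕ) → i ≤ n → γ.Nerve n → γ.Nerve (n + 1)
  | 0, _, _, x => ⟨fun _ => γ.one x, fun k hk => absurd hk (Nat.not_lt.2 (Nat.le_add_left 1 k))⟩
  | _ + 1, i, hi, g => ⟨γ.degenFun i hi g.1, γ.degenFun_composable i hi g.1 g.2⟩

theorem mul_congr {g g' h h' : G} (hg : g = g') (hh : h = h') (e : γ.src g = γ.tgt h) :
    γ.mul g h e = γ.mul g' h' (hg ▸ hh ▸ e) := by subst hg hh; rfl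

theorem face_face (n i j : ℕ) (hij : i ≤ j) (hj : j ≤ n + 1) (x : γ.Nerve (n + 2)) :
    γ.face n i (by omega) (γ.face (n + 1) (j + 1) (by omega) x) =
      γ.face n j hj (γ.face (n + 1) i (by omega) x) := by
  cases n with
  | zero =>
    obtain ⟨rfl, rfl⟩ | ⟨rfl, rfl⟩ | ⟨rfl, rfl⟩ :
        (i = 0 ∧ j = 0) ∨ (i = 0 ∧ j = 1) ∨ (i = 1 ∧ j = 1) := by omega
    · exact γ.src_mul ..
    · exact x.2 0 Nat.one_lt_two
    · exact (γ.tgt_mul ..).symm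
  | succ n =>
    apply Subtype.ext
    funext ⟨k, hk⟩
    simp only [face, faceFun]
    grind [mul_assoc]

theorem degen_degen (n i j : ℕ) (hij : i ≤ j) (hj : j ≤ n) (x : γ.Nerve n) :
    γ.degen (n + 1) i (by omega) (γ.degen n j hj x) =
      γ.degen (n + 1) (j + 1) (by omega) (γ.degen n i (by omega) x) := by
  cases n with
  | zero =>
    obtain ⟨rfl, rfl⟩ : i = 0 ∧ j = 0 := by omega
    apply Subtype.ext
    funext ⟨k, hk⟩
    simp only [degen, degenFun, vertex]
    grind [src_one, tgt_one]
  | succ n =>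
    apply Subtype.ext
    funext ⟨k, hk⟩
    simp only [degen]
    have h1 := γ.vertex_degenFun i (by omega) x.1 x.2 (j + 1) (by omega)
    have h2 := γ.vertex_degenFun j (by omega) x.1 x.2 i (by omega)
    unfold degenFun at *
    grind

theorem face_degen_lt (n i j : ℕ) (hij : i ≤ j) (hj : j ≤ n) (x : γ.Nerve (n + 1)) :
    γ.face (n + 1) i (by omega) (γ.degen (n + 1) (j + 1) (by omega) x) =
      γ.degen n j hj (γ.face n i (by omega) x) := by
  cases n with
  | zero =>
    obtain ⟨rfl, rfl⟩ : i = 0 ∧ j = 0 := by omega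
    apply Subtype.ext
    funext ⟨k, hk⟩
    simp only [face, degen, faceFun, degenFun, vertex]
    grind [src_one, tgt_one]
  | succ n =>
    apply Subtype.ext
    funext ⟨k, hk⟩
    simp only [face, degen]
    have h1 := γ.vertex_faceFun i x.1 x.2 j (by omega)
    unfold faceFun degenFun at *
    grind [mul_assoc]

theorem face_degen_gt (n i j : ℕ) (hij : j < i) (hi : i ≤ n + 1) (x : γ.Nerve (n + 1)) :
    γ.face (n + 1) (i + 1) (by omega) (γ.degen (n + 1) j (by omega) x) =
      γ.degen n j (by omega) (γ.face n i hi x) := by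
  cases n with
  | zero =>
    obtain ⟨rfl, rfl⟩ : i = 1 ∧ j = 0 := by omega
    apply Subtype.ext
    funext ⟨k, hk⟩
    simp only [face, degen, faceFun, degenFun, vertex]
    grind [src_one, tgt_one]
  | succ n =>
    apply Subtype.ext
    funext ⟨k, hk⟩
    simp only [face, degen]
    have h1 := γ.vertex_faceFun i x.1 x.2 j (by omega)
    unfold faceFun degenFun at *
    grind [mul_assoc]

theorem face_degen_self (n i : ℕ) (hi : i ≤ n) (x : γ.Nerve n) :
    γ.face n i (by omega) (γ.degen n i hi x) = x := by
  cases n with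
  | zero =>
    obtain rfl : i = 0 := by omega
    exact γ.src_one x
  | succ n =>
    apply Subtype.ext
    funext ⟨k, hk⟩
    simp only [face, degen]
    have h1 := x.2.tgt_eq k hk
    have h2 := γ.one_mul (x.1 ⟨k, hk⟩)
    have h3 := src_eq (γ := γ) x.1 k hk
    have h4 := γ.mul_one (x.1 ⟨k, hk⟩)
    unfold faceFun degenFun at *
    grind

theorem face_degen_succ (n i : ℕ) (hi : i ≤ n) (x : γ.Nerve n) :
    γ.face n (i + 1) (by omega) (γ.degen n i hi x) = x := by
  cases n with
  | zero =>
    obtain rfl : i = 0 := by omega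
    exact γ.tgt_one x
  | succ n =>
    apply Subtype.ext
    funext ⟨k, hk⟩
    simp only [face, degen]
    have h1 := x.2.tgt_eq k hk
    have h2 := γ.one_mul (x.1 ⟨k, hk⟩)
    have h3 := src_eq (γ := γ) x.1 k hk
    have h4 := γ.mul_one (x.1 ⟨k, hk⟩)
    unfold faceFun degenFun at *
    grind

/-- The nerve of a groupoid. -/
def nerve : SimplicialStructure γ.Nerve where
  face := γ.face
  degen := γ.degen
  face_face := γ.face_face
  degen_degen := γ.degen_degen
  face_degen_lt := γ.face_degen_lt
  face_degen_self := γ.face_degen_self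
  face_degen_succ := γ.face_degen_succ
  face_degen_gt := γ.face_degen_gt

variable {G' X' : Type u}

/-- A morphism of groupoids. -/
structure Hom (γ : Gpd G X) (γ' : Gpd G' X') where
  arr : G → G'
  obj : X → X'
  src_arr : ∀ g, γ'.src (arr g) = obj (γ.src g)
  tgt_arr : ∀ g, γ'.tgt (arr g) = obj (γ.tgt g)
  map_mul : ∀ g h (e : γ.src g = γ.tgt h), arr (γ.mul g h e) =
    γ'.mul (arr g) (arr h) ((src_arr g).trans ((congrArg obj e).trans (tgt_arr h).symm))

theorem eq_inv_of_mul_eq_one (g h : G) (e : γ.src g = γ.tgt h) (hh : γ.mul g h e = γ.one (γ.tgt g)) :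
    h = γ.inv g := by
  have h1 := γ.mul_assoc (γ.inv g) g h (γ.src_inv g) e
  have h2 := γ.inv_mul g
  have h3 := γ.one_mul h
  have h4 := γ.mul_one (γ.inv g)
  have h5 := γ.src_inv g
  grind

theorem eq_one_of_mul_self (g : G) (e : γ.src g = γ.tgt g) (h : γ.mul g g e = g) :
    g = γ.one (γ.src g) := by
  have h1 := γ.mul_assoc (γ.inv g) g g (γ.src_inv g) e
  have h2 := γ.inv_mul g
  have h3 := γ.one_mul g
  grind

namespace Hom

variable {γ} {γ' : Gpd G' X'} (φ : Hom γ γ')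

theorem map_one (x : X) : φ.arr (γ.one x) = γ'.one (φ.obj x) := by
  have e : γ.src (γ.one x) = γ.tgt (γ.one x) := by rw [γ.src_one, γ.tgt_one]
  have h : γ.mul (γ.one x) (γ.one x) e = γ.one x := by
    have := γ.one_mul (γ.one x)
    have := γ.tgt_one x
    grind
  have h' := φ.map_mul _ _ e
  rw [h] at h'
  rw [γ'.eq_one_of_mul_self _ _ h'.symm, φ.src_arr, γ.src_one]

/-- The map induced on nerves. -/
def map : (n : ℕ) → γ.Nerve n → γ'.Nerve n
  | 0, x => φ.obj x
  | _ + 1, g => ⟨fun k => φ.arr (g.1 k), fun k hk => by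
      rw [φ.src_arr, φ.tgt_arr, g.2 k hk]⟩

theorem map_face (n i : ℕ) (hi : i ≤ n + 1) (x : γ.Nerve (n + 1)) :
    φ.map n (γ.face n i hi x) = γ'.face n i hi (φ.map (n + 1) x) := by
  cases n with
  | zero =>
    obtain rfl | rfl : i = 0 ∨ i = 1 := by omega
    · exact (φ.src_arr _).symm
    · exact (φ.tgt_arr _).symm
  | succ n =>
    apply Subtype.ext
    funext ⟨k, hk⟩
    simp only [map, face, faceFun]
    split_ifs
    · rfl
    · exact φ.map_mul _ _ _
    · rfl

theorem map_degen (n i : ℕ) (hi : i ≤ n) (x : γ.Nerve n) :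
    φ.map (n + 1) (γ.degen n i hi x) = γ'.degen n i hi (φ.map n x) := by
  cases n with
  | zero =>
    apply Subtype.ext
    funext k
    exact φ.map_one x
  | succ n =>
    apply Subtype.ext
    funext ⟨k, hk⟩
    simp only [map, degen, degenFun]
    split_ifs
    · rfl
    · rw [φ.map_one]
      congr 1
      unfold vertex
      split_ifs
      · exact (φ.tgt_arr _).symm
      · exact (φ.src_arr _).symm
    · rfl

theorem map_inv (g : G) : φ.arr (γ.inv g) = γ'.inv (φ.arr g) := by
  have e : γ.src g = γ.tgt (γ.inv g) := (γ.tgt_inv g).symm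
  have h := φ.map_mul g (γ.inv g) e
  rw [γ.mul_inv, map_one, ← φ.tgt_arr] at h
  exact γ'.eq_inv_of_mul_eq_one _ _ _ h.symm

end Hom

end Gpd

/-- A double groupoid: a square of groupoids `D ⇉ H` (source `s_H`, target `t_H`, product `·_H`),
`D ⇉ V` (source `s_V`, target `t_V`, product `·_V`), `H ⇉ M` and `V ⇉ M`. -/
structure DoubleGpd (D H V M : Type u) where
  DH : Gpd D H
  DV : Gpd D V
  HM : Gpd H M
  VM : Gpd V M
  src_src : ∀ α, HM.src (DH.src α) = VM.src (DV.src α)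
  tgt_tgt : ∀ α, HM.tgt (DH.tgt α) = VM.tgt (DV.tgt α)
  tgt_src : ∀ α, HM.tgt (DH.src α) = VM.src (DV.tgt α)
  src_tgt : ∀ α, HM.src (DH.tgt α) = VM.tgt (DV.src α)
  srcV_mulH : ∀ α β (e : DH.src α = DH.tgt β), DV.src (DH.mul α β e) =
    VM.mul (DV.src α) (DV.src β) (by rw [← src_src, ← src_tgt, e])
  tgtV_mulH : ∀ α β (e : DH.src α = DH.tgt β), DV.tgt (DH.mul α β e) =
    VM.mul (DV.tgt α) (DV.tgt β) (by rw [← tgt_src, ← tgt_tgt, e])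
  srcH_mulV : ∀ α β (e : DV.src α = DV.tgt β), DH.src (DV.mul α β e) =
    HM.mul (DH.src α) (DH.src β) (by rw [src_src, tgt_src, e])
  tgtH_mulV : ∀ α β (e : DV.src α = DV.tgt β), DH.tgt (DV.mul α β e) =
    HM.mul (DH.tgt α) (DH.tgt β) (by rw [src_tgt, tgt_tgt, e])
  /-- The interchange law. -/
  interchange : ∀ (α₁₁ α₁₂ α₂₁ α₂₂ : D)
    (h₁ : DH.src α₁₁ = DH.tgt α₁₂) (h₂ : DH.src α₂₁ = DH.tgt α₂₂)
    (v₁ : DV.src α₁₁ = DV.tgt α₂₁) (v₂ : DV.src α₁₂ = DV.tgt α₂₂),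
    DV.mul (DH.mul α₁₁ α₁₂ h₁) (DH.mul α₂₁ α₂₂ h₂)
        (by simp only [srcV_mulH, tgtV_mulH, v₁, v₂]) =
      DH.mul (DV.mul α₁₁ α₂₁ v₁) (DV.mul α₁₂ α₂₂ v₂)
        (by simp only [srcH_mulV, tgtH_mulV, h₁, h₂])

namespace DoubleGpd

variable {D H V M : Type u} (𝒟 : DoubleGpd D H V M)

/-- `s_V` is a morphism from `D ⇉ H` to `V ⇉ M`. -/
def srcV : Gpd.Hom 𝒟.DH 𝒟.VM where
  arr := 𝒟.DV.src
  obj := 𝒟.HM.src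
  src_arr α := (𝒟.src_src α).symm
  tgt_arr α := (𝒟.src_tgt α).symm
  map_mul := 𝒟.srcV_mulH

/-- `t_V` is a morphism from `D ⇉ H` to `V ⇉ M`. -/
def tgtV : Gpd.Hom 𝒟.DH 𝒟.VM where
  arr := 𝒟.DV.tgt
  obj := 𝒟.HM.tgt
  src_arr α := (𝒟.tgt_src α).symm
  tgt_arr α := (𝒟.tgt_tgt α).symm
  map_mul := 𝒟.tgtV_mulH

/-- `s_H` is a morphism from `D ⇉ V` to `H ⇉ M`. -/
def srcH : Gpd.Hom 𝒟.DV 𝒟.HM where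
  arr := 𝒟.DH.src
  obj := 𝒟.VM.src
  src_arr α := 𝒟.src_src α
  tgt_arr α := 𝒟.tgt_src α
  map_mul := 𝒟.srcH_mulV

/-- `t_H` is a morphism from `D ⇉ V` to `H ⇉ M`. -/
def tgtH : Gpd.Hom 𝒟.DV 𝒟.HM where
  arr := 𝒟.DH.tgt
  obj := 𝒟.VM.tgt
  src_arr α := 𝒟.src_tgt α
  tgt_arr α := 𝒟.tgt_tgt α
  map_mul := 𝒟.tgtH_mulV

/-- The identity map of `D ⇉ V` is a morphism from `V ⇉ M` to `D ⇉ H`. -/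
def oneV : Gpd.Hom 𝒟.VM 𝒟.DH where
  arr := 𝒟.DV.one
  obj := 𝒟.HM.one
  src_arr := 𝒟.srcH.map_one
  tgt_arr := 𝒟.tgtH.map_one
  map_mul θ θ' e := by
    have e1 : 𝒟.DH.src (𝒟.DV.one θ) = 𝒟.DH.tgt (𝒟.DV.one θ') :=
      (𝒟.srcH.map_one θ).trans ((congrArg _ e).trans (𝒟.tgtH.map_one θ').symm)
    have hs : ∀ θ, 𝒟.DV.src (𝒟.DV.one θ) = 𝒟.DV.tgt (𝒟.DV.one θ) := fun θ =>
      (𝒟.DV.src_one θ).trans (𝒟.DV.tgt_one θ).symm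
    have hm : ∀ θ, 𝒟.DV.mul (𝒟.DV.one θ) (𝒟.DV.one θ) (hs θ) = 𝒟.DV.one θ := fun θ => by
      have := 𝒟.DV.one_mul (𝒟.DV.one θ)
      have := 𝒟.DV.tgt_one θ
      grind
    have h := 𝒟.interchange _ _ _ _ e1 e1 (hs θ) (hs θ')
    simp only [hm] at h
    have h' := 𝒟.DV.eq_one_of_mul_self _ _ h
    rw [h']
    congr 1
    simp only [srcV_mulH, Gpd.src_one]

/-- The identity map of `D ⇉ H` is a morphism from `H ⇉ M` to `D ⇉ V`. -/
def oneH : Gpd.Hom 𝒟.HM 𝒟.DV where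
  arr := 𝒟.DH.one
  obj := 𝒟.VM.one
  src_arr := 𝒟.srcV.map_one
  tgt_arr := 𝒟.tgtV.map_one
  map_mul θ θ' e := by
    have e1 : 𝒟.DV.src (𝒟.DH.one θ) = 𝒟.DV.tgt (𝒟.DH.one θ') :=
      (𝒟.srcV.map_one θ).trans ((congrArg _ e).trans (𝒟.tgtV.map_one θ').symm)
    have hs : ∀ θ, 𝒟.DH.src (𝒟.DH.one θ) = 𝒟.DH.tgt (𝒟.DH.one θ) := fun θ =>
      (𝒟.DH.src_one θ).trans (𝒟.DH.tgt_one θ).symm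
    have hm : ∀ θ, 𝒟.DH.mul (𝒟.DH.one θ) (𝒟.DH.one θ) (hs θ) = 𝒟.DH.one θ := fun θ => by
      have := 𝒟.DH.one_mul (𝒟.DH.one θ)
      have := 𝒟.DH.tgt_one θ
      grind
    have h := 𝒟.interchange _ _ _ _ (hs θ) (hs θ') e1 e1
    simp only [hm] at h
    have h' := 𝒟.DH.eq_one_of_mul_self _ _ h.symm
    rw [h']
    congr 1
    simp only [srcH_mulV, Gpd.src_one]

/-- The inverse map of `D ⇉ V` is a morphism from `D ⇉ H` to itself. -/
def invV : Gpd.Hom 𝒟.DH 𝒟.DH where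
  arr := 𝒟.DV.inv
  obj := 𝒟.HM.inv
  src_arr := 𝒟.srcH.map_inv
  tgt_arr := 𝒟.tgtH.map_inv
  map_mul α β e := by
    have e1 : 𝒟.DH.src (𝒟.DV.inv α) = 𝒟.DH.tgt (𝒟.DV.inv β) :=
      (𝒟.srcH.map_inv α).trans ((congrArg _ e).trans (𝒟.tgtH.map_inv β).symm)
    have h := 𝒟.interchange _ _ _ _ e e1 (𝒟.DV.tgt_inv α).symm (𝒟.DV.tgt_inv β).symm
    simp only [𝒟.DV.mul_inv] at h
    refine (𝒟.DV.eq_inv_of_mul_eq_one _ _ _ (h.trans ?_)).symm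
    simp only [𝒟.tgtV_mulH]
    exact (𝒟.oneV.map_mul _ _ _).symm

/-- The componentwise product of `D_H^{(q)} ⇉ V^{(q)}`. -/
def levelMul : (q : ℕ) → (a b : 𝒟.DH.Nerve q) → 𝒟.srcV.map q a = 𝒟.tgtV.map q b → 𝒟.DH.Nerve q
  | 0, a, b, e => 𝒟.HM.mul a b e
  | _ + 1, a, b, e =>
    ⟨fun k => 𝒟.DV.mul (a.1 k) (b.1 k) (congrFun (congrArg Subtype.val e) k), fun k hk =>
      (𝒟.srcH_mulV _ _ _).trans
        ((𝒟.HM.mul_congr (a.2 k hk) (b.2 k hk) _).trans (𝒟.tgtH_mulV _ _ _).symm)⟩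

/-- The groupoid `D_H^{(q)} ⇉ V^{(q)}` of horizontally composable `q`-strings, with componentwise
structure maps; for `q = 0` it is `H ⇉ M`. -/
def level (q : ℕ) : Gpd (𝒟.DH.Nerve q) (𝒟.VM.Nerve q) where
  src := 𝒟.srcV.map q
  tgt := 𝒟.tgtV.map q
  mul := 𝒟.levelMul q
  one := 𝒟.oneV.map q
  inv := 𝒟.invV.map q
  src_mul a b e := by
    cases q with
    | zero => exact 𝒟.HM.src_mul a b e
    | succ q => exact Subtype.ext (funext fun k => 𝒟.DV.src_mul _ _ _)
  tgt_mul a b e := by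
    cases q with
    | zero => exact 𝒟.HM.tgt_mul a b e
    | succ q => exact Subtype.ext (funext fun k => 𝒟.DV.tgt_mul _ _ _)
  src_one a := by
    cases q with
    | zero => exact 𝒟.HM.src_one a
    | succ q => exact Subtype.ext (funext fun k => 𝒟.DV.src_one _)
  tgt_one a := by
    cases q with
    | zero => exact 𝒟.HM.tgt_one a
    | succ q => exact Subtype.ext (funext fun k => 𝒟.DV.tgt_one _)
  src_inv a := by
    cases q with
    | zero => exact 𝒟.HM.src_inv a
    | succ q => exact Subtype.ext (funext fun k => 𝒟.DV.src_inv _)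
  tgt_inv a := by
    cases q with
    | zero => exact 𝒟.HM.tgt_inv a
    | succ q => exact Subtype.ext (funext fun k => 𝒟.DV.tgt_inv _)
  mul_assoc a b c e e' := by
    cases q with
    | zero => exact 𝒟.HM.mul_assoc a b c e e'
    | succ q => exact Subtype.ext (funext fun k => 𝒟.DV.mul_assoc _ _ _ _
        (congrFun (congrArg Subtype.val e') k))
  one_mul a := by
    cases q with
    | zero => exact 𝒟.HM.one_mul a
    | succ q => exact Subtype.ext (funext fun k => 𝒟.DV.one_mul _)
  mul_one a := by
    cases q with
    | zero => exact 𝒟.HM.mul_one a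
    | succ q => exact Subtype.ext (funext fun k => 𝒟.DV.mul_one _)
  mul_inv a := by
    cases q with
    | zero => exact 𝒟.HM.mul_inv a
    | succ q => exact Subtype.ext (funext fun k => 𝒟.DV.mul_inv _)
  inv_mul a := by
    cases q with
    | zero => exact 𝒟.HM.inv_mul a
    | succ q => exact Subtype.ext (funext fun k => 𝒟.DV.inv_mul _)

/-- The face maps of `D_H^{(•)}` and `V^{(•)}` form morphisms of groupoids. -/
def faceHom (q i : ℕ) (hi : i ≤ q + 1) : Gpd.Hom (𝒟.level (q + 1)) (𝒟.level q) where
  arr := 𝒟.DH.face q i hi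
  obj := 𝒟.VM.face q i hi
  src_arr a := 𝒟.srcV.map_face q i hi a
  tgt_arr a := 𝒟.tgtV.map_face q i hi a
  map_mul a b e := by
    cases q with
    | zero =>
      obtain rfl | rfl : i = 0 ∨ i = 1 := by omega
      · exact 𝒟.srcH_mulV _ _ _
      · exact 𝒟.tgtH_mulV _ _ _
    | succ q =>
      apply Subtype.ext
      funext ⟨k, hk⟩
      simp only [level, levelMul, Gpd.face, Gpd.faceFun]
      split_ifs
      · rfl
      · exact (𝒟.interchange _ _ _ _ _ _ _ _).symm
      · rfl

/-- The degeneracy maps of `D_H^{(•)}` and `V^{(•)}` form morphisms of groupoids. -/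
def degenHom (q i : ℕ) (hi : i ≤ q) : Gpd.Hom (𝒟.level q) (𝒟.level (q + 1)) where
  arr := 𝒟.DH.degen q i hi
  obj := 𝒟.VM.degen q i hi
  src_arr a := 𝒟.srcV.map_degen q i hi a
  tgt_arr a := 𝒟.tgtV.map_degen q i hi a
  map_mul a b e := by
    cases q with
    | zero => exact Subtype.ext (funext fun k => 𝒟.oneH.map_mul _ _ _)
    | succ q =>
      apply Subtype.ext
      funext ⟨k, hk⟩
      simp only [level, levelMul, Gpd.degen, Gpd.degenFun]
      split_ifs
      · rfl
      · have hs := congrFun (congrArg Subtype.val e)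
        refine Eq.trans ?_ (𝒟.oneH.map_mul _ _ ?_)
        · refine congrArg 𝒟.DH.one ?_
          simp only [Gpd.vertex]
          split_ifs
          · exact 𝒟.tgtH_mulV _ _ _
          · exact 𝒟.srcH_mulV _ _ _
        · simp only [Gpd.vertex]
          split_ifs
          · exact (𝒟.src_tgt _).trans ((congrArg _ (hs _)).trans (𝒟.tgt_tgt _).symm)
          · exact (𝒟.src_src _).trans ((congrArg _ (hs _)).trans (𝒟.tgt_src _).symm)
      · rfl

end DoubleGpd

/-- A bisimplicial structure on a two-parameter family of sets `obj p q`: the vertical maps change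
`q`, the horizontal maps change `p`. -/
structure BisimplicialStructure (obj : ℕ → ℕ → Type u) where
  vert : ∀ p, SimplicialStructure (fun q => obj p q)
  horiz : ∀ q, SimplicialStructure (fun p => obj p q)
  vface_hface : ∀ (p q i j : ℕ) (hi : i ≤ p + 1) (hj : j ≤ q + 1) (x : obj (p + 1) (q + 1)),
    (vert p).face q j hj ((horiz (q + 1)).face p i hi x) =
      (horiz q).face p i hi ((vert (p + 1)).face q j hj x)
  vdegen_hdegen : ∀ (p q i j : ℕ) (hi : i ≤ p) (hj : j ≤ q) (x : obj p q),
    (vert (p + 1)).degen q j hj ((horiz q).degen p i hi x) =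
      (horiz (q + 1)).degen p i hi ((vert p).degen q j hj x)
  vface_hdegen : ∀ (p q i j : ℕ) (hi : i ≤ p) (hj : j ≤ q + 1) (x : obj p (q + 1)),
    (vert (p + 1)).face q j hj ((horiz (q + 1)).degen p i hi x) =
      (horiz q).degen p i hi ((vert p).face q j hj x)
  vdegen_hface : ∀ (p q i j : ℕ) (hi : i ≤ p + 1) (hj : j ≤ q) (x : obj (p + 1) q),
    (vert p).degen q j hj ((horiz q).face p i hi x) =
      (horiz (q + 1)).face p i hi ((vert (p + 1)).degen q j hj x)

namespace DoubleGpd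

variable {D H V M : Type u} (𝒟 : DoubleGpd D H V M)

/-- The double nerve: `N_{p,q}` consists of the composable `p × q` arrays in `D`, with
`N_{0,q} = V^{(q)}`, `N_{p,0} = H^{(p)}` and `N_{0,0} = M`. An array is a `p`-string in the groupoid
`D_H^{(q)} ⇉ V^{(q)}`. -/
def Nerve (p q : ℕ) : Type u := (𝒟.level q).Nerve p

/-- The bisimplicial structure of the double nerve. -/
def nerve : BisimplicialStructure 𝒟.Nerve where
  horiz q := (𝒟.level q).nerve
  vert p :=
    { face := fun q i hi => (𝒟.faceHom q i hi).map p
      degen := fun q i hi => (𝒟.degenHom q i hi).map p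
      face_face := fun q i j hij hj x => by
        cases p with
        | zero => exact 𝒟.VM.face_face q i j hij hj x
        | succ p => exact Subtype.ext (funext fun k => 𝒟.DH.face_face q i j hij hj _)
      degen_degen := fun q i j hij hj x => by
        cases p with
        | zero => exact 𝒟.VM.degen_degen q i j hij hj x
        | succ p => exact Subtype.ext (funext fun k => 𝒟.DH.degen_degen q i j hij hj _)
      face_degen_lt := fun q i j hij hj x => by
        cases p with
        | zero => exact 𝒟.VM.face_degen_lt q i j hij hj x
        | succ p => exact Subtype.ext (funext fun k => 𝒟.DH.face_degen_lt q i j hij hj _)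
      face_degen_self := fun q i hi x => by
        cases p with
        | zero => exact 𝒟.VM.face_degen_self q i hi x
        | succ p => exact Subtype.ext (funext fun k => 𝒟.DH.face_degen_self q i hi _)
      face_degen_succ := fun q i hi x => by
        cases p with
        | zero => exact 𝒟.VM.face_degen_succ q i hi x
        | succ p => exact Subtype.ext (funext fun k => 𝒟.DH.face_degen_succ q i hi _)
      face_degen_gt := fun q i j hij hi x => by
        cases p with
        | zero => exact 𝒟.VM.face_degen_gt q i j hij hi x
        | succ p => exact Subtype.ext (funext fun k => 𝒟.DH.face_degen_gt q i j hij hi _) }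
  vface_hface p q i j hi hj x := (𝒟.faceHom q j hj).map_face p i hi x
  vdegen_hdegen p q i j hi hj x := (𝒟.degenHom q j hj).map_degen p i hi x
  vface_hdegen p q i j hi hj x := (𝒟.faceHom q j hj).map_degen p i hi x
  vdegen_hface p q i j hi hj x := (𝒟.degenHom q j hj).map_face p i hi x

end DoubleGpd

namespace BisimplicialStructure

variable {obj : ℕ → ℕ → Type u} (X : BisimplicialStructure obj)

/-- The pairs `(p, q)` with `p + q = r`. -/
abbrev Index (r : ℕ) : Type := Finset.HasAntidiagonal.antidiagonal r

/-- Families `x = (x_0, …, x_r)` with `x_p ∈ X_{p,r-p}`; the entry `x_p` is `x.entry p (r - p)`. -/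
def Family (obj : ℕ → ℕ → Type u) (r : ℕ) : Type u :=
  ∀ a : Index r, obj a.1.1 a.1.2

namespace Family

variable {r : ℕ}

def entry (x : Family obj r) (p q : ℕ) (h : p + q = r) : obj p q :=
  x ⟨(p, q), Finset.HasAntidiagonal.mem_antidiagonal.2 h⟩

def mk (f : ∀ p q, p + q = r → obj p q) : Family obj r :=
  fun a => f a.1.1 a.1.2 (Finset.HasAntidiagonal.mem_antidiagonal.1 a.2)

theorem ext {x y : Family obj r} (h : ∀ p q e, x.entry p q e = y.entry p q e) : x = y :=
  funext fun ⟨(p, q), e⟩ => h p q (Finset.HasAntidiagonal.mem_antidiagonal.1 e)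

theorem entry_mk (f : ∀ p q, p + q = r → obj p q) (p q : ℕ) (h : p + q = r) :
    (mk f).entry p q h = f p q h := rfl

end Family

/-- The families with `v_0 (x_p) = h_{p+1} (x_{p+1})` for `0 ≤ p < r`. -/
def barSet (r : ℕ) : Set (Family obj r) :=
  {x | ∀ (p q : ℕ) (h : p + (q + 1) = r),
    (X.vert p).face q 0 (by omega) (x.entry p (q + 1) h) =
      (X.horiz q).face p (p + 1) le_rfl (x.entry (p + 1) q (by omega))}

/-- The `r`-simplices of the bar construction. -/
def Bar (r : ℕ) : Type u := X.barSet r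

/-- The face map
`f_i (x_0, …, x_r) = (v_i x_0, v_{i-1} x_1, …, v_1 x_{i-1}, h_i x_{i+1}, …, h_i x_r)`. -/
def barFace (r i : ℕ) (hi : i ≤ r + 1) (x : Family obj (r + 1)) : Family obj r :=
  .mk fun p q e =>
    if h : p < i then (X.vert p).face q (i - p) (by omega) (x.entry p (q + 1) (by omega))
    else (X.horiz q).face p i (by omega) (x.entry (p + 1) q (by omega))

/-- The degeneracy map
`δ_i (x_0, …, x_r) = (μ_i x_0, μ_{i-1} x_1, …, μ_0 x_i, η_i x_i, …, η_i x_r)`. -/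
def barDegen (r i : ℕ) (hi : i ≤ r) (x : Family obj r) : Family obj (r + 1) :=
  .mk fun
    | 0, 0, e => absurd e (by omega)
    | 0, q + 1, e => (X.vert 0).degen q i (by omega) (x.entry 0 q (by omega))
    | p + 1, 0, e => (X.horiz 0).degen p i (by omega) (x.entry p 0 (by omega))
    | p + 1, q + 1, e =>
      if h : p + 1 ≤ i then
        (X.vert (p + 1)).degen q (i - (p + 1)) (by omega) (x.entry (p + 1) q (by omega))
      else (X.horiz (q + 1)).degen p i (by omega) (x.entry p (q + 1) (by omega))

section

variable {X} {r i p q : ℕ}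

theorem entry_barFace_of_lt (hi : i ≤ r + 1) (x : Family obj (r + 1)) (e : p + q = r)
    (h : p < i) : (X.barFace r i hi x).entry p q e =
      (X.vert p).face q (i - p) (by omega) (x.entry p (q + 1) (by omega)) :=
  dif_pos h

theorem entry_barFace_of_ge (hi : i ≤ r + 1) (x : Family obj (r + 1)) (e : p + q = r)
    (h : i ≤ p) : (X.barFace r i hi x).entry p q e =
      (X.horiz q).face p i (by omega) (x.entry (p + 1) q (by omega)) :=
  dif_neg (not_lt.2 h)

theorem entry_barDegen_of_le (hi : i ≤ r) (x : Family obj r) (e : p + (q + 1) = r + 1)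
    (h : p ≤ i) : (X.barDegen r i hi x).entry p (q + 1) e =
      (X.vert p).degen q (i - p) (by omega) (x.entry p q (by omega)) := by
  cases p with
  | zero => rfl
  | succ p => exact dif_pos h

theorem entry_barDegen_of_gt (hi : i ≤ r) (x : Family obj r) (e : (p + 1) + q = r + 1)
    (h : i ≤ p) : (X.barDegen r i hi x).entry (p + 1) q e =
      (X.horiz q).degen p i (by omega) (x.entry p q (by omega)) := by
  cases q with
  | zero => rfl
  | succ q => exact dif_neg (by omega)

theorem barFace_mem (hi : i ≤ r + 1) (x : Family obj (r + 1)) (hx : x ∈ X.barSet (r + 1)) :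
    X.barFace r i hi x ∈ X.barSet r := by
  intro p q e
  have h0 := hx p (q + 1) (by omega)
  have h1 := hx (p + 1) q (by omega)
  rcases lt_trichotomy (p + 1) i with h | h | h
  · rw [entry_barFace_of_lt _ _ _ (by omega), entry_barFace_of_lt _ _ _ h, ← X.vface_hface, ← h0]
    exact (X.vert p).face_face' (by omega) (by omega) (by omega) _ _
  · subst h
    rw [entry_barFace_of_lt _ _ _ (by omega), entry_barFace_of_ge _ _ _ (by omega),
      (X.vert p).face_face' (j := 0) (l := 0) (by omega) (by omega) (by omega) (by omega) (by omega)
        (h3 := by omega) (h4 := by omega),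
      h0, X.vface_hface, h1]
    exact (X.horiz q).face_face' (by omega) (by omega) (by omega) _ _
  · rw [entry_barFace_of_ge _ _ _ (by omega), entry_barFace_of_ge _ _ _ (by omega), X.vface_hface,
      h1]
    exact (X.horiz q).face_face' (by omega) (by omega) (by omega) _ _

theorem barDegen_mem (hi : i ≤ r) (x : Family obj r) (hx : x ∈ X.barSet r) :
    X.barDegen r i hi x ∈ X.barSet (r + 1) := by
  intro p q e
  rcases lt_trichotomy p i with h | h | h
  · obtain ⟨q, rfl⟩ : ∃ l, q = l + 1 := ⟨q - 1, by omega⟩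
    rw [entry_barDegen_of_le _ _ _ (by omega), entry_barDegen_of_le _ _ _ (by omega),
      (X.vert p).face_degen_lt' (j := i - (p + 1)) (l := 0) (by omega) (by omega) (by omega) _ _
        (h3 := by omega) (h4 := by omega), hx p q (by omega), X.vdegen_hface]
  · subst h
    rw [entry_barDegen_of_le _ _ _ (by omega), entry_barDegen_of_gt _ _ _ (by omega),
      (X.vert p).face_degen_self' (by omega), (X.horiz q).face_degen_self' (by omega)]
  · obtain ⟨p, rfl⟩ : ∃ l, p = l + 1 := ⟨p - 1, by omega⟩
    rw [entry_barDegen_of_gt _ _ _ (by omega), entry_barDegen_of_gt _ _ _ (by omega),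
      X.vface_hdegen, hx p q (by omega)]
    exact ((X.horiz q).face_degen_gt' (by omega) (by omega) (by omega) _ _).symm

theorem barFace_barFace {j : ℕ} (hij : i ≤ j) (hj : j ≤ r + 1) (x : Family obj (r + 2)) :
    X.barFace r i (by omega) (X.barFace (r + 1) (j + 1) (by omega) x) =
      X.barFace r j hj (X.barFace (r + 1) i (by omega) x) := by
  refine Family.ext fun p q e => ?_
  rcases lt_or_ge p i with h | h
  · rw [entry_barFace_of_lt _ _ _ h, entry_barFace_of_lt _ _ _ (by omega),
      entry_barFace_of_lt _ _ _ (by omega), entry_barFace_of_lt _ _ _ (by omega)]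
    exact (X.vert p).face_face' (by omega) (by omega) (by omega) _ _
  · rcases lt_or_ge p j with h' | h'
    · rw [entry_barFace_of_ge _ _ _ h, entry_barFace_of_lt _ _ _ (by omega),
        entry_barFace_of_lt _ _ _ (by omega), entry_barFace_of_ge _ _ _ (by omega),
        X.vface_hface]
      congr 2
      omega
    · rw [entry_barFace_of_ge _ _ _ h, entry_barFace_of_ge _ _ _ (by omega),
        entry_barFace_of_ge _ _ _ (by omega), entry_barFace_of_ge _ _ _ (by omega)]
      exact (X.horiz q).face_face' (by omega) (by omega) (by omega) _ _

theorem barDegen_barDegen {j : ℕ} (hij : i ≤ j) (hj : j ≤ r) (x : Family obj r) :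
    X.barDegen (r + 1) i (by omega) (X.barDegen r j hj x) =
      X.barDegen (r + 1) (j + 1) (by omega) (X.barDegen r i (by omega) x) := by
  refine Family.ext fun p q e => ?_
  rcases le_or_gt p i with h | h
  · obtain ⟨q, rfl⟩ : ∃ l, q = l + 2 := ⟨q - 2, by omega⟩
    rw [entry_barDegen_of_le _ _ _ h, entry_barDegen_of_le _ _ _ (by omega),
      entry_barDegen_of_le _ _ _ (by omega), entry_barDegen_of_le _ _ _ (by omega)]
    exact (X.vert p).degen_degen' (by omega) (by omega) (by omega) _ _
  · obtain ⟨p, rfl⟩ : ∃ l, p = l + 1 := ⟨p - 1, by omega⟩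
    rcases le_or_gt p j with h' | h'
    · obtain ⟨q, rfl⟩ : ∃ l, q = l + 1 := ⟨q - 1, by omega⟩
      rw [entry_barDegen_of_gt _ _ _ (by omega), entry_barDegen_of_le _ _ _ (by omega),
        entry_barDegen_of_le _ _ _ (by omega), entry_barDegen_of_gt _ _ _ (by omega),
        X.vdegen_hdegen]
      congr 2
      omega
    · obtain ⟨p, rfl⟩ : ∃ l, p = l + 1 := ⟨p - 1, by omega⟩
      rw [entry_barDegen_of_gt _ _ _ (by omega), entry_barDegen_of_gt _ _ _ (by omega),
        entry_barDegen_of_gt _ _ _ (by omega), entry_barDegen_of_gt _ _ _ (by omega)]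
      exact (X.horiz q).degen_degen' (by omega) (by omega) (by omega) _ _

theorem barFace_barDegen_lt {j : ℕ} (hij : i ≤ j) (hj : j ≤ r) (x : Family obj (r + 1)) :
    X.barFace (r + 1) i (by omega) (X.barDegen (r + 1) (j + 1) (by omega) x) =
      X.barDegen r j hj (X.barFace r i (by omega) x) := by
  refine Family.ext fun p q e => ?_
  rcases lt_or_ge p i with h | h
  · obtain ⟨q, rfl⟩ : ∃ l, q = l + 1 := ⟨q - 1, by omega⟩
    rw [entry_barFace_of_lt _ _ _ h, entry_barDegen_of_le _ _ _ (by omega),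
      entry_barDegen_of_le _ _ _ (by omega), entry_barFace_of_lt _ _ _ h]
    exact (X.vert p).face_degen_lt' (by omega) (by omega) (by omega) _ _
  · rcases le_or_gt p j with h' | h'
    · obtain ⟨q, rfl⟩ : ∃ l, q = l + 1 := ⟨q - 1, by omega⟩
      rw [entry_barFace_of_ge _ _ _ h, entry_barDegen_of_le _ _ _ (by omega),
        entry_barDegen_of_le _ _ _ (by omega), entry_barFace_of_ge _ _ _ h, X.vdegen_hface]
      congr 2
      omega
    · obtain ⟨p, rfl⟩ : ∃ l, p = l + 1 := ⟨p - 1, by omega⟩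
      rw [entry_barFace_of_ge _ _ _ h, entry_barDegen_of_gt _ _ _ (by omega),
        entry_barDegen_of_gt _ _ _ (by omega), entry_barFace_of_ge _ _ _ (by omega)]
      exact (X.horiz q).face_degen_lt' (by omega) (by omega) (by omega) _ _

theorem barFace_barDegen_self {j : ℕ} (h : i = j ∨ i = j + 1) (hj : j ≤ r) (x : Family obj r) :
    X.barFace r i (by omega) (X.barDegen r j hj x) = x := by
  refine Family.ext fun p q e => ?_
  rcases lt_or_ge p i with h' | h'
  · rw [entry_barFace_of_lt _ _ _ h', entry_barDegen_of_le _ _ _ (by omega)]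
    exact (X.vert p).face_degen_self' (by omega) _ _
  · rw [entry_barFace_of_ge _ _ _ h', entry_barDegen_of_gt _ _ _ (by omega)]
    exact (X.horiz q).face_degen_self' (by omega) _ _

theorem barFace_barDegen_gt {j : ℕ} (hij : j < i) (hi : i ≤ r + 1) (x : Family obj (r + 1)) :
    X.barFace (r + 1) (i + 1) (by omega) (X.barDegen (r + 1) j (by omega) x) =
      X.barDegen r j (by omega) (X.barFace r i hi x) := by
  refine Family.ext fun p q e => ?_
  rcases le_or_gt p j with h | h
  · obtain ⟨q, rfl⟩ : ∃ l, q = l + 1 := ⟨q - 1, by omega⟩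
    rw [entry_barFace_of_lt _ _ _ (by omega), entry_barDegen_of_le _ _ _ (by omega),
      entry_barDegen_of_le _ _ _ (by omega), entry_barFace_of_lt _ _ _ (by omega)]
    exact (X.vert p).face_degen_gt' (by omega) (by omega) (by omega) _ _
  · obtain ⟨p, rfl⟩ : ∃ l, p = l + 1 := ⟨p - 1, by omega⟩
    rcases lt_or_ge p i with h' | h'
    · rw [entry_barFace_of_lt _ _ _ (by omega), entry_barDegen_of_gt _ _ _ (by omega),
        entry_barDegen_of_gt _ _ _ (by omega), entry_barFace_of_lt _ _ _ (by omega),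
        X.vface_hdegen]
      congr 2
      omega
    · rw [entry_barFace_of_ge _ _ _ (by omega), entry_barDegen_of_gt _ _ _ (by omega),
        entry_barDegen_of_gt _ _ _ (by omega), entry_barFace_of_ge _ _ _ (by omega)]
      exact (X.horiz q).face_degen_gt' (by omega) (by omega) (by omega) _ _

end

/-- The simplicial structure of the bar construction. -/
def bar : SimplicialStructure X.Bar where
  face r i hi x := ⟨X.barFace r i hi x.1, barFace_mem hi x.1 x.2⟩
  degen r i hi x := ⟨X.barDegen r i hi x.1, barDegen_mem hi x.1 x.2⟩
  face_face _ _ _ hij hj x := Subtype.ext (barFace_barFace hij hj x.1)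
  degen_degen _ _ _ hij hj x := Subtype.ext (barDegen_barDegen hij hj x.1)
  face_degen_lt _ _ _ hij hj x := Subtype.ext (barFace_barDegen_lt hij hj x.1)
  face_degen_self _ _ hi x := Subtype.ext (barFace_barDegen_self (.inl rfl) hi x.1)
  face_degen_succ _ _ hi x := Subtype.ext (barFace_barDegen_self (.inr rfl) hi x.1)
  face_degen_gt _ _ _ hij hi x := Subtype.ext (barFace_barDegen_gt hij hi x.1)

end BisimplicialStructure

namespace SimplicialStructure

variable {obj : ℕ → Type u} (S : SimplicialStructure obj) (σ : ∀ n, SmoothStructure (obj n))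

/-- With respect to the smooth structures `σ n` on the sets `obj n`, the given simplicial structure
makes up a simplicial manifold: the face maps are surjective submersions and the degeneracy maps
are embeddings. -/
structure IsSimplicialManifold : Prop where
  face_submersion : ∀ (n i : ℕ) (hi : i ≤ n + 1), (σ (n + 1)).Submersion (σ n) (S.face n i hi)
  face_surjective : ∀ (n i : ℕ) (hi : i ≤ n + 1), Function.Surjective (S.face n i hi)
  degen_embedding : ∀ (n i : ℕ) (hi : i ≤ n), (σ n).Embedding (σ (n + 1)) (S.degen n i hi)

/-- The space `Λ_{m+1,k}` of `(m+1,k)`-horns: the tuples `(x_0, …, x_{k-1}, x_{k+1}, …, x_{m+1})` of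
`m`-simplices with `f_i x_j = f_{j-1} x_i` for `i < j` (no condition for `m = 0`). -/
def hornSet : (m : ℕ) → (k : Fin (m + 2)) → Set ({i : Fin (m + 2) // i ≠ k} → obj m)
  | 0, _ => Set.univ
  | m + 1, k => {x | ∀ (i j : {i : Fin (m + 3) // i ≠ k}) (hij : i.1.1 < j.1.1),
      S.face m i.1.1 (by omega) (x j) = S.face m (j.1.1 - 1) (by omega) (x i)}

/-- The horn map `λ_{m+1,k}`. -/
def hornMap (m : ℕ) (k : Fin (m + 2)) (x : obj (m + 1)) : S.hornSet m k :=
  ⟨fun i => S.face m i.1.1 (by omega) x, by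
    cases m with
    | zero => trivial
    | succ m => exact fun i j hij => S.face_face' (by omega) (by omega) rfl _ _⟩

/-- The smooth structure of the space of horns, as a submanifold of a product of copies of
`obj m`. -/
noncomputable def hornSmooth (m : ℕ) (k : Fin (m + 2)) : SmoothStructure (S.hornSet m k) :=
  (SmoothStructure.pi fun _ : {i : Fin (m + 2) // i ≠ k} => σ m).sub (S.hornSet m k)

/-- The spaces of horns are smooth: they are embedded submanifolds. -/
def HornsAreSmooth : Prop :=
  ∀ (m : ℕ) (k : Fin (m + 2)),
    (SmoothStructure.pi fun _ : {i : Fin (m + 2) // i ≠ k} => σ m).IsSubmanifold (S.hornSet m k)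

/-- A Lie `n`-groupoid: a simplicial manifold whose horn maps `λ_{q,k}` are surjective submersions
for all `q ≥ 1` and diffeomorphisms for all `q > n` (here `q = m + 1`). -/
structure IsLieGroupoid (n : ℕ) : Prop where
  isSimplicialManifold : S.IsSimplicialManifold σ
  hornsAreSmooth : S.HornsAreSmooth σ
  horn_surjective : ∀ (m : ℕ) (k : Fin (m + 2)), Function.Surjective (S.hornMap m k)
  horn_submersion : ∀ (m : ℕ) (k : Fin (m + 2)),
    (σ (m + 1)).Submersion (S.hornSmooth σ m k) (S.hornMap m k)
  horn_diffeo : ∀ (m : ℕ) (k : Fin (m + 2)), n < m + 1 →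
    (σ (m + 1)).Diffeo (S.hornSmooth σ m k) (S.hornMap m k)

/-- A local Lie `n`-groupoid: a simplicial manifold whose horn maps `λ_{q,k}` are submersions for all
`q ≥ 1` and injective étale for all `q > n` (here `q = m + 1`). -/
structure IsLocalLieGroupoid (n : ℕ) : Prop where
  isSimplicialManifold : S.IsSimplicialManifold σ
  hornsAreSmooth : S.HornsAreSmooth σ
  horn_submersion : ∀ (m : ℕ) (k : Fin (m + 2)),
    (σ (m + 1)).Submersion (S.hornSmooth σ m k) (S.hornMap m k)
  horn_injective : ∀ (m : ℕ) (k : Fin (m + 2)), n < m + 1 → Function.Injective (S.hornMap m k)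
  horn_etale : ∀ (m : ℕ) (k : Fin (m + 2)), n < m + 1 →
    (σ (m + 1)).Etale (S.hornSmooth σ m k) (S.hornMap m k)

end SimplicialStructure

namespace BisimplicialStructure

variable {obj : ℕ → ℕ → Type u} (X : BisimplicialStructure obj)
  (σ : ∀ p q, SmoothStructure (obj p q))

/-- The product smooth structure on `X_{0,r} × X_{1,r-1} × ⋯ × X_{r,0}`. -/
noncomputable def familySmooth (r : ℕ) : SmoothStructure (Family obj r) :=
  SmoothStructure.pi fun a : Index r => σ a.1.1 a.1.2

/-- The smooth structure of the iterated fiber product `W̄_r X`. -/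
noncomputable def barSmooth (r : ℕ) : SmoothStructure (X.Bar r) :=
  (familySmooth σ r).sub (X.barSet r)

/-- The iterated fiber products `W̄_r X` are smooth: they are embedded submanifolds. -/
def BarIsSmooth : Prop :=
  ∀ r, (familySmooth σ r).IsSubmanifold (X.barSet r)

end BisimplicialStructure

namespace Gpd

variable {G X : Type u} (γ : Gpd G X) (σG : SmoothStructure G) (σX : SmoothStructure X)

/-- `G ⇉ X` is a Lie groupoid: source and target are submersions, and multiplication (on the fiber
product of source and target), identity and inverse are smooth. -/
structure IsLie : Prop where
  src_submersion : σG.Submersion σX γ.src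
  tgt_submersion : σG.Submersion σX γ.tgt
  mul_smooth : SmoothStructure.Smooth ((σG.prod σG).sub {p | γ.src p.1 = γ.tgt p.2}) σG
    (fun p => γ.mul p.1.1 p.1.2 p.2)
  one_smooth : σX.Smooth σG γ.one
  inv_smooth : σG.Smooth σG γ.inv

/-- The smooth structures on the levels of the nerve. -/
noncomputable def nerveSmooth : (n : ℕ) → SmoothStructure (γ.Nerve n)
  | 0 => σX
  | n + 1 => (SmoothStructure.pi fun _ : Fin (n + 1) => σG).sub {g | γ.Composable g}

/-- The spaces of composable strings are smooth: they are embedded submanifolds. -/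
def NerveIsSmooth : Prop :=
  ∀ n : ℕ, (SmoothStructure.pi fun _ : Fin (n + 1) => σG).IsSubmanifold {g | γ.Composable g}

end Gpd

/-- A double Lie groupoid: a double groupoid in which `D`, `H`, `V`, `M` are manifolds, each edge is a
Lie groupoid, and the double-source map `(s_V, s_H)` from `D` to the fiber product of `V` and `H`
over their source maps is a submersion. -/
structure DoubleLieGroupoid (D H V M : Type u) extends DoubleGpd D H V M where
  σD : SmoothStructure D
  σH : SmoothStructure H
  σV : SmoothStructure V
  σM : SmoothStructure M
  lieDH : DH.IsLie σD σH
  lieDV : DV.IsLie σD σV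
  lieHM : HM.IsLie σH σM
  lieVM : VM.IsLie σV σM
  doubleSource_submersion :
    σD.Submersion ((σV.prod σH).sub {p | VM.src p.1 = HM.src p.2})
      (fun α => ⟨(DV.src α, DH.src α), (src_src α).symm⟩)

namespace DoubleLieGroupoid

variable {D H V M : Type u} (𝒟 : DoubleLieGroupoid D H V M)

/-- A double Lie groupoid is full if its double-source map is surjective. -/
def IsFull : Prop :=
  ∀ (θ : V) (η : H), 𝒟.VM.src θ = 𝒟.HM.src η → ∃ α : D, 𝒟.DV.src α = θ ∧ 𝒟.DH.src α = η

/-- The smooth structures on the double nerve. -/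
noncomputable def nerveSmooth (p q : ℕ) : SmoothStructure (𝒟.Nerve p q) :=
  (𝒟.level q).nerveSmooth (𝒟.DH.nerveSmooth 𝒟.σD 𝒟.σH q) (𝒟.VM.nerveSmooth 𝒟.σV 𝒟.σM q) p

/-- All the spaces `V^{(q)}`, `D_H^{(q)}` and `N_{p,q}` are smooth: they are embedded submanifolds. -/
structure NerveIsSmooth : Prop where
  stringsV : 𝒟.VM.NerveIsSmooth 𝒟.σV
  stringsDH : 𝒟.DH.NerveIsSmooth 𝒟.σD
  arrays : ∀ q, (𝒟.level q).NerveIsSmooth (𝒟.DH.nerveSmooth 𝒟.σD 𝒟.σH q)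

end DoubleLieGroupoid

/-!
The theorem has an algebraic half, filling horns in the bar construction of the double nerve, and
a differential half, showing that everything in sight is smooth. The bridge between them is a
uniform treatment of smoothness by germs.

*Germs.* `σ.Near τ f x` says that `f` is smooth on a neighbourhood of `x`. A smooth map is a
submersion if and only if it has a smooth local section through every point of its domain
(`SmoothStructure.submersion_of_sections`, `SmoothStructure.Submersion.exists_section`), and an
immersion if and only if it has smooth local left inverses. Consequently an injective submersion
is étale and a bijective one is a diffeomorphism. All embedded submanifolds come from one
criterion, a consequence of the inverse function theorem: the equalizer of two smooth maps `f`,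
`g` on a submanifold is again a submanifold if through every one of its points there is a local
section of `f` along which `g` is constant (`SmoothStructure.IsSubmanifold.equalizer`). It is
applied repeatedly, imposing one equation at a time, in an order such that the entry on which the
new equation depends can still be varied. This covers the nerve of a Lie groupoid, the spaces
`W̄_r ND`, and the spaces of horns.

*The double nerve.* Lifting a square with two prescribed adjacent sides, smoothly in parameters
and through a given square, is what the double-source map being a submersion provides. Lifting
strings in `V` square by square shows that the source maps of the groupoids of horizontally
composable strings are submersions, so that these are Lie groupoids
(`DoubleLieGroupoid.level_isLie`). The nerves of Lie groupoids have smooth structure maps, and the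
faces which forget the last arrow are submersions; hence `W̄_r ND` is a submanifold with smooth
faces and degeneracies (`BisimplicialStructure.IsSmooth.barIsSmooth`).

*Filling horns.* For `r ≥ 2`, a simplex `x` of `W̄_r ND` is determined by its faces `f_0 x` and
`f_r x` and one square `sq x`, the last square in the row `x_1`; conversely such data which fit
together come from a simplex, which depends smoothly on them (`DoubleGpd.ext_of_sq`,
`DoubleGpd.exists_of_sq`, `DoubleLieGroupoid.near_of_sq`). The corner square of an inner face
of `x` is `sq x` itself, or a product of `sq x` with the corner square of an outer face, so for `r ≥ 3`
the square `sq x` can be computed from the faces in any horn. Therefore horns of dimension at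
least three have unique fillers, for every double Lie groupoid (`DoubleGpd.exists_filler`,
`DoubleGpd.ext_of_horn`). A filler of a horn of dimension two amounts to a square with two
prescribed adjacent sides; it exists always if `D` is full, and near a given filler in any case.

*Conclusion.* So a smooth family of horns, filled at one point, has smooth fillers nearby
(`DoubleLieGroupoid.hasLocalFillers`). Adding missing faces one after the other, each a filler of
a partial horn of lower dimension, extends this to partial horns
(`SimplicialStructure.hasLocalFillers_of_horns`). For partial horns consisting of one simplex it
says that the faces are submersions. For general ones it is the variation needed to exhibit the
spaces of horns as submanifolds (`SimplicialStructure.isSubmanifold_partialHornSet`), and for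
horns it provides the local sections which make the horn maps submersions.
-/

open scoped Topology
open Set Filter

/-! ### Straightening smooth maps between vector spaces -/

section Analysis

variable {E F K : Type*} [NormedAddCommGroup E] [NormedSpace ℝ E] [FiniteDimensional ℝ E]
  [NormedAddCommGroup F] [NormedSpace ℝ F]
  [NormedAddCommGroup K] [NormedSpace ℝ K] [FiniteDimensional ℝ K]

/-- Inverse function theorem for maps that are `C^∞` on a neighbourhood of `x`. -/
theorem exists_openPartialHomeomorph_of_bijective_fderiv {f : E → F} {x : E}
    (hf : ∀ᶠ y in 𝓝 x, ContDiffAt ℝ ∞ f y) (hf' : Function.Bijective (fderiv ℝ f x)) :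
    ∃ Ψ : OpenPartialHomeomorph E F, x ∈ Ψ.source ∧ ⇑Ψ = f ∧ ContDiffOn ℝ ∞ f Ψ.source ∧
      ContDiffOn ℝ ∞ Ψ.symm Ψ.target := by
  let L : E ≃L[ℝ] F :=
    (LinearEquiv.ofBijective (fderiv ℝ f x).toLinearMap hf').toContinuousLinearEquiv
  have hL : (L : E →L[ℝ] F) = fderiv ℝ f x := by ext v; rfl
  have hx := hf.self_of_nhds
  have hd : HasFDerivAt f (L : E →L[ℝ] F) x := by
    rw [hL]; exact (hx.differentiableAt (by simp)).hasFDerivAt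
  let Ψ := hx.toOpenPartialHomeomorph f hd (by simp)
  -- near `x` the derivative stays invertible, since invertible maps form an open set
  have hinv : ∀ᶠ y in 𝓝 x, ∃ M : E ≃L[ℝ] F, (M : E →L[ℝ] F) = fderiv ℝ f y := by
    have hc : ContinuousAt (fderiv ℝ f) x :=
      (hx.fderiv_right (m := 0) (by simp)).continuousAt
    have := L.nhds
    rw [hL] at this
    exact hc this
  obtain ⟨U, hU, hUo, hxU⟩ := eventually_nhds_iff.1 (hf.and hinv)
  refine ⟨Ψ.restrOpen U hUo, ⟨hx.mem_toOpenPartialHomeomorph_source hd _, hxU⟩, rfl, ?_, ?_⟩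
  · intro y hy
    exact (hU y hy.2).1.contDiffWithinAt
  · intro z hz
    have hz' : Ψ.symm z ∈ U := by
      have := (Ψ.restrOpen U hUo).map_target hz
      exact this.2
    obtain ⟨M, hM⟩ := (hU _ hz').2
    have hzt : z ∈ Ψ.target := by
      have := hz.1
      exact this
    refine (Ψ.contDiffAt_symm (f₀' := M) hzt ?_ (hU _ hz').1).contDiffWithinAt
    rw [hM]
    exact ((hU _ hz').1.differentiableAt (by simp)).hasFDerivAt

variable [FiniteDimensional ℝ F]

/-- A smooth map with a local section through `x` is, after a smooth change of coordinates of the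
domain, a linear projection near `x`. -/
theorem exists_straightening_of_section (L : E ≃L[ℝ] F × K) {f : E → F} {x : E} {c : F → E} {y : F}
    (hf : ∀ᶠ x' in 𝓝 x, ContDiffAt ℝ ∞ f x') (hc : ContDiffAt ℝ ∞ c y) (hcx : c y = x)
    (hfc : ∀ᶠ y' in 𝓝 y, f (c y') = y') :
    ∃ Ψ : OpenPartialHomeomorph E E, x ∈ Ψ.source ∧ ContDiffOn ℝ ∞ Ψ Ψ.source ∧
      ContDiffOn ℝ ∞ Ψ.symm Ψ.target ∧ ∀ x' ∈ Ψ.source, (L (Ψ x')).1 = f x' := by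
  have hfx := hf.self_of_nhds
  have hdf : HasFDerivAt f (fderiv ℝ f x) x := (hfx.differentiableAt (by simp)).hasFDerivAt
  have hdc : HasFDerivAt c (fderiv ℝ c y) y := (hc.differentiableAt (by simp)).hasFDerivAt
  have hcomp : (fderiv ℝ f x).comp (fderiv ℝ c y) = ContinuousLinearMap.id ℝ F := by
    have h1 : HasFDerivAt (f ∘ c) ((fderiv ℝ f x).comp (fderiv ℝ c y)) y :=
      HasFDerivAt.comp y (by rw [hcx]; exact hdf) hdc
    have h2 : HasFDerivAt (f ∘ c) (ContinuousLinearMap.id ℝ F) y :=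
      (hasFDerivAt_id y).congr_of_eventuallyEq hfc
    exact h1.unique h2
  have hsurj : Function.Surjective (fderiv ℝ f x) := fun v =>
    ⟨fderiv ℝ c y v, by simpa using DFunLike.congr_fun hcomp v⟩
  have hker : Module.finrank ℝ (LinearMap.ker (fderiv ℝ f x).toLinearMap) = Module.finrank ℝ K := by
    have h1 := (fderiv ℝ f x).toLinearMap.finrank_range_add_finrank_ker
    have h2 : LinearMap.range (fderiv ℝ f x).toLinearMap = ⊤ := LinearMap.range_eq_top.2 hsurj
    rw [h2, finrank_top] at h1
    have h3 := L.toLinearEquiv.finrank_eq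
    rw [Module.finrank_prod] at h3
    omega
  let e : LinearMap.ker (fderiv ℝ f x).toLinearMap ≃ₗ[ℝ] K := LinearEquiv.ofFinrankEq _ _ hker
  obtain ⟨p, hp⟩ :=
    (LinearMap.ker (fderiv ℝ f x).toLinearMap).subtype.exists_leftInverse_of_injective
      (Submodule.ker_subtype _)
  let ℓ : E →L[ℝ] K := LinearMap.toContinuousLinearMap (e.toLinearMap ∘ₗ p)
  -- `ℓ` maps the kernel of the derivative of `f` isomorphically to `K`, so `(f, ℓ)` is a chart
  let Φ : E → E := fun x' => L.symm (f x', ℓ x')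
  have hΦ : ∀ᶠ x' in 𝓝 x, ContDiffAt ℝ ∞ Φ x' := hf.mono fun x' h =>
    L.symm.contDiff.contDiffAt.comp x' (h.prodMk ℓ.contDiff.contDiffAt)
  have hdΦ : HasFDerivAt Φ ((L.symm : F × K →L[ℝ] E).comp ((fderiv ℝ f x).prod ℓ)) x :=
    L.symm.hasFDerivAt.comp x (hdf.prodMk ℓ.hasFDerivAt)
  have hinj : Function.Injective (fderiv ℝ Φ x) := by
    rw [hdΦ.fderiv]
    refine (injective_iff_map_eq_zero _).2 fun v hv => ?_
    simp only [ContinuousLinearMap.comp_apply, ContinuousLinearMap.prod_apply,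
      ContinuousLinearEquiv.coe_coe, EmbeddingLike.map_eq_zero_iff, Prod.mk_eq_zero] at hv
    have hv1 : v ∈ LinearMap.ker (fderiv ℝ f x).toLinearMap := hv.1
    have hv2 : e (p v) = 0 := hv.2
    have hv3 : p v = ⟨v, hv1⟩ := DFunLike.congr_fun hp ⟨v, hv1⟩
    rw [EmbeddingLike.map_eq_zero_iff, hv3] at hv2
    exact congrArg Subtype.val hv2
  have hbij : Function.Bijective (fderiv ℝ Φ x) :=
    ⟨hinj, (LinearMap.injective_iff_surjective (f := (fderiv ℝ Φ x).toLinearMap)).1 hinj⟩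
  obtain ⟨Ψ, h1, h2, h3, h4⟩ := exists_openPartialHomeomorph_of_bijective_fderiv hΦ hbij
  refine ⟨Ψ, h1, h2 ▸ h3, h4, fun x' _ => ?_⟩
  rw [h2]
  simp [Φ]

/-- A smooth map with a local left inverse is, after a smooth change of coordinates of the codomain,
a linear inclusion near `x`. -/
theorem exists_straightening_of_leftInverse (L : (E × K) ≃L[ℝ] F) {f : E → F} {x : E} {g : F → E}
    (hf : ContDiffAt ℝ ∞ f x) (hf' : ∀ᶠ y in 𝓝 (f x), ContDiffAt ℝ ∞ (f ∘ g) y)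
    (hg : ∀ᶠ y in 𝓝 (f x), ContDiffAt ℝ ∞ g y)
    (hgf : ∀ᶠ x' in 𝓝 x, g (f x') = x') :
    ∃ Ψ : OpenPartialHomeomorph F F, f x ∈ Ψ.source ∧ ContDiffOn ℝ ∞ Ψ Ψ.source ∧
      ContDiffOn ℝ ∞ Ψ.symm Ψ.target ∧ ∀ᶠ x' in 𝓝 x, Ψ (f x') = L (x', 0) := by
  have hgx := hg.self_of_nhds
  have hdf : HasFDerivAt f (fderiv ℝ f x) x := (hf.differentiableAt (by simp)).hasFDerivAt
  have hdg : HasFDerivAt g (fderiv ℝ g (f x)) (f x) := (hgx.differentiableAt (by simp)).hasFDerivAt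
  have hxg : g (f x) = x := hgf.self_of_nhds
  have hcomp : (fderiv ℝ g (f x)).comp (fderiv ℝ f x) = ContinuousLinearMap.id ℝ E := by
    have h1 : HasFDerivAt (g ∘ f) ((fderiv ℝ g (f x)).comp (fderiv ℝ f x)) x :=
      HasFDerivAt.comp x hdg hdf
    exact h1.unique ((hasFDerivAt_id x).congr_of_eventuallyEq hgf)
  set B := fderiv ℝ g (f x)
  set A := fderiv ℝ f x
  have hsurj : Function.Surjective B := fun v => ⟨A v, by simpa using DFunLike.congr_fun hcomp v⟩
  have hker : Module.finrank ℝ (LinearMap.ker B.toLinearMap) = Module.finrank ℝ K := by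
    have h1 := B.toLinearMap.finrank_range_add_finrank_ker
    have h2 : LinearMap.range B.toLinearMap = ⊤ := LinearMap.range_eq_top.2 hsurj
    rw [h2, finrank_top] at h1
    have h3 := L.toLinearEquiv.finrank_eq
    rw [Module.finrank_prod] at h3
    omega
  let e : LinearMap.ker B.toLinearMap ≃ₗ[ℝ] K := LinearEquiv.ofFinrankEq _ _ hker
  obtain ⟨p, hp⟩ := (LinearMap.ker B.toLinearMap).subtype.exists_leftInverse_of_injective
    (Submodule.ker_subtype _)
  let ℓ : F →L[ℝ] K := LinearMap.toContinuousLinearMap (e.toLinearMap ∘ₗ p)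
  -- `y ↦ y - f (g y)` vanishes on the image of `f`, which is therefore mapped into `E × 0`
  let Φ : F → F := fun y => L (g y, ℓ (y - f (g y)))
  have hΦ : ∀ᶠ y in 𝓝 (f x), ContDiffAt ℝ ∞ Φ y := by
    filter_upwards [hg, hf'] with y h1 h2
    exact L.contDiff.contDiffAt.comp y
      (h1.prodMk (ℓ.contDiff.contDiffAt.comp y (contDiffAt_id.sub h2)))
  have hdΦ : HasFDerivAt Φ ((L : E × K →L[ℝ] F).comp (B.prod (ℓ.comp
      (ContinuousLinearMap.id ℝ F - A.comp B)))) (f x) := by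
    refine L.hasFDerivAt.comp (f x) (hdg.prodMk (ℓ.hasFDerivAt.comp (f x) ?_))
    refine (hasFDerivAt_id _).sub (HasFDerivAt.comp (f x) ?_ hdg)
    rw [hxg]; exact hdf
  have hinj : Function.Injective (fderiv ℝ Φ (f x)) := by
    rw [hdΦ.fderiv]
    refine (injective_iff_map_eq_zero _).2 fun v hv => ?_
    simp only [ContinuousLinearMap.comp_apply, ContinuousLinearMap.prod_apply,
      ContinuousLinearEquiv.coe_coe, EmbeddingLike.map_eq_zero_iff, Prod.mk_eq_zero,
      sub_apply, ContinuousLinearMap.id_apply] at hv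
    obtain ⟨hv1, hv2⟩ := hv
    rw [hv1, map_zero, sub_zero] at hv2
    replace hv1 : v ∈ LinearMap.ker B.toLinearMap := hv1
    replace hv2 : e (p v) = 0 := hv2
    have hv3 : p v = ⟨v, hv1⟩ := DFunLike.congr_fun hp ⟨v, hv1⟩
    rw [EmbeddingLike.map_eq_zero_iff, hv3] at hv2
    exact congrArg Subtype.val hv2
  have hbij : Function.Bijective (fderiv ℝ Φ (f x)) :=
    ⟨hinj, (LinearMap.injective_iff_surjective (f := (fderiv ℝ Φ (f x)).toLinearMap)).1 hinj⟩
  obtain ⟨Ψ, h1, h2, h3, h4⟩ := exists_openPartialHomeomorph_of_bijective_fderiv hΦ hbij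
  refine ⟨Ψ, h1, h2 ▸ h3, h4, hgf.mono fun x' hx' => ?_⟩
  rw [h2]
  simp [Φ, hx']

theorem exists_complement_of_finrank_le (h : Module.finrank ℝ F ≤ Module.finrank ℝ E) :
    Nonempty (E ≃L[ℝ] F × EuclideanSpace ℝ (Fin (Module.finrank ℝ E - Module.finrank ℝ F))) :=
  ⟨ContinuousLinearEquiv.ofFinrankEq (by
    rw [Module.finrank_prod, finrank_euclideanSpace_fin]; omega)⟩

end Analysis

/-! ### Germs of smooth maps, submersions and immersions -/

section Germs

variable {E F G K : Type*} [NormedAddCommGroup E] [NormedSpace ℝ E]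
  [NormedAddCommGroup F] [NormedSpace ℝ F] [NormedAddCommGroup G] [NormedSpace ℝ G]
  {X Y Z : Type*} [TopologicalSpace X] [ChartedSpace E X]
  [TopologicalSpace Y] [ChartedSpace F Y] [TopologicalSpace Z] [ChartedSpace G Z]

variable (E F) in
/-- The map `f` is smooth at every point of a neighbourhood of `x`. (For the smoothness exponent `∞`
this is stronger than being smooth at `x`.) -/
def ContMDiffNear (f : X → Y) (x : X) : Prop :=
  ∀ᶠ x' in 𝓝 x, ContMDiffAt 𝓘(ℝ, E) 𝓘(ℝ, F) ∞ f x'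

namespace ContMDiffNear

variable {f f' : X → Y} {g : Y → Z} {x : X}

theorem contMDiffAt (h : ContMDiffNear E F f x) : ContMDiffAt 𝓘(ℝ, E) 𝓘(ℝ, F) ∞ f x :=
  h.self_of_nhds

theorem continuousAt (h : ContMDiffNear E F f x) : ContinuousAt f x :=
  h.contMDiffAt.continuousAt

theorem comp (hg : ContMDiffNear F G g (f x)) (hf : ContMDiffNear E F f x) :
    ContMDiffNear E G (fun y => g (f y)) x := by
  filter_upwards [hf, hf.continuousAt.eventually hg] with y h1 h2
  exact h2.comp y h1

theorem comp' {y : Y} (hg : ContMDiffNear F G g y) (hf : ContMDiffNear E F f x) (hy : f x = y) :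
    ContMDiffNear E G (fun y => g (f y)) x :=
  comp (hy ▸ hg) hf

theorem congr (hf : ContMDiffNear E F f x) (h : ∀ᶠ y in 𝓝 x, f' y = f y) :
    ContMDiffNear E F f' x := by
  filter_upwards [hf, h.eventually_nhds] with y h1 h2
  exact h1.congr_of_eventuallyEq h2

theorem of_contMDiff (hf : ContMDiff 𝓘(ℝ, E) 𝓘(ℝ, F) ∞ f) : ContMDiffNear E F f x :=
  Eventually.of_forall fun y => hf y

theorem of_contMDiffOn {U : Set X} (hf : ContMDiffOn 𝓘(ℝ, E) 𝓘(ℝ, F) ∞ f U) (hU : IsOpen U)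
    (hx : x ∈ U) : ContMDiffNear E F f x := by
  filter_upwards [hU.mem_nhds hx] with y hy
  exact hf.contMDiffAt (hU.mem_nhds hy)

end ContMDiffNear

end Germs

section Charts

variable {E : Type*} [NormedAddCommGroup E] [NormedSpace ℝ E]
  {X : Type*} [TopologicalSpace X] [ChartedSpace E X]

theorem contMDiffNear_chart {φ : OpenPartialHomeomorph X E}
    (hφ : φ ∈ IsManifold.maximalAtlas 𝓘(ℝ, E) ∞ X) {x : X} (hx : x ∈ φ.source) :
    ContMDiffNear E E φ x :=
  .of_contMDiffOn (contMDiffOn_of_mem_maximalAtlas hφ) φ.open_source hx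

theorem contMDiffNear_chart_symm {φ : OpenPartialHomeomorph X E}
    (hφ : φ ∈ IsManifold.maximalAtlas 𝓘(ℝ, E) ∞ X) {u : E} (hu : u ∈ φ.target) :
    ContMDiffNear E E φ.symm u :=
  .of_contMDiffOn (contMDiffOn_symm_of_mem_maximalAtlas hφ) φ.open_target hu

variable [IsManifold 𝓘(ℝ, E) ∞ X]

/-- Charts can be composed with diffeomorphisms between open subsets of the model space. -/
theorem trans_mem_maximalAtlas {φ : OpenPartialHomeomorph X E}
    (hφ : φ ∈ IsManifold.maximalAtlas 𝓘(ℝ, E) ∞ X) {Ψ : OpenPartialHomeomorph E E}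
    (h : ContDiffOn ℝ ∞ Ψ Ψ.source) (h' : ContDiffOn ℝ ∞ Ψ.symm Ψ.target) :
    φ ≫ₕ Ψ ∈ IsManifold.maximalAtlas 𝓘(ℝ, E) ∞ X := by
  refine OpenPartialHomeomorph.mem_maximalAtlas_of_contMDiffOn _ ?_ ?_
  · have := h.contMDiffOn.comp ((contMDiffOn_of_mem_maximalAtlas hφ).mono
      (fun x hx => hx.1 : (φ ≫ₕ Ψ).source ⊆ φ.source)) (fun x hx => hx.2)
    exact this
  · have := (contMDiffOn_symm_of_mem_maximalAtlas hφ).comp (h'.contMDiffOn.mono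
      (fun x hx => hx.1 : (φ ≫ₕ Ψ).target ⊆ Ψ.target)) (fun x hx => hx.2)
    exact this

theorem restrOpen_mem_maximalAtlas {φ : OpenPartialHomeomorph X E}
    (hφ : φ ∈ IsManifold.maximalAtlas 𝓘(ℝ, E) ∞ X) {U : Set X} (hU : IsOpen U) :
    φ.restrOpen U hU ∈ IsManifold.maximalAtlas 𝓘(ℝ, E) ∞ X :=
  OpenPartialHomeomorph.mem_maximalAtlas_of_contMDiffOn _
    ((contMDiffOn_of_mem_maximalAtlas hφ).mono fun _ hx => hx.1)
    ((contMDiffOn_symm_of_mem_maximalAtlas hφ).mono fun _ hx => hx.1)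

end Charts

section Submersions

variable {E F : Type} [NormedAddCommGroup E] [NormedSpace ℝ E]
  [NormedAddCommGroup F] [NormedSpace ℝ F]
  {X Y : Type*} [TopologicalSpace X] [ChartedSpace E X]
  [TopologicalSpace Y] [ChartedSpace F Y]

/-- The local representation of a germ of maps in charts is smooth. -/
theorem ContMDiffNear.contDiffAt_charts {f : X → Y} {x : X} (hf : ContMDiffNear E F f x)
    {φ : OpenPartialHomeomorph X E} {ψ : OpenPartialHomeomorph Y F}
    (hφ : φ ∈ IsManifold.maximalAtlas 𝓘(ℝ, E) ∞ X) (hψ : ψ ∈ IsManifold.maximalAtlas 𝓘(ℝ, F) ∞ Y)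
    (hx : x ∈ φ.source) (hy : f x ∈ ψ.source) :
    ∀ᶠ u in 𝓝 (φ x), ContDiffAt ℝ ∞ (fun u => ψ (f (φ.symm u))) u := by
  have h1 : ContMDiffNear E E φ.symm (φ x) := contMDiffNear_chart_symm hφ (φ.map_source hx)
  have h2 := (contMDiffNear_chart hψ hy).comp' (hf.comp' h1 (φ.left_inv hx))
    (by rw [φ.left_inv hx])
  exact h2.mono fun u hu => hu.contDiffAt

/-- Submersions have local sections through all points of their domain. -/
theorem exists_section_of_isSubmersion {f : X → Y}
    (hf : Manifold.IsSubmersion 𝓘(ℝ, E) 𝓘(ℝ, F) ∞ f) (x : X) :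
    ∃ s : Y → X, ContMDiffNear F E s (f x) ∧ s (f x) = x ∧ ∀ᶠ y in 𝓝 (f x), f (s y) = y := by
  obtain ⟨K, _, _, hK⟩ := hf
  have h := hK x
  have hw := h.writtenInCharts
  have hφ := h.domChart_mem_maximalAtlas
  have hψ := h.codChart_mem_maximalAtlas
  have hx := h.mem_domChart_source
  have hy := h.mem_codChart_source
  have hsub := h.source_subset_preimage_source
  set φ := h.domChart
  set ψ := h.codChart
  set L := h.equiv
  simp only [mfld_simps] at hw
  have hw' : ∀ u ∈ φ.target, ψ (f (φ.symm u)) = (L u).1 := fun u hu => hw hu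
  have hψx : (L (φ x)).1 = ψ (f x) := by
    rw [← hw' _ (φ.map_source hx), φ.left_inv hx]
  -- in the charts `f` is a projection `F × K → F`; the section keeps the second coordinate of `x`
  let c : F → E := fun v => L.symm (v, (L (φ x)).2)
  have hc : ContDiff ℝ ∞ c := L.symm.contDiff.comp (contDiff_id.prodMk contDiff_const)
  have hcx : c (ψ (f x)) = φ x := by simp only [c, ← hψx, L.symm_apply_apply]
  have hcn : ContMDiffNear F E c (ψ (f x)) := .of_contMDiff hc.contMDiff
  have hcψ : ContMDiffNear F E (fun y => c (ψ y)) (f x) := hcn.comp (contMDiffNear_chart hψ hy)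
  refine ⟨fun y => φ.symm (c (ψ y)), (contMDiffNear_chart_symm hφ (φ.map_source hx)).comp'
    hcψ hcx, by simp only [hcx, φ.left_inv hx], ?_⟩
  have h1 : ∀ᶠ y in 𝓝 (f x), c (ψ y) ∈ φ.target :=
    hcψ.continuousAt.eventually (φ.open_target.mem_nhds (show c (ψ (f x)) ∈ φ.target by
      rw [hcx]; exact φ.map_source hx))
  filter_upwards [h1, ψ.open_source.mem_nhds hy] with y h2 h3
  have h4 := hw' _ h2
  simp only [c, L.apply_symm_apply] at h4
  refine ψ.injOn (hsub (φ.map_target h2)) h3 h4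

variable [FiniteDimensional ℝ F]

theorem finrank_le_of_leftInverse {f : E → F} {g : F → E} {x : E} (hf : ContDiffAt ℝ ∞ f x)
    (hg : ContDiffAt ℝ ∞ g (f x)) (h : ∀ᶠ x' in 𝓝 x, g (f x') = x') :
    Module.finrank ℝ E ≤ Module.finrank ℝ F := by
  have hdf : HasFDerivAt f (fderiv ℝ f x) x := (hf.differentiableAt (by simp)).hasFDerivAt
  have hdg : HasFDerivAt g (fderiv ℝ g (f x)) (f x) := (hg.differentiableAt (by simp)).hasFDerivAt
  have hcomp : (fderiv ℝ g (f x)).comp (fderiv ℝ f x) = ContinuousLinearMap.id ℝ E := by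
    have h1 : HasFDerivAt (g ∘ f) ((fderiv ℝ g (f x)).comp (fderiv ℝ f x)) x :=
      HasFDerivAt.comp x hdg hdf
    exact h1.unique ((hasFDerivAt_id x).congr_of_eventuallyEq h)
  refine LinearMap.finrank_le_finrank_of_injective (f := (fderiv ℝ f x).toLinearMap) ?_
  exact Function.LeftInverse.injective (g := fderiv ℝ g (f x)) fun v => DFunLike.congr_fun hcomp v

variable [IsManifold 𝓘(ℝ, E) ∞ X] [IsManifold 𝓘(ℝ, F) ∞ Y]

/-- A germ of maps with a smooth left inverse does not lower the dimension. This provides the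
linear complement which the definitions of submersions and immersions require to be the same at all
points. -/
theorem finrank_le_of_germs {f : X → Y} {g : Y → X} {x : X} (hf : ContMDiffNear E F f x)
    (hg : ContMDiffNear F E g (f x)) (h : ∀ᶠ x' in 𝓝 x, g (f x') = x') :
    Module.finrank ℝ E ≤ Module.finrank ℝ F := by
  have hφ := IsManifold.chart_mem_maximalAtlas (I := 𝓘(ℝ, E)) (n := ∞) x
  have hψ := IsManifold.chart_mem_maximalAtlas (I := 𝓘(ℝ, F)) (n := ∞) (f x)
  have hx := mem_chart_source E x
  have hy := mem_chart_source F (f x)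
  have h1 := (hf.contDiffAt_charts hφ hψ hx hy).self_of_nhds
  have h2 := (hg.contDiffAt_charts hψ hφ hy (by rw [h.self_of_nhds]; exact hx)).self_of_nhds
  refine finrank_le_of_leftInverse h1 (by simpa [(chartAt E x).left_inv hx] using h2) ?_
  have hc : ContinuousAt (chartAt E x).symm (chartAt E x x) :=
    (chartAt E x).continuousAt_symm ((chartAt E x).map_source hx)
  have hxx := (chartAt E x).left_inv hx
  have hs : ∀ᶠ x' in 𝓝 x, f x' ∈ (chartAt F (f x)).source :=
    hf.continuousAt.eventually ((chartAt F (f x)).open_source.mem_nhds hy)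
  filter_upwards [hc.eventually (by rw [hxx]; exact h), hc.eventually (by rw [hxx]; exact hs),
    (chartAt E x).open_target.mem_nhds ((chartAt E x).map_source hx)] with u hu1 hu2 hu3
  rw [(chartAt F (f x)).left_inv hu2, hu1, (chartAt E x).right_inv hu3]

variable [FiniteDimensional ℝ E]

/-- A smooth map which has local sections through all points of its domain is a submersion. -/
theorem isSubmersion_of_sections {f : X → Y} (hf : ContMDiff 𝓘(ℝ, E) 𝓘(ℝ, F) ∞ f)
    (h : ∀ x, ∃ s : Y → X, ContMDiffNear F E s (f x) ∧ s (f x) = x ∧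
      ∀ᶠ y in 𝓝 (f x), f (s y) = y) : Manifold.IsSubmersion 𝓘(ℝ, E) 𝓘(ℝ, F) ∞ f := by
  rcases isEmpty_or_nonempty X with hX | ⟨⟨x₀⟩⟩
  -- on an empty manifold the dimensions are not related, and any complement will do
  · exact Manifold.IsSubmersionOfComplement.isSubmersion (F := PUnit.{1}) fun x => (hX.false x).elim
  have hdim : Module.finrank ℝ F ≤ Module.finrank ℝ E := by
    obtain ⟨s, h1, h2, h3⟩ := h x₀
    exact finrank_le_of_germs h1 (.of_contMDiff hf) h3
  obtain ⟨L⟩ := exists_complement_of_finrank_le hdim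
  refine Manifold.IsSubmersionOfComplement.isSubmersion
    (F := EuclideanSpace ℝ (Fin (Module.finrank ℝ E - Module.finrank ℝ F))) fun x => ?_
  obtain ⟨s, h1, h2, h3⟩ := h x
  obtain ⟨φ, hφ, hx⟩ : ∃ φ ∈ IsManifold.maximalAtlas 𝓘(ℝ, E) ∞ X, x ∈ φ.source :=
    ⟨_, IsManifold.chart_mem_maximalAtlas x, mem_chart_source E x⟩
  obtain ⟨ψ, hψ, hy⟩ : ∃ ψ ∈ IsManifold.maximalAtlas 𝓘(ℝ, F) ∞ Y, f x ∈ ψ.source :=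
    ⟨_, IsManifold.chart_mem_maximalAtlas (f x), mem_chart_source F (f x)⟩
  have hf' := ContMDiffNear.contDiffAt_charts (.of_contMDiff hf) hφ hψ hx hy
  have hs' := (h1.contDiffAt_charts hψ hφ hy (by rw [h2]; exact hx)).self_of_nhds
  obtain ⟨Ψ, hΨ1, hΨ2, hΨ3, hΨ4⟩ := exists_straightening_of_section L hf' hs'
    (by simp only [ψ.left_inv hy, h2]) (by
      have hc : ContinuousAt ψ.symm (ψ (f x)) := ψ.continuousAt_symm (ψ.map_source hy)
      have hxx := ψ.left_inv hy
      have hs : ∀ᶠ y in 𝓝 (f x), s y ∈ φ.source :=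
        h1.continuousAt.eventually (φ.open_source.mem_nhds (by rw [h2]; exact hx))
      filter_upwards [hc.eventually (by rw [hxx]; exact h3), hc.eventually (by rw [hxx]; exact hs),
        ψ.open_target.mem_nhds (ψ.map_source hy)] with u hu1 hu2 hu3
      rw [φ.left_inv hu2, hu1, ψ.right_inv hu3])
  refine Manifold.IsSubmersionAtOfComplement.mk_of_continuousAt (hf x).continuousAt L (φ ≫ₕ Ψ) ψ
    ⟨hx, hΨ1⟩ hy (trans_mem_maximalAtlas hφ hΨ2 hΨ3) hψ ?_
  intro u hu
  simp only [mfld_simps] at hu ⊢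
  have := hΨ4 (Ψ.symm u) (Ψ.map_target hu.1)
  rw [Ψ.right_inv hu.1] at this
  exact this.symm

end Submersions

section Embeddings

variable {E F : Type} [NormedAddCommGroup E] [NormedSpace ℝ E]
  [NormedAddCommGroup F] [NormedSpace ℝ F]
  {X Y : Type*} [TopologicalSpace X] [ChartedSpace E X]
  [TopologicalSpace Y] [ChartedSpace F Y]

/-- Immersions have smooth left inverses near all points of their domain. -/
theorem exists_leftInverse_of_isImmersion {f : X → Y}
    (hf : Manifold.IsImmersion 𝓘(ℝ, E) 𝓘(ℝ, F) ∞ f) (x : X) :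
    ∃ g : Y → X, ContMDiffNear F E g (f x) ∧ ∀ᶠ x' in 𝓝 x, g (f x') = x' := by
  obtain ⟨K, _, _, hK⟩ := hf
  have h := hK x
  have hw := h.writtenInCharts
  have hφ := h.domChart_mem_maximalAtlas
  have hψ := h.codChart_mem_maximalAtlas
  have hx := h.mem_domChart_source
  have hy := h.mem_codChart_source
  set φ := h.domChart
  set ψ := h.codChart
  set L := h.equiv
  simp only [mfld_simps] at hw
  have hw' : ∀ u ∈ φ.target, ψ (f (φ.symm u)) = L (u, 0) := fun u hu => hw hu
  have hψx : (L.symm (ψ (f x))).1 = φ x := by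
    have := hw' _ (φ.map_source hx)
    rw [φ.left_inv hx] at this
    rw [this, L.symm_apply_apply]
  have hc : ContDiff ℝ ∞ (fun v => (L.symm v).1) := contDiff_fst.comp L.symm.contDiff
  have hcn : ContMDiffNear F E (fun v => (L.symm v).1) (ψ (f x)) := .of_contMDiff hc.contMDiff
  refine ⟨fun y => φ.symm (L.symm (ψ y)).1, (contMDiffNear_chart_symm hφ (φ.map_source hx)).comp'
    (hcn.comp (contMDiffNear_chart hψ hy)) hψx, ?_⟩
  filter_upwards [φ.open_source.mem_nhds hx] with x' hx'
  have := hw' _ (φ.map_source hx')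
  rw [φ.left_inv hx'] at this
  rw [this, L.symm_apply_apply, φ.left_inv hx']

variable [IsManifold 𝓘(ℝ, E) ∞ X] [IsManifold 𝓘(ℝ, F) ∞ Y]
  [FiniteDimensional ℝ E] [FiniteDimensional ℝ F]

/-- A smooth map which has smooth left inverses near all points of its domain is an immersion. -/
theorem isImmersion_of_leftInverses {f : X → Y} (hf : ContMDiff 𝓘(ℝ, E) 𝓘(ℝ, F) ∞ f)
    (h : ∀ x, ∃ g : Y → X, ContMDiffNear F E g (f x) ∧ ∀ᶠ x' in 𝓝 x, g (f x') = x') :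
    Manifold.IsImmersion 𝓘(ℝ, E) 𝓘(ℝ, F) ∞ f := by
  rcases isEmpty_or_nonempty X with hX | ⟨⟨x₀⟩⟩
  · exact Manifold.IsImmersionOfComplement.isImmersion (F := PUnit.{1}) fun x => (hX.false x).elim
  have hdim : Module.finrank ℝ E ≤ Module.finrank ℝ F := by
    obtain ⟨s, h1, h2⟩ := h x₀
    exact finrank_le_of_germs (.of_contMDiff hf) h1 h2
  obtain ⟨L⟩ := exists_complement_of_finrank_le hdim
  refine Manifold.IsImmersionOfComplement.isImmersion
    (F := EuclideanSpace ℝ (Fin (Module.finrank ℝ F - Module.finrank ℝ E))) fun x => ?_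
  obtain ⟨g, h1, h2⟩ := h x
  obtain ⟨φ, hφ, hx⟩ : ∃ φ ∈ IsManifold.maximalAtlas 𝓘(ℝ, E) ∞ X, x ∈ φ.source :=
    ⟨_, IsManifold.chart_mem_maximalAtlas x, mem_chart_source E x⟩
  obtain ⟨ψ, hψ, hy⟩ : ∃ ψ ∈ IsManifold.maximalAtlas 𝓘(ℝ, F) ∞ Y, f x ∈ ψ.source :=
    ⟨_, IsManifold.chart_mem_maximalAtlas (f x), mem_chart_source F (f x)⟩
  have hgx : g (f x) = x := h2.self_of_nhds
  have hφψ : ψ (f (φ.symm (φ x))) = ψ (f x) := by rw [φ.left_inv hx]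
  have hf' := ContMDiffNear.contDiffAt_charts (.of_contMDiff hf) hφ hψ hx hy
  have hg' := h1.contDiffAt_charts hψ hφ hy (by rw [hgx]; exact hx)
  have hc : ContinuousAt φ.symm (φ x) := φ.continuousAt_symm (φ.map_source hx)
  have hfs : ∀ᶠ x' in 𝓝 x, f x' ∈ ψ.source :=
    (hf x).continuousAt.eventually (ψ.open_source.mem_nhds hy)
  have hgf : ∀ᶠ u in 𝓝 (φ x), φ (g (ψ.symm (ψ (f (φ.symm u))))) = u := by
    filter_upwards [hc.eventually (by rw [φ.left_inv hx]; exact h2),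
      hc.eventually (by rw [φ.left_inv hx]; exact hfs),
      φ.open_target.mem_nhds (φ.map_source hx)] with u hu1 hu2 hu3
    rw [ψ.left_inv hu2, hu1, φ.right_inv hu3]
  have hfg : ∀ᶠ v in 𝓝 (ψ (f x)), ContDiffAt ℝ ∞
      ((fun u => ψ (f (φ.symm u))) ∘ (fun v => φ (g (ψ.symm v)))) v := by
    have hxx : φ x = φ (g (ψ.symm (ψ (f x)))) := by rw [ψ.left_inv hy, hgx]
    rw [hxx] at hf'
    have hf'' := hg'.self_of_nhds.continuousAt.eventually hf'
    filter_upwards [hg', hf''] with v hv1 hv2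
    exact ContDiffAt.comp v hv2 hv1
  obtain ⟨Ψ, hΨ1, hΨ2, hΨ3, hΨ4⟩ := exists_straightening_of_leftInverse L.symm hf'.self_of_nhds
    (by rw [hφψ]; exact hfg) (by rw [hφψ]; exact hg') hgf
  rw [hφψ] at hΨ1
  have hev : ∀ᶠ x' in 𝓝 x, Ψ (ψ (f x')) = L.symm (φ x', 0) := by
    filter_upwards [(φ.continuousAt hx).eventually hΨ4, φ.open_source.mem_nhds hx] with x' h1 h2
    rw [φ.left_inv h2] at h1
    exact h1
  obtain ⟨U, hU, hUo, hxU⟩ := eventually_nhds_iff.1 hev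
  refine Manifold.IsImmersionAtOfComplement.mk_of_continuousAt (hf x).continuousAt L.symm
    (φ.restrOpen U hUo) (ψ ≫ₕ Ψ) ⟨hx, hxU⟩ ⟨hy, hΨ1⟩
    (restrOpen_mem_maximalAtlas hφ hUo) (trans_mem_maximalAtlas hψ hΨ2 hΨ3) ?_
  intro u hu
  simp only [mfld_simps] at hu ⊢
  rw [hU _ hu.2, φ.right_inv hu.1]

end Embeddings

/-! ### Submanifolds from local parametrizations -/

section Slices

variable {E F K : Type} [NormedAddCommGroup E] [NormedSpace ℝ E]
  [NormedAddCommGroup F] [NormedSpace ℝ F] [FiniteDimensional ℝ F]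
  [NormedAddCommGroup K] [NormedSpace ℝ K]
  {X Y Z : Type*} [TopologicalSpace X] [ChartedSpace E X]
  [TopologicalSpace Y] [ChartedSpace E Y] [IsManifold 𝓘(ℝ, E) ∞ Y]
  [TopologicalSpace Z] [ChartedSpace F Z] [IsManifold 𝓘(ℝ, F) ∞ Z]

variable (E K) in
/-- A local parametrization of the subset `S` of the manifold `X` near `x` by the vector space `K`:
a germ `ψ` of maps from `K` into `S` together with a germ `φ` of maps from `X` to `K` which is
inverse to it on `S`. -/
structure IsLocalSlice (S : Set X) (x : X) (φ : X → K) (ψ : K → X) : Prop where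
  smooth : ContMDiffNear E K φ x
  smooth_symm : ContMDiffNear K E ψ (φ x)
  left_inv : ∀ᶠ x' in 𝓝 x, x' ∈ S → ψ (φ x') = x'
  mem : ∀ᶠ k in 𝓝 (φ x), ψ k ∈ S
  right_inv : ∀ᶠ k in 𝓝 (φ x), φ (ψ k) = k

open Classical in
/-- The chart of `S` defined by a local parametrization. -/
theorem IsLocalSlice.exists_chart {S : Set X} {x : S} {φ : X → K} {ψ : K → X}
    (h : IsLocalSlice E K S x φ ψ) : ∃ e : OpenPartialHomeomorph S K, x ∈ e.source ∧
      (∀ s, e s = φ s) ∧ (∀ k ∈ e.target, (e.symm k : X) = ψ k) ∧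
      (∀ s ∈ e.source, ContMDiffAt 𝓘(ℝ, E) 𝓘(ℝ, K) ∞ φ s) ∧
      (∀ k ∈ e.target, ContMDiffAt 𝓘(ℝ, K) 𝓘(ℝ, E) ∞ ψ k) := by
  obtain ⟨U, hU, hUo, hxU⟩ := eventually_nhds_iff.1 (h.smooth.and h.left_inv)
  obtain ⟨W, hW, hWo, hxW⟩ := eventually_nhds_iff.1 (h.smooth_symm.and (h.mem.and h.right_inv))
  have hφc : ContinuousOn φ U := fun y hy => (hU y hy).1.continuousAt.continuousWithinAt
  have hψc : ContinuousOn ψ W := fun k hk => (hW k hk).1.continuousAt.continuousWithinAt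
  -- only the values on `W`, where `ψ` maps to `S`, matter
  let inv : K → S := fun k => if hk : ψ k ∈ S then ⟨ψ k, hk⟩ else x
  have hinv : ∀ k ∈ W, (inv k : X) = ψ k := fun k hk => by
    simp only [inv, dif_pos (hW k hk).2.1]
  have hso : IsOpen {s : S | (s : X) ∈ U ∩ φ ⁻¹' W} :=
    (hφc.isOpen_inter_preimage hUo hWo).preimage continuous_subtype_val
  refine ⟨{ toFun := fun s => φ s
            invFun := inv
            source := {s | (s : X) ∈ U ∩ φ ⁻¹' W}
            target := W ∩ ψ ⁻¹' U
            map_source' := ?_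
            map_target' := ?_
            left_inv' := ?_
            right_inv' := ?_
            open_source := hso
            open_target := hψc.isOpen_inter_preimage hWo hUo
            continuousOn_toFun := ?_
            continuousOn_invFun := ?_ }, ⟨hxU, hxW⟩, fun s => rfl, fun k hk => hinv k hk.1,
            fun s hs => (hU s hs.1).1, fun k hk => (hW k hk.1).1⟩
  · intro s hs
    refine ⟨hs.2, ?_⟩
    rw [mem_preimage, (hU s hs.1).2 s.2]
    exact hs.1
  · intro k hk
    refine ⟨?_, ?_⟩
    · rw [hinv k hk.1]; exact hk.2
    · rw [mem_preimage, hinv k hk.1, (hW k hk.1).2.2]; exact hk.1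
  · intro s hs
    apply Subtype.ext
    rw [hinv _ hs.2, (hU s hs.1).2 s.2]
  · intro k hk
    rw [hinv k hk.1, (hW k hk.1).2.2]
  · exact hφc.comp continuous_subtype_val.continuousOn fun s hs => hs.1
  · rw [Topology.IsInducing.subtypeVal.continuousOn_iff]
    exact (hψc.mono fun k hk => hk.1).congr fun k hk => hinv k hk.1

variable [FiniteDimensional ℝ E] [FiniteDimensional ℝ K] [IsManifold 𝓘(ℝ, E) ∞ X]

/-- A subset with local parametrizations by the same vector space near all its points is an
embedded submanifold. -/
theorem exists_smoothEmbedding_of_slices {S : Set X}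
    (h : ∀ x : S, ∃ (φ : X → K) (ψ : K → X), IsLocalSlice E K S x φ ψ) :
    ∃ (_ : ChartedSpace K S) (_ : IsManifold 𝓘(ℝ, K) ∞ S),
      Manifold.IsSmoothEmbedding 𝓘(ℝ, K) 𝓘(ℝ, E) ∞ (Subtype.val : S → X) := by
  choose φ ψ hs using h
  choose e hxe heφ heψ hφ hψ using fun x => (hs x).exists_chart
  let c : ChartedSpace K S :=
    { atlas := range e
      chartAt := e
      mem_chart_source := hxe
      chart_mem_atlas := mem_range_self }
  have hm : IsManifold 𝓘(ℝ, K) ∞ S := by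
    refine isManifold_of_contDiffOn _ _ _ ?_
    rintro _ _ ⟨x, rfl⟩ ⟨y, rfl⟩
    rintro k ⟨⟨hk1, hk2⟩, -⟩
    have hk2' : (e x).symm k ∈ (e y).source := hk2
    have h1 : ContMDiffAt 𝓘(ℝ, K) 𝓘(ℝ, E) ∞ (ψ x) k := hψ x k hk1
    have h2 : ContMDiffAt 𝓘(ℝ, E) 𝓘(ℝ, K) ∞ (φ y) (ψ x k) := by
      have := hφ y _ hk2'
      rwa [heψ x k hk1] at this
    have h3 : ContDiffAt ℝ ∞ (fun k => φ y (ψ x k)) k := (h2.comp k h1).contDiffAt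
    refine h3.contDiffWithinAt.congr_of_mem (fun k' hk' => ?_) ⟨⟨hk1, hk2⟩, mem_range_self k⟩
    change e y ((e x).symm k') = _
    rw [heφ, heψ x k' hk'.1.1]
  have hchart : ∀ x, e x ∈ IsManifold.maximalAtlas 𝓘(ℝ, K) ∞ S := fun x =>
    IsManifold.chart_mem_maximalAtlas x
  have hval : ContMDiff 𝓘(ℝ, K) 𝓘(ℝ, E) ∞ (Subtype.val : S → X) := by
    intro x
    have h1 : ContMDiffNear K K (e x) x := contMDiffNear_chart (hchart x) (hxe x)
    have h2 := (hs x).smooth_symm.comp' h1 (heφ x x)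
    refine (h2.congr (f' := Subtype.val) ?_).contMDiffAt
    filter_upwards [(e x).open_source.mem_nhds (hxe x)] with s hs
    rw [← heψ x _ ((e x).map_source hs), (e x).left_inv hs]
  refine ⟨c, hm, ⟨isImmersion_of_leftInverses hval fun x => ?_, .subtypeVal⟩⟩
  refine ⟨fun y => (e x).symm (φ x y), ?_, ?_⟩
  · exact (contMDiffNear_chart_symm (hchart x) ((e x).map_source (hxe x))).comp' (hs x).smooth
      (heφ x x).symm
  · filter_upwards [(e x).open_source.mem_nhds (hxe x)] with s hs
    rw [← heφ, (e x).left_inv hs]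

/-- The equalizer of two smooth maps `f`, `g` has a local parametrization near `y` if `f` has a
local section through `y` along which `g` is constant: in a chart `χ`, this makes `χ ∘ f - χ ∘ g` a
submersion. -/
theorem exists_slice_equalizer (L : E ≃L[ℝ] F × K) {f g : Y → Z} {y : Y}
    (hf : ContMDiff 𝓘(ℝ, E) 𝓘(ℝ, F) ∞ f) (hg : ContMDiff 𝓘(ℝ, E) 𝓘(ℝ, F) ∞ g) (hfg : f y = g y)
    {c : Z → Y} (hc : ContMDiffNear F E c (f y)) (hcy : c (f y) = y)
    (hfc : ∀ᶠ z in 𝓝 (f y), f (c z) = z ∧ g (c z) = g y) :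
    ∃ (φ : Y → K) (ψ : K → Y), IsLocalSlice E K {y | f y = g y} y φ ψ := by
  obtain ⟨φ, hφ, hy⟩ : ∃ φ ∈ IsManifold.maximalAtlas 𝓘(ℝ, E) ∞ Y, y ∈ φ.source :=
    ⟨_, IsManifold.chart_mem_maximalAtlas y, mem_chart_source E y⟩
  obtain ⟨χ, hχ, hz⟩ : ∃ χ ∈ IsManifold.maximalAtlas 𝓘(ℝ, F) ∞ Z, f y ∈ χ.source :=
    ⟨_, IsManifold.chart_mem_maximalAtlas (f y), mem_chart_source F (f y)⟩
  have hz' : g y ∈ χ.source := hfg ▸ hz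
  have hyy := φ.left_inv hy
  have hΦ : ∀ᶠ u in 𝓝 (φ y), ContDiffAt ℝ ∞ (fun u => χ (f (φ.symm u)) - χ (g (φ.symm u))) u := by
    filter_upwards [ContMDiffNear.contDiffAt_charts (.of_contMDiff hf) hφ hχ hy hz,
      ContMDiffNear.contDiffAt_charts (.of_contMDiff hg) hφ hχ hy hz'] with u h1 h2
    exact h1.sub h2
  have hshift : ContMDiffNear F F (fun v => χ (f y) + v) 0 :=
    .of_contMDiff (contDiff_const.add contDiff_id).contMDiff
  -- along `v ↦ c (χ⁻¹ (χ (f y) + v))` the map `χ ∘ f - χ ∘ g` takes the value `v`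
  have hsec : ContMDiffNear F E (fun v => c (χ.symm (χ (f y) + v))) 0 :=
    hc.comp' ((contMDiffNear_chart_symm hχ (χ.map_source hz)).comp' hshift (add_zero _))
      (by rw [add_zero, χ.left_inv hz])
  have hsec0 : c (χ.symm (χ (f y) + 0)) = y := by rw [add_zero, χ.left_inv hz, hcy]
  have hsec' : ContDiffAt ℝ ∞ (fun v => φ (c (χ.symm (χ (f y) + v)))) 0 :=
    ((contMDiffNear_chart hφ hy).comp' hsec hsec0).contMDiffAt.contDiffAt
  have hzs : ContinuousAt (fun v => χ.symm (χ (f y) + v)) 0 :=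
    ((contMDiffNear_chart_symm hχ (χ.map_source hz)).comp' hshift (add_zero _)).continuousAt
  have hz0 : χ.symm (χ (f y) + 0) = f y := by rw [add_zero, χ.left_inv hz]
  obtain ⟨Ψ, hΨ1, hΨ2, hΨ3, hΨ4⟩ := exists_straightening_of_section L hΦ hsec'
    (by simp only [hsec0]) (by
      have h1 : ∀ᶠ v in 𝓝 (0 : F), f (c (χ.symm (χ (f y) + v))) = χ.symm (χ (f y) + v) ∧
          g (c (χ.symm (χ (f y) + v))) = g y := by
        rw [← hz0] at hfc
        simpa only [hz0] using hzs.eventually hfc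
      have h2 : ∀ᶠ v in 𝓝 (0 : F), c (χ.symm (χ (f y) + v)) ∈ φ.source :=
        hsec.continuousAt.eventually (φ.open_source.mem_nhds
          (show c (χ.symm (χ (f y) + 0)) ∈ φ.source by rw [hsec0]; exact hy))
      have h3 : ∀ᶠ v in 𝓝 (0 : F), χ (f y) + v ∈ χ.target :=
        hshift.continuousAt.eventually (χ.open_target.mem_nhds
          (show χ (f y) + 0 ∈ χ.target by rw [add_zero]; exact χ.map_source hz))
      filter_upwards [h1, h2, h3] with v hv1 hv2 hv3
      rw [φ.left_inv hv2, hv1.1, hv1.2, χ.right_inv hv3, ← hfg, add_sub_cancel_left])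
  have hΨn : ContMDiffNear E E Ψ (φ y) :=
    .of_contMDiffOn hΨ2.contMDiffOn Ψ.open_source hΨ1
  have hΨn' : ContMDiffNear E E Ψ.symm (Ψ (φ y)) :=
    .of_contMDiffOn hΨ3.contMDiffOn Ψ.open_target (Ψ.map_source hΨ1)
  have hp : ContMDiffNear E K (fun u => (L u).2) (Ψ (φ y)) :=
    .of_contMDiff (contDiff_snd.comp L.contDiff).contMDiff
  have hi : ContMDiffNear K E (fun k => L.symm (0, k)) ((L (Ψ (φ y))).2) :=
    .of_contMDiff (L.symm.contDiff.comp (contDiff_const.prodMk contDiff_id)).contMDiff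
  have hy0 : (L (Ψ (φ y))).1 = 0 := by
    rw [hΨ4 _ hΨ1, hyy, hfg, sub_self]
  have hi0 : L.symm (0, (L (Ψ (φ y))).2) = Ψ (φ y) := by
    rw [← hy0]; exact L.symm_apply_apply _
  have hψ1 := hΨn'.comp' hi hi0
  have hψ0 : Ψ.symm (L.symm (0, (L (Ψ (φ y))).2)) = φ y := by rw [hi0, Ψ.left_inv hΨ1]
  have hψ2 := (contMDiffNear_chart_symm hφ (φ.map_source hy)).comp' hψ1 hψ0
  have hψ00 : φ.symm (Ψ.symm (L.symm (0, (L (Ψ (φ y))).2))) = y := by rw [hψ0, hyy]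
  have hev1 : ∀ᶠ k in 𝓝 ((L (Ψ (φ y))).2), L.symm (0, k) ∈ Ψ.target :=
    hi.continuousAt.eventually (Ψ.open_target.mem_nhds
      (show L.symm (0, (L (Ψ (φ y))).2) ∈ Ψ.target by rw [hi0]; exact Ψ.map_source hΨ1))
  have hev2 : ∀ᶠ k in 𝓝 ((L (Ψ (φ y))).2), Ψ.symm (L.symm (0, k)) ∈ φ.target :=
    hψ1.continuousAt.eventually (φ.open_target.mem_nhds
      (show Ψ.symm (L.symm (0, (L (Ψ (φ y))).2)) ∈ φ.target by rw [hψ0]; exact φ.map_source hy))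
  refine ⟨fun y' => (L (Ψ (φ y'))).2, fun k => φ.symm (Ψ.symm (L.symm (0, k))),
    hp.comp (f := fun y' => Ψ (φ y')) (hΨn.comp (contMDiffNear_chart hφ hy)), hψ2, ?_, ?_, ?_⟩
  · filter_upwards [φ.open_source.mem_nhds hy,
      (φ.continuousAt hy).eventually (Ψ.open_source.mem_nhds hΨ1)] with y' h1 h2 h3
    have h4 : (L (Ψ (φ y'))).1 = 0 := by
      rw [hΨ4 _ h2, φ.left_inv h1, show f y' = g y' from h3, sub_self]
    rw [← h4, Prod.mk.eta, L.symm_apply_apply, Ψ.left_inv h2, φ.left_inv h1]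
  · have h1 : ∀ᶠ y' in 𝓝 y, f y' ∈ χ.source := (hf y).continuousAt.eventually
      (χ.open_source.mem_nhds hz)
    have h2 : ∀ᶠ y' in 𝓝 y, g y' ∈ χ.source := (hg y).continuousAt.eventually
      (χ.open_source.mem_nhds hz')
    rw [← hψ00] at h1 h2
    filter_upwards [hψ2.continuousAt.eventually h1, hψ2.continuousAt.eventually h2, hev1]
      with k hk1 hk2 hk3
    have h4 := hΨ4 _ (Ψ.map_target hk3)
    rw [Ψ.right_inv hk3, L.apply_symm_apply] at h4
    exact χ.injOn hk1 hk2 (sub_eq_zero.1 h4.symm)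
  · filter_upwards [hev1, hev2] with k h1 h2
    rw [φ.right_inv h2, Ψ.right_inv h1, L.apply_symm_apply]

end Slices

/-! ### Germs of maps between sets with smooth structures -/

namespace SmoothStructure

variable {P X Y Z : Type u}

/-- The neighbourhood filter of the topology of a smooth structure. -/
def nhds (σ : SmoothStructure X) (x : X) : Filter X := @_root_.nhds X σ.top x

/-- The map `c` is smooth on a neighbourhood of `p`. -/
def Near (π : SmoothStructure P) (σ : SmoothStructure X) (c : P → X) (p : P) : Prop :=
  letI := π.top; letI := π.charted; letI := σ.top; letI := σ.charted
  ContMDiffNear π.E σ.E c p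

section Near

variable {π : SmoothStructure P} {σ : SmoothStructure X} {τ : SmoothStructure Y}
  {ρ : SmoothStructure Z} {c c' : P → X} {p : P}

theorem Near.eventually (hc : π.Near σ c p) {Q : X → Prop} (h : ∀ᶠ x in σ.nhds (c p), Q x) :
    ∀ᶠ p' in π.nhds p, Q (c p') := by
  let := π.top; let := π.charted; let := σ.top; let := σ.charted
  exact (ContMDiffNear.continuousAt hc).eventually h

theorem Near.eventually' (hc : π.Near σ c p) {x : X} (hx : c p = x) {Q : X → Prop}
    (h : ∀ᶠ x in σ.nhds x, Q x) : ∀ᶠ p' in π.nhds p, Q (c p') :=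
  hc.eventually (hx ▸ h)

theorem Near.comp {f : X → Y} (hf : σ.Near τ f (c p)) (hc : π.Near σ c p) :
    π.Near τ (fun p => f (c p)) p := by
  let := π.top; let := π.charted; let := σ.top; let := σ.charted; let := τ.top
  let := τ.charted
  exact ContMDiffNear.comp hf hc

theorem Near.comp' {f : X → Y} {x : X} (hf : σ.Near τ f x) (hc : π.Near σ c p) (hx : c p = x) :
    π.Near τ (fun p => f (c p)) p :=
  Near.comp (hx ▸ hf) hc

theorem Near.congr (hc : π.Near σ c p) (h : ∀ᶠ p' in π.nhds p, c' p' = c p') :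
    π.Near σ c' p := by
  let := π.top; let := π.charted; let := σ.top; let := σ.charted
  exact ContMDiffNear.congr hc h

theorem eventually_self {Q : P → Prop} (h : ∀ᶠ p' in π.nhds p, Q p') : Q p :=
  let := π.top
  Eventually.self_of_nhds (x := p) h

theorem Smooth.near {f : X → Y} (hf : σ.Smooth τ f) (x : X) : σ.Near τ f x := by
  let := σ.top; let := σ.charted; let := τ.top; let := τ.charted
  exact ContMDiffNear.of_contMDiff hf

theorem Smooth.near_comp {f : X → Y} (hf : σ.Smooth τ f) (hc : π.Near σ c p) :
    π.Near τ (fun p => f (c p)) p :=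
  (hf.near _).comp hc

theorem smooth_of_near {f : X → Y} (h : ∀ x, σ.Near τ f x) : σ.Smooth τ f := by
  let := σ.top; let := σ.charted; let := τ.top; let := τ.charted
  exact fun x => ContMDiffNear.contMDiffAt (h x)

theorem Smooth.comp {f : X → Y} {g : Y → Z} (hg : τ.Smooth ρ g) (hf : σ.Smooth τ f) :
    σ.Smooth ρ (fun x => g (f x)) :=
  smooth_of_near fun x => hg.near_comp (hf.near x)

theorem smooth_id (σ : SmoothStructure X) : σ.Smooth σ (fun x => x) := by
  let := σ.top; let := σ.charted
  exact contMDiff_id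

theorem near_id (π : SmoothStructure P) (p : P) : π.Near π (fun x => x) p := (smooth_id π).near p

theorem near_const (π : SmoothStructure P) (σ : SmoothStructure X) (x : X) (p : P) :
    π.Near σ (fun _ => x) p := by
  let := π.top; let := π.charted; let := σ.top; let := σ.charted
  exact ContMDiffNear.of_contMDiff contMDiff_const

end Near

section Products

variable {π : SmoothStructure P} {σ : SmoothStructure X} {τ : SmoothStructure Y} {p : P}

theorem near_prod_iff {c : P → X × Y} : π.Near (σ.prod τ) c p ↔
    π.Near σ (fun p => (c p).1) p ∧ π.Near τ (fun p => (c p).2) p := by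
  let := π.top; let := π.charted; let := σ.top; let := σ.charted; let := τ.top
  let := τ.charted
  have h : ∀ p', (@ContMDiffAt ℝ _ π.E _ _ π.E _ 𝓘(ℝ, π.E) P _ _ (σ.E × τ.E) _ _ (σ.E × τ.E) _
      𝓘(ℝ, σ.E × τ.E) (X × Y) _ (prodChartedSpace σ.E X τ.E Y) ∞ c p') ↔
      ContMDiffAt 𝓘(ℝ, π.E) 𝓘(ℝ, σ.E) ∞ (fun p => (c p).1) p' ∧
      ContMDiffAt 𝓘(ℝ, π.E) 𝓘(ℝ, τ.E) ∞ (fun p => (c p).2) p' := by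
    intro p'
    rw [modelWithCornersSelf_prod]
    exact contMDiffAt_prod_iff c
  exact (eventually_congr (Eventually.of_forall h)).trans eventually_and

theorem Near.prodMk {a : P → X} {b : P → Y} (ha : π.Near σ a p) (hb : π.Near τ b p) :
    π.Near (σ.prod τ) (fun p => (a p, b p)) p :=
  near_prod_iff.2 ⟨ha, hb⟩

theorem smooth_fst (σ : SmoothStructure X) (τ : SmoothStructure Y) :
    (σ.prod τ).Smooth σ Prod.fst :=
  smooth_of_near fun x => (near_prod_iff.1 (near_id (σ.prod τ) x)).1

theorem smooth_snd (σ : SmoothStructure X) (τ : SmoothStructure Y) :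
    (σ.prod τ).Smooth τ Prod.snd :=
  smooth_of_near fun x => (near_prod_iff.1 (near_id (σ.prod τ) x)).2

variable {ι : Type} [Fintype ι] {A : ι → Type u} {α : ∀ i, SmoothStructure (A i)}

/-- A germ of maps into a finite product of manifolds is smooth if its components are. -/
theorem near_pi_iff {c : P → ∀ i, A i} : π.Near (pi α) c p ↔
    ∀ i, π.Near (α i) (fun p => c p i) p := by
  let := π.top; let := π.charted; let := fun i => (α i).top; let := fun i => (α i).charted
  have := fun i => (α i).mfd
  have h : ∀ p', (@ContMDiffAt ℝ _ π.E _ _ π.E _ 𝓘(ℝ, π.E) P _ _ (∀ i, (α i).E) _ _ (∀ i, (α i).E)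
      _ 𝓘(ℝ, ∀ i, (α i).E) (∀ i, A i) _ (piChartedSpace (fun i => (α i).E) A) ∞ c p') ↔
      ∀ i, ContMDiffAt 𝓘(ℝ, π.E) 𝓘(ℝ, (α i).E) ∞ (fun p => c p i) p' := by
    intro p'
    simp only [contMDiffAt_iff, continuousAt_pi, forall_and, contDiffWithinAt_pi,
      Function.comp_def]
    rfl
  exact (eventually_congr (Eventually.of_forall h)).trans eventually_all

theorem smooth_apply (α : ∀ i, SmoothStructure (A i)) (i : ι) :
    (pi α).Smooth (α i) (fun x => x i) :=
  smooth_of_near fun x => near_pi_iff.1 (near_id (pi α) x) i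

end Products

end SmoothStructure

/-! ### Submersions, embeddings and submanifolds -/

namespace SmoothStructure

variable {P X Y Z : Type u} {π : SmoothStructure P} {σ : SmoothStructure X} {τ : SmoothStructure Y}
  {ρ : SmoothStructure Z}

theorem Submersion.smooth {f : X → Y} (hf : σ.Submersion τ f) : σ.Smooth τ f := by
  let := σ.top; let := σ.charted; let := τ.top; let := τ.charted
  exact Manifold.IsSubmersion.contMDiff hf

theorem Submersion.exists_section {f : X → Y} (hf : σ.Submersion τ f) (x : X) :
    ∃ s : Y → X, τ.Near σ s (f x) ∧ s (f x) = x ∧ ∀ᶠ y in τ.nhds (f x), f (s y) = y := by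
  let := σ.top; let := σ.charted; let := τ.top; let := τ.charted
  have := σ.mfd; have := τ.mfd
  exact exists_section_of_isSubmersion hf x

/-- Submersions lift germs of smooth maps. -/
theorem Submersion.exists_lift {f : X → Y} (hf : σ.Submersion τ f) {c : P → Y} {p : P}
    (hc : π.Near τ c p) (x : X) (hx : f x = c p) :
    ∃ d : P → X, π.Near σ d p ∧ d p = x ∧ ∀ᶠ p' in π.nhds p, f (d p') = c p' := by
  obtain ⟨s, h1, h2, h3⟩ := hf.exists_section x
  exact ⟨fun p => s (c p), h1.comp' hc hx.symm, by simp only [← hx, h2], hc.eventually' hx.symm h3⟩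

theorem submersion_of_sections {f : X → Y} (hf : σ.Smooth τ f)
    (h : ∀ x, ∃ s : Y → X, τ.Near σ s (f x) ∧ s (f x) = x ∧ ∀ᶠ y in τ.nhds (f x), f (s y) = y) :
    σ.Submersion τ f := by
  let := σ.top; let := σ.charted; let := τ.top; let := τ.charted
  have := σ.mfd; have := τ.mfd
  exact isSubmersion_of_sections hf h

/-- An injective submersion is étale. -/
theorem Submersion.etale {f : X → Y} (hf : σ.Submersion τ f) (hi : Function.Injective f) :
    σ.Etale τ f := by
  let := σ.top; let := σ.charted; let := τ.top; let := τ.charted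
  intro x
  obtain ⟨s, h1, -, h3⟩ := hf.exists_section x
  obtain ⟨V, hV, hVo, hxV⟩ := eventually_nhds_iff.1 (Filter.Eventually.and h1 h3)
  have hsm : ContMDiff 𝓘(ℝ, σ.E) 𝓘(ℝ, τ.E) ∞ f := hf.smooth
  refine ⟨{ toFun := f
            invFun := s
            source := f ⁻¹' V
            target := V
            map_source' := fun x hx => hx
            map_target' := fun y hy => by rw [mem_preimage, (hV y hy).2]; exact hy
            left_inv' := fun x hx => hi (hV _ hx).2
            right_inv' := fun y hy => (hV y hy).2
            open_source := hVo.preimage hsm.continuous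
            open_target := hVo
            contMDiffOn_toFun := hsm.contMDiffOn
            contMDiffOn_invFun := fun y hy => (hV y hy).1.contMDiffWithinAt }, hxV, fun _ _ => rfl⟩

/-- A bijective submersion is a diffeomorphism. -/
theorem Submersion.diffeo {f : X → Y} (hf : σ.Submersion τ f) (hb : Function.Bijective f) :
    σ.Diffeo τ f := by
  let := σ.top; let := σ.charted; let := τ.top; let := τ.charted
  refine ⟨{ toEquiv := Equiv.ofBijective f hb
            contMDiff_toFun := hf.smooth
            contMDiff_invFun := smooth_of_near (σ := τ) (τ := σ) fun y => ?_ }, rfl⟩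
  obtain ⟨x, rfl⟩ := hb.2 y
  obtain ⟨s, h1, -, h3⟩ := hf.exists_section x
  exact h1.congr (h3.mono fun y hy => (Equiv.symm_apply_eq (Equiv.ofBijective f hb)).2 hy.symm)

theorem Embedding.smooth {f : X → Y} (hf : σ.Embedding τ f) : σ.Smooth τ f := by
  let := σ.top; let := σ.charted; let := τ.top; let := τ.charted
  exact Manifold.IsSmoothEmbedding.contMDiff hf

theorem Embedding.exists_leftInverse {f : X → Y} (hf : σ.Embedding τ f) (x : X) :
    ∃ g : Y → X, τ.Near σ g (f x) ∧ ∀ᶠ x' in σ.nhds x, g (f x') = x' := by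
  let := σ.top; let := σ.charted; let := τ.top; let := τ.charted
  have := σ.mfd; have := τ.mfd
  exact exists_leftInverse_of_isImmersion hf.isImmersion x

/-- Embeddings detect smoothness of germs. -/
theorem Embedding.near_iff {f : X → Y} (hf : σ.Embedding τ f) {c : P → X} {p : P} :
    π.Near σ c p ↔ π.Near τ (fun p => f (c p)) p := by
  refine ⟨fun h => hf.smooth.near_comp h, fun h => ?_⟩
  let := σ.top; let := σ.charted; let := τ.top; let := τ.charted; let := π.top
  let := π.charted
  have := σ.mfd; have := τ.mfd; have := π.mfd
  refine h.mono fun p' hp' => ?_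
  exact (ContMDiffAt.iff_comp_isImmersionAt (hf.isImmersion.isImmersionAt _)).2
    ⟨hf.isEmbedding.isInducing.continuousAt_iff.2 hp'.continuousAt, hp'⟩

/-- A smooth map with a smooth left inverse is an embedding. -/
theorem embedding_of_leftInverse {f : X → Y} {g : Y → X} (hf : σ.Smooth τ f) (hg : τ.Smooth σ g)
    (h : ∀ x, g (f x) = x) : σ.Embedding τ f := by
  let := σ.top; let := σ.charted; let := τ.top; let := τ.charted
  have := σ.mfd; have := τ.mfd
  have hf' : ContMDiff 𝓘(ℝ, σ.E) 𝓘(ℝ, τ.E) ∞ f := hf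
  have hg' : ContMDiff 𝓘(ℝ, τ.E) 𝓘(ℝ, σ.E) ∞ g := hg
  exact ⟨isImmersion_of_leftInverses hf' fun x => ⟨g, .of_contMDiff hg', .of_forall h⟩,
    .of_leftInverse h hg'.continuous hf'.continuous⟩

section Submanifolds

variable {S : Set X}

theorem IsSubmanifold.embedding (hS : σ.IsSubmanifold S) :
    (σ.sub S).Embedding σ Subtype.val := by
  unfold sub
  rw [dif_pos hS]
  exact hS.choose_spec

theorem IsSubmanifold.smooth_val (hS : σ.IsSubmanifold S) : (σ.sub S).Smooth σ Subtype.val :=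
  hS.embedding.smooth

theorem IsSubmanifold.near_iff (hS : σ.IsSubmanifold S) {c : P → S} {p : P} :
    π.Near (σ.sub S) c p ↔ π.Near σ (fun p => (c p : X)) p :=
  hS.embedding.near_iff

theorem IsSubmanifold.smooth_iff (hS : σ.IsSubmanifold S) {c : P → S} :
    π.Smooth (σ.sub S) c ↔ π.Smooth σ (fun p => (c p : X)) :=
  ⟨fun h => hS.smooth_val.comp h, fun h => smooth_of_near fun p => hS.near_iff.2 (h.near p)⟩

open Classical in
/-- A germ of smooth maps with values in a submanifold is a germ of smooth maps into it. -/
theorem IsSubmanifold.exists_lift (hS : σ.IsSubmanifold S) {c : P → X} {p : P}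
    (hc : π.Near σ c p) (h : ∀ᶠ p' in π.nhds p, c p' ∈ S) :
    ∃ d : P → S, π.Near (σ.sub S) d p ∧ ∀ᶠ p' in π.nhds p, (d p' : X) = c p' := by
  have hp : c p ∈ S := eventually_self (π := π) (Q := fun p' => c p' ∈ S) h
  let d : P → S := fun p' => if hp' : c p' ∈ S then ⟨c p', hp'⟩ else ⟨c p, hp⟩
  have hd : ∀ᶠ p' in π.nhds p, (d p' : X) = c p' := h.mono fun p' hp => by
    simp only [d, dif_pos hp]
  exact ⟨d, hS.near_iff.2 (hc.congr hd), hd⟩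

theorem isSubmanifold_of_slices {K : Type} [NormedAddCommGroup K] [NormedSpace ℝ K]
    [FiniteDimensional ℝ K] (h : ∀ x : S, ∃ (φ : X → K) (ψ : K → X),
      letI := σ.top; letI := σ.charted; IsLocalSlice σ.E K S x φ ψ) : σ.IsSubmanifold S := by
  let := σ.top; let := σ.charted
  have := σ.mfd
  obtain ⟨c, hm, he⟩ := exists_smoothEmbedding_of_slices h
  exact ⟨{ E := K, top := instTopologicalSpaceSubtype, charted := c, mfd := hm }, he⟩

theorem isSubmanifold_univ (σ : SmoothStructure X) : σ.IsSubmanifold univ := by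
  refine isSubmanifold_of_slices (K := σ.E) fun x => ?_
  let := σ.top; let := σ.charted
  have := σ.mfd
  have h := IsManifold.chart_mem_maximalAtlas (I := 𝓘(ℝ, σ.E)) (n := ∞) (x : X)
  have hx := mem_chart_source σ.E (x : X)
  refine ⟨chartAt σ.E (x : X), (chartAt σ.E (x : X)).symm, contMDiffNear_chart h hx,
    contMDiffNear_chart_symm h ((chartAt σ.E (x : X)).map_source hx), ?_,
    Eventually.of_forall fun _ => trivial, ?_⟩
  · filter_upwards [(chartAt σ.E (x : X)).open_source.mem_nhds hx] with x' hx' _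
    exact (chartAt σ.E (x : X)).left_inv hx'
  · filter_upwards [(chartAt σ.E (x : X)).open_target.mem_nhds
      ((chartAt σ.E (x : X)).map_source hx)] with k hk
    exact (chartAt σ.E (x : X)).right_inv hk

/-- Let `f` and `g` be smooth maps on a submanifold such that `f` has local sections, through all
points where the maps agree, along which `g` is constant. Then the equalizer of `f` and `g` is a
submanifold. -/
theorem IsSubmanifold.equalizer (hS : σ.IsSubmanifold S) {f g : S → Y}
    (hf : (σ.sub S).Smooth τ f) (hg : (σ.sub S).Smooth τ g)
    (h : ∀ x, f x = g x → ∃ c : Y → S, τ.Near (σ.sub S) c (f x) ∧ c (f x) = x ∧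
      ∀ᶠ y in τ.nhds (f x), f (c y) = y ∧ g (c y) = g x) :
    σ.IsSubmanifold {x | ∃ hx : x ∈ S, f ⟨x, hx⟩ = g ⟨x, hx⟩} := by
  have hval := hS.embedding
  generalize hυ : σ.sub S = υ at *
  let := σ.top; let := σ.charted; let := τ.top; let := τ.charted; let := υ.top
  let := υ.charted
  have := σ.mfd; have := τ.mfd; have := υ.mfd
  -- an empty equalizer is a submanifold whatever the dimensions are
  by_cases hne : ∃ x, f x = g x
  swap
  · exact isSubmanifold_of_slices (K := σ.E) fun x => (hne ⟨_, x.2.choose_spec⟩).elim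
  have hdim : Module.finrank ℝ τ.E ≤ Module.finrank ℝ υ.E := by
    obtain ⟨x, hx⟩ := hne
    obtain ⟨c, hc1, hc2, hc3⟩ := h x hx
    exact finrank_le_of_germs hc1 (.of_contMDiff hf) (hc3.mono fun y hy => hy.1)
  obtain ⟨L⟩ := exists_complement_of_finrank_le hdim
  refine isSubmanifold_of_slices
    (K := EuclideanSpace ℝ (Fin (Module.finrank ℝ υ.E - Module.finrank ℝ τ.E)))
    fun ⟨x, hx, hfg⟩ => ?_
  obtain ⟨c, hc1, hc2, hc3⟩ := h _ hfg
  obtain ⟨φ, ψ, hs⟩ := exists_slice_equalizer L hf hg hfg hc1 hc2 hc3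
  -- a local retraction onto `S` extends the parametrization of the equalizer in `S` to one in `X`
  obtain ⟨r, hr, hrv⟩ := hval.exists_leftInverse ⟨x, hx⟩
  have hrx : r x = ⟨x, hx⟩ :=
    eventually_self (π := υ) (Q := fun s : S => r (s : X) = s) hrv
  have hr' : ContMDiffNear σ.E υ.E r x := hr
  refine ⟨fun x' => φ (r x'), fun k => ψ k, hs.smooth.comp' hr' hrx, ?_, ?_, ?_, ?_⟩
  · have h1 : ContMDiffNear υ.E σ.E (Subtype.val : S → X) (ψ (φ (r x))) :=
      .of_contMDiff hval.smooth
    refine h1.comp (f := ψ) ?_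
    rw [hrx]
    exact hs.smooth_symm
  · have h1 := hs.left_inv
    have hind : 𝓝 (⟨x, hx⟩ : S) = comap Subtype.val (𝓝 x) :=
      hval.isEmbedding.isInducing.nhds_eq_comap _
    rw [hind] at h1
    have h2 : ∀ᶠ s : S in 𝓝 (⟨x, hx⟩ : S), r (s : X) = s := hrv
    rw [hind] at h2
    filter_upwards [eventually_comap.1 h1, eventually_comap.1 h2] with x' h3 h4 ⟨h5, h6⟩
    have h7 : r x' = ⟨x', h5⟩ := h4 ⟨x', h5⟩ rfl
    rw [h7]
    exact congrArg Subtype.val (h3 ⟨x', h5⟩ rfl h6)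
  · simp only [hrx]
    exact hs.mem.mono fun k hk => ⟨(ψ k).2, hk⟩
  · simp only [hrx]
    have hψc : ContinuousAt ψ (φ ⟨x, hx⟩) := hs.smooth_symm.continuousAt
    have hψ0 : ψ (φ ⟨x, hx⟩) = ⟨x, hx⟩ := hs.left_inv.self_of_nhds hfg
    have h2 : ∀ᶠ s : S in 𝓝 (⟨x, hx⟩ : S), r (s : X) = s := hrv
    rw [← hψ0] at h2
    filter_upwards [hs.right_inv, hψc.eventually h2] with k h3 h4
    rw [h4, h3]

/-- The equalizer of two smooth maps `f` and `g` is a submanifold if `f` has local sections, through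
all points where the maps agree, along which `g` is constant. -/
theorem isSubmanifold_equalizer {f g : X → Y} (hf : σ.Smooth τ f) (hg : σ.Smooth τ g)
    (h : ∀ x, f x = g x → ∃ c : Y → X, τ.Near σ c (f x) ∧ c (f x) = x ∧
      ∀ᶠ y in τ.nhds (f x), f (c y) = y ∧ g (c y) = g x) :
    σ.IsSubmanifold {x | f x = g x} := by
  have hu := isSubmanifold_univ σ
  have := hu.equalizer (f := fun x => f x) (g := fun x => g x) (hf.comp hu.smooth_val)
    (hg.comp hu.smooth_val) fun x hx => by
      obtain ⟨c, h1, h2, h3⟩ := h x hx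
      exact ⟨fun y => ⟨c y, trivial⟩, hu.near_iff.2 h1, Subtype.ext h2, h3⟩
  convert this using 1
  ext x
  simp

/-- The fiber product of a smooth map and a submersion is a submanifold. -/
theorem isSubmanifold_fiberProduct {f : X → Z} {g : Y → Z} (hf : σ.Smooth ρ f)
    (hg : τ.Submersion ρ g) : (σ.prod τ).IsSubmanifold {p | f p.1 = g p.2} := by
  have h := isSubmanifold_equalizer (σ := σ.prod τ) (τ := ρ) (f := fun p => g p.2)
    (g := fun p => f p.1)
    (hg.smooth.comp (smooth_snd σ τ)) (hf.comp (smooth_fst σ τ)) fun ⟨x, y⟩ hxy => by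
      obtain ⟨s, h1, h2, h3⟩ := hg.exists_section y
      exact ⟨fun z => (x, s z), (near_const _ _ _ _).prodMk h1, by simp only [h2],
        h3.mono fun z hz => ⟨hz, rfl⟩⟩
  convert h using 1
  ext p
  exact eq_comm

end Submanifolds

end SmoothStructure

/-! ### The nerve of a Lie groupoid -/

namespace SmoothStructure

variable {P : Type u} {π : SmoothStructure P} {p : P}
  {ι : Type} [Fintype ι] [DecidableEq ι] {A : ι → Type u} {α : ∀ i, SmoothStructure (A i)}

/-- Varying one component of a point of a product smoothly. -/
theorem near_update (x : ∀ i, A i) {i : ι} {s : P → A i} (hs : π.Near (α i) s p) :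
    π.Near (pi α) (fun p => Function.update x i (s p)) p := by
  refine near_pi_iff.2 fun j => ?_
  rcases eq_or_ne j i with rfl | h
  · simpa using hs
  · simpa [h] using near_const π (α j) (x j) p

end SmoothStructure

namespace Gpd

open SmoothStructure

variable {G X : Type u} {γ : Gpd G X} {σG : SmoothStructure G} {σX : SmoothStructure X}
  {P : Type u} {π : SmoothStructure P} {p : P}

open Classical in
/-- The multiplication of a groupoid as a total function. Where the product is not defined, the
value is the first factor; then at least the target is always the one of the first factor. -/
noncomputable def pmul (γ : Gpd G X) (g h : G) : G :=
  if e : γ.src g = γ.tgt h then γ.mul g h e else g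

theorem pmul_eq {g h : G} (e : γ.src g = γ.tgt h) : γ.pmul g h = γ.mul g h e := dif_pos e

theorem src_pmul {g h : G} (e : γ.src g = γ.tgt h) : γ.src (γ.pmul g h) = γ.src h := by
  rw [pmul_eq e, src_mul]

theorem tgt_pmul (g h : G) : γ.tgt (γ.pmul g h) = γ.tgt g := by
  unfold pmul
  split_ifs
  · rw [tgt_mul]
  · rfl

theorem pmul_assoc {g h k : G} (e : γ.src g = γ.tgt h) (e' : γ.src h = γ.tgt k) :
    γ.pmul (γ.pmul g h) k = γ.pmul g (γ.pmul h k) := by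
  rw [pmul_eq e, pmul_eq e', pmul_eq (by rw [src_mul, e']), pmul_eq (by rw [tgt_mul, e]),
    mul_assoc _ _ _ _ e e']

theorem pmul_inv_cancel {g h : G} (e : γ.src g = γ.tgt h) :
    γ.pmul (γ.pmul g h) (γ.inv h) = g := by
  rw [pmul_assoc e (γ.tgt_inv h).symm, pmul_eq (γ.tgt_inv h).symm, mul_inv, ← e,
    pmul_eq (γ.tgt_one _).symm, mul_one]

theorem pmul_inv_cancel' {g h : G} (e : γ.src g = γ.src h) :
    γ.pmul (γ.pmul g (γ.inv h)) h = g := by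
  rw [pmul_assoc (by rw [tgt_inv, e]) (γ.src_inv h), pmul_eq (γ.src_inv h), inv_mul, ← e,
    pmul_eq (γ.tgt_one _).symm, mul_one]

theorem inv_pmul_cancel {g h : G} (e : γ.src g = γ.tgt h) :
    γ.pmul (γ.inv g) (γ.pmul g h) = h := by
  rw [← pmul_assoc (γ.src_inv g) e, pmul_eq (γ.src_inv g), inv_mul, e,
    pmul_eq (γ.src_one _), one_mul]

theorem inv_pmul_cancel' {g h : G} (e : γ.tgt g = γ.tgt h) :
    γ.pmul g (γ.pmul (γ.inv g) h) = h := by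
  rw [← pmul_assoc (γ.tgt_inv g).symm (by rw [src_inv, e]), pmul_eq (γ.tgt_inv g).symm, mul_inv, e,
    pmul_eq (γ.src_one _), one_mul]

theorem src_pmul_inv {g h : G} (e : γ.src g = γ.src h) : γ.src (γ.pmul g (γ.inv h)) = γ.tgt h := by
  rw [src_pmul (by rw [tgt_inv, e]), src_inv]

theorem src_inv_pmul {g h : G} (e : γ.tgt g = γ.tgt h) : γ.src (γ.pmul (γ.inv g) h) = γ.src h := by
  rw [src_pmul (by rw [src_inv, e])]

theorem tgt_inv_pmul (g h : G) : γ.tgt (γ.pmul (γ.inv g) h) = γ.src g := by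
  rw [tgt_pmul, tgt_inv]

theorem inv_inv (g : G) : γ.inv (γ.inv g) = g :=
  (γ.eq_inv_of_mul_eq_one (γ.inv g) g (γ.src_inv g) (by rw [inv_mul, tgt_inv])).symm

theorem Hom.map_pmul {G' X' : Type u} {γ' : Gpd G' X'} (φ : Hom γ γ') {g h : G}
    (e : γ.src g = γ.tgt h) : φ.arr (γ.pmul g h) = γ'.pmul (φ.arr g) (φ.arr h) := by
  rw [pmul_eq e, pmul_eq (by rw [φ.src_arr, φ.tgt_arr, e]), φ.map_mul]

/-- The target map is a submersion if the source map is. -/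
theorem tgt_submersion_of_src (h : σG.Submersion σX γ.src) (hi : σG.Smooth σG γ.inv) :
    σG.Submersion σX γ.tgt := by
  have ht : σG.Smooth σX γ.tgt := by
    have := h.smooth.comp hi
    simpa only [src_inv] using this
  refine submersion_of_sections ht fun g => ?_
  obtain ⟨s, h1, h2, h3⟩ := h.exists_section (γ.inv g)
  rw [src_inv] at h1 h2 h3
  exact ⟨fun x => γ.inv (s x), hi.near_comp h1, by simp only [h2, inv_inv],
    h3.mono fun x hx => by rw [tgt_inv, hx]⟩

theorem isSubmanifold_composablePairs (hs : σG.Smooth σX γ.src) (ht : σG.Submersion σX γ.tgt) :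
    (σG.prod σG).IsSubmanifold {p | γ.src p.1 = γ.tgt p.2} :=
  isSubmanifold_fiberProduct hs ht

/-- The string `g` followed by the arrow `a`. -/
def snoc {n : ℕ} (g : Fin (n + 1) → G) (a : G) (k : Fin (n + 2)) : G :=
  if h : k.1 < n + 1 then g ⟨k, h⟩ else a

theorem snoc_of_lt {n : ℕ} (g : Fin (n + 1) → G) (a : G) (k : ℕ) (hk : k < n + 1) :
    snoc g a ⟨k, by omega⟩ = g ⟨k, hk⟩ := dif_pos hk

theorem snoc_last {n : ℕ} (g : Fin (n + 1) → G) (a : G) (k : ℕ) (hk : k = n + 1) :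
    snoc g a ⟨k, by omega⟩ = a := dif_neg (by simp only; omega)

theorem snoc_composable {n : ℕ} {g : Fin (n + 1) → G} {a : G} (hg : γ.Composable g)
    (h : γ.src (g (Fin.last n)) = γ.tgt a) : γ.Composable (snoc g a) := by
  intro k hk
  rcases Nat.lt_or_ge k n with h' | h'
  · rw [snoc_of_lt g a k (by omega), snoc_of_lt g a (k + 1) (by omega)]
    exact hg k (by omega)
  · obtain rfl : k = n := by omega
    rw [snoc_of_lt g a k (by omega), snoc_last g a (k + 1) rfl]
    exact h

/-- Strings of length one are composable. -/
theorem composable_const (a : G) : γ.Composable (fun _ : Fin 1 => a) :=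
  fun k hk => absurd hk (by omega)

theorem face_last_apply {n : ℕ} (x : γ.Nerve (n + 2)) (k : ℕ) (hk : k < n + 1) :
    (γ.face (n + 1) (n + 2) le_rfl x).1 ⟨k, hk⟩ = x.1 ⟨k, by omega⟩ :=
  if_pos (show k + 1 < n + 2 by omega)

theorem faceFun_zero {n : ℕ} (g : Fin (n + 2) → G) (hg : γ.Composable g) (k : ℕ)
    (hk : k < n + 1) : γ.faceFun 0 g hg ⟨k, hk⟩ = g ⟨k + 1, by omega⟩ := by
  simp [faceFun]

theorem face_zero_apply {n : ℕ} (x : γ.Nerve (n + 2)) (k : ℕ) (hk : k < n + 1) :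
    (γ.face (n + 1) 0 (Nat.zero_le _) x).1 ⟨k, hk⟩ = x.1 ⟨k + 1, by omega⟩ :=
  faceFun_zero x.1 x.2 k hk

namespace IsLie

theorem near_pmul (hγ : γ.IsLie σG σX) {a b : P → G} (ha : π.Near σG a p) (hb : π.Near σG b p)
    (h : ∀ᶠ p' in π.nhds p, γ.src (a p') = γ.tgt (b p')) :
    π.Near σG (fun p => γ.pmul (a p) (b p)) p := by
  obtain ⟨d, hd, hd'⟩ := (isSubmanifold_composablePairs hγ.src_submersion.smooth
    hγ.tgt_submersion).exists_lift (ha.prodMk hb) h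
  refine (hγ.mul_smooth.near_comp hd).congr (hd'.mono fun p' hp' => ?_)
  rw [← pmul_eq, hp']

theorem near_mul (hγ : γ.IsLie σG σX) {a b : P → G} (ha : π.Near σG a p) (hb : π.Near σG b p)
    (h : ∀ p', γ.src (a p') = γ.tgt (b p')) :
    π.Near σG (fun p => γ.mul (a p) (b p) (h p)) p := by
  refine (hγ.near_pmul ha hb (.of_forall h)).congr (.of_forall fun p' => ?_)
  rw [pmul_eq (h p')]

theorem near_inv (hγ : γ.IsLie σG σX) {a : P → G} (ha : π.Near σG a p) :
    π.Near σG (fun p => γ.inv (a p)) p :=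
  hγ.inv_smooth.near_comp ha

theorem near_src (hγ : γ.IsLie σG σX) {a : P → G} (ha : π.Near σG a p) :
    π.Near σX (fun p => γ.src (a p)) p :=
  hγ.src_submersion.smooth.near_comp ha

theorem near_tgt (hγ : γ.IsLie σG σX) {a : P → G} (ha : π.Near σG a p) :
    π.Near σX (fun p => γ.tgt (a p)) p :=
  hγ.tgt_submersion.smooth.near_comp ha

/-- The composability conditions are imposed one at a time, beginning with the last one: the `j`-th
arrow can be varied as long as only the later conditions are imposed. -/
theorem isSubmanifold_composable_ge (hγ : γ.IsLie σG σX) (n : ℕ) (j : ℕ) :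
    (SmoothStructure.pi fun _ : Fin (n + 1) => σG).IsSubmanifold
      {g | ∀ (k : ℕ) (hk : k + 1 < n + 1), n - j ≤ k →
        γ.src (g ⟨k, by omega⟩) = γ.tgt (g ⟨k + 1, hk⟩)} := by
  induction j with
  | zero =>
    convert isSubmanifold_univ _ using 1
    exact eq_univ_of_forall fun g k hk hk' => by omega
  | succ j ih =>
    rcases Nat.lt_or_ge j n with hj | hj
    swap
    · rwa [show n - (j + 1) = n - j by omega]
    let a : Fin (n + 1) := ⟨n - (j + 1), by omega⟩
    let b : Fin (n + 1) := ⟨n - (j + 1) + 1, by omega⟩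
    have hval := ih.smooth_val
    have := ih.equalizer (τ := σX) (f := fun g => γ.src (g.1 a)) (g := fun g => γ.tgt (g.1 b))
      (hγ.src_submersion.smooth.comp ((smooth_apply _ a).comp hval))
      (hγ.tgt_submersion.smooth.comp ((smooth_apply _ b).comp hval)) fun g hg => by
        obtain ⟨s, h1, h2, h3⟩ := hγ.src_submersion.exists_section (g.1 a)
        refine ⟨fun x => ⟨Function.update g.1 a (s x), fun k hk hk' => ?_⟩,
          ih.near_iff.2 (near_update _ h1), Subtype.ext ?_, h3.mono fun x hx => ⟨?_, ?_⟩⟩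
        · rw [Function.update_of_ne, Function.update_of_ne]
          · exact g.2 k hk hk'
          · exact fun h => by have := congrArg Fin.val h; simp only [a] at this; omega
          · exact fun h => by have := congrArg Fin.val h; simp only [a] at this; omega
        · simp only [h2, Function.update_eq_self]
        · simp only [Function.update_self, hx]
        · dsimp only
          rw [Function.update_of_ne]
          exact fun h => by have := congrArg Fin.val h; simp only [a, b] at this; omega
    convert this using 1
    ext g
    refine ⟨fun hg => ⟨fun k hk hk' => hg k hk (by omega), hg _ (by omega) le_rfl⟩,
      fun ⟨h1, h2⟩ k hk hk' => ?_⟩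
    rcases hk'.eq_or_lt with rfl | h
    · exact h2
    · exact h1 k hk (by omega)

theorem nerveIsSmooth (hγ : γ.IsLie σG σX) : γ.NerveIsSmooth σG := by
  intro n
  convert hγ.isSubmanifold_composable_ge n n using 1
  ext g
  exact ⟨fun h k hk _ => h k hk, fun h k hk => h k hk (by omega)⟩

/-- A germ of maps into the nerve is smooth if its arrows are. -/
theorem near_nerve_iff (hγ : γ.IsLie σG σX) {n : ℕ} {c : P → γ.Nerve (n + 1)} :
    π.Near (γ.nerveSmooth σG σX (n + 1)) c p ↔ ∀ k, π.Near σG (fun p => (c p).1 k) p :=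
  ((hγ.nerveIsSmooth n).near_iff).trans near_pi_iff

/-- A germ of composable strings is a germ of points of the nerve. -/
theorem exists_nerve_lift (hγ : γ.IsLie σG σX) {n : ℕ} {c : Fin (n + 1) → P → G}
    (hc : ∀ k, π.Near σG (c k) p) (h : ∀ᶠ p' in π.nhds p, γ.Composable fun k => c k p') :
    ∃ d : P → γ.Nerve (n + 1), π.Near (γ.nerveSmooth σG σX (n + 1)) d p ∧
      ∀ᶠ p' in π.nhds p, ∀ k, (d p').1 k = c k p' := by
  obtain ⟨d, h1, h2⟩ := (hγ.nerveIsSmooth n).exists_lift (π := π) (p := p)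
    (c := fun p k => c k p) (near_pi_iff.2 hc) h
  exact ⟨d, h1, h2.mono fun p' hp' k => congrFun hp' k⟩

theorem near_apply (hγ : γ.IsLie σG σX) {n : ℕ} {c : P → γ.Nerve (n + 1)}
    (hc : π.Near (γ.nerveSmooth σG σX (n + 1)) c p) (k : Fin (n + 1)) :
    π.Near σG (fun p => (c p).1 k) p :=
  hγ.near_nerve_iff.1 hc k

theorem near_vertex (hγ : γ.IsLie σG σX) {n : ℕ} {c : P → γ.Nerve (n + 1)}
    (hc : π.Near (γ.nerveSmooth σG σX (n + 1)) c p) (i : ℕ) (hi : i ≤ n + 1) :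
    π.Near σX (fun p => γ.vertex (c p).1 i hi) p := by
  unfold vertex
  split_ifs
  · exact hγ.near_tgt (hγ.near_apply hc _)
  · exact hγ.near_src (hγ.near_apply hc _)

theorem smooth_face (hγ : γ.IsLie σG σX) (n i : ℕ) (hi : i ≤ n + 1) :
    (γ.nerveSmooth σG σX (n + 1)).Smooth (γ.nerveSmooth σG σX n) (γ.face n i hi) := by
  refine smooth_of_near fun x => ?_
  have hx := near_id (γ.nerveSmooth σG σX (n + 1)) x
  cases n with
  | zero =>
    cases i with
    | zero => exact hγ.near_src (hγ.near_apply hx 0)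
    | succ i => exact hγ.near_tgt (hγ.near_apply hx 0)
  | succ n =>
    refine hγ.near_nerve_iff.2 fun k => ?_
    simp only [face, faceFun]
    split_ifs
    · exact hγ.near_apply hx _
    · exact hγ.near_mul (hγ.near_apply hx _) (hγ.near_apply hx _) fun g => g.2 _ (by omega)
    · exact hγ.near_apply hx _

theorem smooth_degen (hγ : γ.IsLie σG σX) (n i : ℕ) (hi : i ≤ n) :
    (γ.nerveSmooth σG σX n).Smooth (γ.nerveSmooth σG σX (n + 1)) (γ.degen n i hi) := by
  refine smooth_of_near fun x => ?_
  have hx := near_id (γ.nerveSmooth σG σX n) x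
  cases n with
  | zero => exact hγ.near_nerve_iff.2 fun k => hγ.one_smooth.near_comp hx
  | succ n =>
    refine hγ.near_nerve_iff.2 fun k => ?_
    simp only [degen, degenFun]
    split_ifs
    · exact hγ.near_apply hx _
    · exact hγ.one_smooth.near_comp (hγ.near_vertex hx _ _)
    · exact hγ.near_apply hx _

theorem smooth_map {G' X' : Type u} {γ' : Gpd G' X'} {σG' : SmoothStructure G'}
    {σX' : SmoothStructure X'} (hγ : γ.IsLie σG σX) (hγ' : γ'.IsLie σG' σX') (φ : Hom γ γ')
    (harr : σG.Smooth σG' φ.arr) (hobj : σX.Smooth σX' φ.obj) (n : ℕ) :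
    (γ.nerveSmooth σG σX n).Smooth (γ'.nerveSmooth σG' σX' n) (φ.map n) := by
  cases n with
  | zero => exact hobj
  | succ n =>
    refine smooth_of_near fun x => hγ'.near_nerve_iff.2 fun k => ?_
    exact harr.near_comp (hγ.near_apply (near_id _ x) k)

/-- The face map of the nerve which forgets the last arrow is a submersion. -/
theorem submersion_face_last (hγ : γ.IsLie σG σX) (n : ℕ) :
    (γ.nerveSmooth σG σX (n + 1)).Submersion (γ.nerveSmooth σG σX n)
      (γ.face n (n + 1) le_rfl) := by
  refine submersion_of_sections (hγ.smooth_face _ _ _) fun x => ?_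
  cases n with
  | zero =>
    obtain ⟨s, h1, h2, h3⟩ := hγ.tgt_submersion.exists_section (x.1 0)
    refine ⟨fun y => ⟨fun _ => s y, composable_const _⟩, hγ.near_nerve_iff.2 fun _ => h1, ?_, h3⟩
    refine Subtype.ext (funext fun k => ?_)
    obtain rfl : k = 0 := Fin.ext (Nat.lt_one_iff.1 k.2)
    exact h2
  | succ n =>
    have hy := near_id (γ.nerveSmooth σG σX (n + 1)) (γ.face (n + 1) (n + 2) le_rfl x)
    -- the string is extended by an arrow `d y` whose target is the source of its last arrow
    obtain ⟨d, h1, h2, h3⟩ := hγ.tgt_submersion.exists_lift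
      (hγ.near_src (hγ.near_apply hy (Fin.last n))) (x.1 ⟨n + 1, by omega⟩)
      ((x.2 n (by omega)).symm.trans (congrArg γ.src (face_last_apply x n (by omega)).symm))
    obtain ⟨s, hs, hs'⟩ := hγ.exists_nerve_lift (n := n + 1) (π := γ.nerveSmooth σG σX (n + 1))
      (p := γ.face (n + 1) (n + 2) le_rfl x)
      (c := fun k y => snoc y.1 (d y) k)
      (fun ⟨k, hk⟩ => by
        rcases Nat.lt_or_ge k (n + 1) with h | h
        · exact (hγ.near_apply hy ⟨k, h⟩).congr (.of_forall fun y => snoc_of_lt y.1 (d y) k h)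
        · exact h1.congr (.of_forall fun y => snoc_last y.1 (d y) k (by omega)))
      (h3.mono fun y hy' => snoc_composable y.2 hy'.symm)
    refine ⟨s, hs, ?_, ?_⟩
    · refine Subtype.ext (funext fun ⟨k, hk⟩ => ?_)
      refine (eventually_self hs' ⟨k, hk⟩).trans ?_
      rcases Nat.lt_or_ge k (n + 1) with h | h
      · exact (snoc_of_lt _ _ k h).trans (face_last_apply x k h)
      · obtain rfl : k = n + 1 := by omega
        exact (snoc_last _ _ _ rfl).trans h2
    · refine hs'.mono fun y hy' => Subtype.ext (funext fun ⟨k, hk⟩ => ?_)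
      exact (face_last_apply _ k hk).trans ((hy' _).trans (snoc_of_lt _ _ k hk))

end IsLie

end Gpd

/-! ### The double nerve of a double Lie groupoid -/

namespace DoubleLieGroupoid

open SmoothStructure

variable {D H V M : Type u} (𝒟 : DoubleLieGroupoid D H V M)
  {P : Type u} {π : SmoothStructure P} {p : P}

section Corners

variable {θ : P → V} {η : P → H}

/-- A germ of pairs of sides with common source lifts to a germ of squares through a given square:
this is the submersion property of the double-source map. -/
theorem exists_square_srcV_srcH (hθ : π.Near 𝒟.σV θ p) (hη : π.Near 𝒟.σH η p)
    (h : ∀ᶠ p' in π.nhds p, 𝒟.VM.src (θ p') = 𝒟.HM.src (η p')) (α : D)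
    (h1 : 𝒟.DV.src α = θ p) (h2 : 𝒟.DH.src α = η p) :
    ∃ δ : P → D, π.Near 𝒟.σD δ p ∧ δ p = α ∧
      ∀ᶠ p' in π.nhds p, 𝒟.DV.src (δ p') = θ p' ∧ 𝒟.DH.src (δ p') = η p' := by
  have hsub : (𝒟.σV.prod 𝒟.σH).IsSubmanifold {p | 𝒟.VM.src p.1 = 𝒟.HM.src p.2} :=
    isSubmanifold_fiberProduct 𝒟.lieVM.src_submersion.smooth 𝒟.lieHM.src_submersion
  obtain ⟨c, hc, hc'⟩ := hsub.exists_lift (hθ.prodMk hη) h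
  have hcp := eventually_self hc'
  obtain ⟨δ, h3, h4, h5⟩ := 𝒟.doubleSource_submersion.exists_lift hc α
    (Subtype.ext (by rw [hcp, ← h1, ← h2]))
  refine ⟨δ, h3, h4, ?_⟩
  filter_upwards [hc', h5] with p' h6 h7
  have h8 := (congrArg Subtype.val h7).trans h6
  exact ⟨congrArg Prod.fst h8, congrArg Prod.snd h8⟩

/-- The same as `exists_square_srcV_srcH` at another corner, by inverting squares horizontally. -/
theorem exists_square_srcV_tgtH (hθ : π.Near 𝒟.σV θ p) (hη : π.Near 𝒟.σH η p)
    (h : ∀ᶠ p' in π.nhds p, 𝒟.VM.tgt (θ p') = 𝒟.HM.src (η p')) (α : D)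
    (h1 : 𝒟.DV.src α = θ p) (h2 : 𝒟.DH.tgt α = η p) :
    ∃ δ : P → D, π.Near 𝒟.σD δ p ∧ δ p = α ∧
      ∀ᶠ p' in π.nhds p, 𝒟.DV.src (δ p') = θ p' ∧ 𝒟.DH.tgt (δ p') = η p' := by
  obtain ⟨δ, h3, h4, h5⟩ := 𝒟.exists_square_srcV_srcH (𝒟.lieVM.near_inv hθ) hη
    (h.mono fun p' h => by rw [Gpd.src_inv, h]) (𝒟.DH.inv α)
    ((𝒟.srcV.map_inv α).trans (congrArg 𝒟.VM.inv h1)) (by rw [Gpd.src_inv, h2])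
  refine ⟨fun p => 𝒟.DH.inv (δ p), 𝒟.lieDH.near_inv h3, by simp only [h4, Gpd.inv_inv], ?_⟩
  refine h5.mono fun p' ⟨h6, h7⟩ => ⟨?_, by rw [Gpd.tgt_inv, h7]⟩
  exact (𝒟.srcV.map_inv _).trans ((congrArg 𝒟.VM.inv h6).trans (Gpd.inv_inv _))

/-- The same as `exists_square_srcV_srcH` at the opposite corner, by inverting squares in both
directions. -/
theorem exists_square_tgtV_tgtH (hθ : π.Near 𝒟.σV θ p) (hη : π.Near 𝒟.σH η p)
    (h : ∀ᶠ p' in π.nhds p, 𝒟.VM.tgt (θ p') = 𝒟.HM.tgt (η p')) (α : D)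
    (h1 : 𝒟.DV.tgt α = θ p) (h2 : 𝒟.DH.tgt α = η p) :
    ∃ δ : P → D, π.Near 𝒟.σD δ p ∧ δ p = α ∧
      ∀ᶠ p' in π.nhds p, 𝒟.DV.tgt (δ p') = θ p' ∧ 𝒟.DH.tgt (δ p') = η p' := by
  obtain ⟨δ, h3, h4, h5⟩ := 𝒟.exists_square_srcV_tgtH hθ (𝒟.lieHM.near_inv hη)
    (h.mono fun p' h => by rw [Gpd.src_inv, h]) (𝒟.DV.inv α) (by rw [Gpd.src_inv, h1])
    ((𝒟.tgtH.map_inv α).trans (congrArg 𝒟.HM.inv h2))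
  refine ⟨fun p => 𝒟.DV.inv (δ p), 𝒟.lieDV.near_inv h3, by simp only [h4, Gpd.inv_inv], ?_⟩
  refine h5.mono fun p' ⟨h6, h7⟩ => ⟨by rw [Gpd.tgt_inv, h6], ?_⟩
  exact (𝒟.tgtH.map_inv _).trans ((congrArg 𝒟.HM.inv h7).trans (Gpd.inv_inv _))

end Corners

variable {𝒟} in
/-- In a full double Lie groupoid squares with two prescribed adjacent sides exist at every corner.
-/
theorem IsFull.exists_srcV_tgtH (hf : 𝒟.IsFull) (θ : V) (η : H) (h : 𝒟.VM.tgt θ = 𝒟.HM.src η) :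
    ∃ α : D, 𝒟.DV.src α = θ ∧ 𝒟.DH.tgt α = η := by
  obtain ⟨α, h1, h2⟩ := hf (𝒟.VM.inv θ) η (by rw [Gpd.src_inv, h])
  exact ⟨𝒟.DH.inv α, (𝒟.srcV.map_inv _).trans ((congrArg 𝒟.VM.inv h1).trans (Gpd.inv_inv _)),
    by rw [Gpd.tgt_inv, h2]⟩

variable {𝒟} in
theorem IsFull.exists_tgtV_tgtH (hf : 𝒟.IsFull) (θ : V) (η : H) (h : 𝒟.VM.tgt θ = 𝒟.HM.tgt η) :
    ∃ α : D, 𝒟.DV.tgt α = θ ∧ 𝒟.DH.tgt α = η := by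
  obtain ⟨α, h1, h2⟩ := hf.exists_srcV_tgtH θ (𝒟.HM.inv η) (by rw [Gpd.src_inv, h])
  exact ⟨𝒟.DV.inv α, by rw [Gpd.tgt_inv, h1],
    (𝒟.tgtH.map_inv _).trans ((congrArg 𝒟.HM.inv h2).trans (Gpd.inv_inv _))⟩

/-- A germ of composable strings in `V` lifts along `s_V` to a germ of horizontally composable
strings in `D` with any prescribed value. The arrows of the string are lifted one after the other,
beginning with the first one. -/
theorem exists_string_lift (n : ℕ) {θ : Fin (n + 1) → P → V} (hθ : ∀ k, π.Near 𝒟.σV (θ k) p)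
    (h : ∀ᶠ p' in π.nhds p, 𝒟.VM.Composable fun k => θ k p') (α : Fin (n + 1) → D)
    (hα : 𝒟.DH.Composable α) (h1 : ∀ k, 𝒟.DV.src (α k) = θ k p) :
    ∃ d : Fin (n + 1) → P → D, (∀ k, π.Near 𝒟.σD (d k) p) ∧ (∀ k, d k p = α k) ∧
      ∀ᶠ p' in π.nhds p, 𝒟.DH.Composable (fun k => d k p') ∧
        ∀ k, 𝒟.DV.src (d k p') = θ k p' := by
  induction n with
  | zero =>
    obtain ⟨δ, h2, h3, h4⟩ := 𝒟.lieDV.src_submersion.exists_lift (hθ 0) (α 0) (h1 0)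
    refine ⟨fun _ => δ, fun _ => h2, fun k => ?_, h4.mono fun p' h5 =>
      ⟨Gpd.composable_const _, fun k => ?_⟩⟩ <;>
    · obtain rfl : k = 0 := Fin.ext (Nat.lt_one_iff.1 k.2)
      assumption
  | succ n ih =>
    obtain ⟨d, h2, h3, h4⟩ := ih (θ := fun k => θ k.castSucc) (fun k => hθ _)
      (h.mono fun p' h k hk => h k (by omega)) (fun k => α k.castSucc)
      (fun k hk => hα k (by omega)) (fun k => h1 _)
    obtain ⟨δ, h5, h6, h7⟩ := 𝒟.exists_square_srcV_tgtH (hθ (Fin.last (n + 1)))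
      (𝒟.lieDH.near_src (h2 (Fin.last n))) (by
        filter_upwards [h, h4] with p' h8 h9
        rw [𝒟.src_src, h9.2]
        exact (h8 n (by omega)).symm) (α (Fin.last (n + 1))) (h1 _) (by
        rw [h3]; exact (hα n (by omega)).symm)
    refine ⟨fun k p => Gpd.snoc (fun j => d j p) (δ p) k, ?_, ?_, ?_⟩
    · rintro ⟨k, hk⟩
      rcases Nat.lt_or_ge k (n + 1) with h' | h'
      · exact (h2 ⟨k, h'⟩).congr (.of_forall fun y => Gpd.snoc_of_lt _ _ k h')
      · exact h5.congr (.of_forall fun y => Gpd.snoc_last _ _ k (by omega))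
    · rintro ⟨k, hk⟩
      rcases Nat.lt_or_ge k (n + 1) with h' | h'
      · exact (Gpd.snoc_of_lt _ _ k h').trans (h3 _)
      · obtain rfl : k = n + 1 := by omega
        exact (Gpd.snoc_last _ _ _ rfl).trans h6
    · filter_upwards [h4, h7] with p' h8 h9
      refine ⟨Gpd.snoc_composable h8.1 h9.2.symm, fun ⟨k, hk⟩ => ?_⟩
      rcases Nat.lt_or_ge k (n + 1) with h' | h'
      · exact (congrArg 𝒟.DV.src (Gpd.snoc_of_lt _ _ k h')).trans (h8.2 _)
      · obtain rfl : k = n + 1 := by omega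
        exact (congrArg 𝒟.DV.src (Gpd.snoc_last _ _ _ rfl)).trans h9.1

theorem smooth_srcV (q : ℕ) : (𝒟.DH.nerveSmooth 𝒟.σD 𝒟.σH q).Smooth
    (𝒟.VM.nerveSmooth 𝒟.σV 𝒟.σM q) (𝒟.srcV.map q) :=
  𝒟.lieDH.smooth_map 𝒟.lieVM 𝒟.srcV 𝒟.lieDV.src_submersion.smooth
    𝒟.lieHM.src_submersion.smooth q

/-- The source map of the groupoid of horizontally composable strings is a submersion. -/
theorem submersion_srcV (q : ℕ) : (𝒟.DH.nerveSmooth 𝒟.σD 𝒟.σH q).Submersion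
    (𝒟.VM.nerveSmooth 𝒟.σV 𝒟.σM q) (𝒟.srcV.map q) := by
  cases q with
  | zero => exact 𝒟.lieHM.src_submersion
  | succ q =>
    refine submersion_of_sections (𝒟.smooth_srcV (q + 1)) fun x => ?_
    have hy := near_id (𝒟.VM.nerveSmooth 𝒟.σV 𝒟.σM (q + 1)) (𝒟.srcV.map (q + 1) x)
    obtain ⟨d, h1, h2, h3⟩ := 𝒟.exists_string_lift q (𝒟.lieVM.near_apply hy)
      (.of_forall fun y => y.2) x.1 x.2 (fun k => rfl)
    obtain ⟨s, h4, h5⟩ := 𝒟.lieDH.exists_nerve_lift h1 (h3.mono fun y h => h.1)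
    refine ⟨s, h4, Subtype.ext (funext fun k => (eventually_self h5 k).trans (h2 k)), ?_⟩
    filter_upwards [h3, h5] with y h6 h7
    exact Subtype.ext (funext fun k => (congrArg 𝒟.DV.src (h7 k)).trans (h6.2 k))

/-- The horizontally composable `q`-strings in `D` form a Lie groupoid over the composable
`q`-strings in `V`. -/
theorem level_isLie (q : ℕ) : (𝒟.level q).IsLie (𝒟.DH.nerveSmooth 𝒟.σD 𝒟.σH q)
    (𝒟.VM.nerveSmooth 𝒟.σV 𝒟.σM q) := by
  have hs := 𝒟.submersion_srcV q
  have hi : (𝒟.DH.nerveSmooth 𝒟.σD 𝒟.σH q).Smooth (𝒟.DH.nerveSmooth 𝒟.σD 𝒟.σH q)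
      (𝒟.level q).inv :=
    𝒟.lieDH.smooth_map 𝒟.lieDH 𝒟.invV 𝒟.lieDV.inv_smooth 𝒟.lieHM.inv_smooth q
  have ht : (𝒟.DH.nerveSmooth 𝒟.σD 𝒟.σH q).Submersion (𝒟.VM.nerveSmooth 𝒟.σV 𝒟.σM q)
      (𝒟.level q).tgt := Gpd.tgt_submersion_of_src hs hi
  refine ⟨hs, ht, ?_, 𝒟.lieVM.smooth_map 𝒟.lieDH 𝒟.oneV 𝒟.lieDV.one_smooth 𝒟.lieHM.one_smooth q,
    hi⟩
  cases q with
  | zero => exact 𝒟.lieHM.mul_smooth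
  | succ q =>
    have hsub := Gpd.isSubmanifold_composablePairs (γ := 𝒟.level (q + 1)) hs.smooth ht
    refine smooth_of_near fun x => 𝒟.lieDH.near_nerve_iff.2 fun k => ?_
    have hx := hsub.smooth_val.near x
    exact 𝒟.lieDV.near_mul (𝒟.lieDH.near_apply ((smooth_fst _ _).near_comp hx) k)
      (𝒟.lieDH.near_apply ((smooth_snd _ _).near_comp hx) k)
      fun y => congrFun (congrArg Subtype.val y.2) k

theorem nerveIsSmooth : 𝒟.NerveIsSmooth :=
  ⟨𝒟.lieVM.nerveIsSmooth, 𝒟.lieDH.nerveIsSmooth, fun q => (𝒟.level_isLie q).nerveIsSmooth⟩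

theorem smooth_horiz_face (p q i : ℕ) (hi : i ≤ p + 1) :
    (𝒟.nerveSmooth (p + 1) q).Smooth (𝒟.nerveSmooth p q) ((𝒟.nerve.horiz q).face p i hi) :=
  (𝒟.level_isLie q).smooth_face p i hi

theorem smooth_horiz_degen (p q i : ℕ) (hi : i ≤ p) :
    (𝒟.nerveSmooth p q).Smooth (𝒟.nerveSmooth (p + 1) q) ((𝒟.nerve.horiz q).degen p i hi) :=
  (𝒟.level_isLie q).smooth_degen p i hi

theorem smooth_vert_face (p q i : ℕ) (hi : i ≤ q + 1) :
    (𝒟.nerveSmooth p (q + 1)).Smooth (𝒟.nerveSmooth p q) ((𝒟.nerve.vert p).face q i hi) :=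
  (𝒟.level_isLie (q + 1)).smooth_map (𝒟.level_isLie q) (𝒟.faceHom q i hi)
    (𝒟.lieDH.smooth_face q i hi) (𝒟.lieVM.smooth_face q i hi) p

theorem smooth_vert_degen (p q i : ℕ) (hi : i ≤ q) :
    (𝒟.nerveSmooth p q).Smooth (𝒟.nerveSmooth p (q + 1)) ((𝒟.nerve.vert p).degen q i hi) :=
  (𝒟.level_isLie q).smooth_map (𝒟.level_isLie (q + 1)) (𝒟.degenHom q i hi)
    (𝒟.lieDH.smooth_degen q i hi) (𝒟.lieVM.smooth_degen q i hi) p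

/-- The horizontal face map which forgets the last row of an array is a submersion. -/
theorem submersion_horiz_face_last (p q : ℕ) : (𝒟.nerveSmooth (p + 1) q).Submersion
    (𝒟.nerveSmooth p q) ((𝒟.nerve.horiz q).face p (p + 1) le_rfl) :=
  (𝒟.level_isLie q).submersion_face_last p

end DoubleLieGroupoid

/-! ### The bar construction as a family of manifolds -/

namespace BisimplicialStructure

open SmoothStructure

variable {obj : ℕ → ℕ → Type u} (X : BisimplicialStructure obj)
  (σ : ∀ p q, SmoothStructure (obj p q))

/-- The structure maps of a bisimplicial set are smooth, and the last horizontal face maps are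
submersions. This is what the smoothness of the bar construction depends on. -/
structure IsSmooth : Prop where
  horiz_face : ∀ p q i hi, (σ (p + 1) q).Smooth (σ p q) ((X.horiz q).face p i hi)
  horiz_degen : ∀ p q i hi, (σ p q).Smooth (σ (p + 1) q) ((X.horiz q).degen p i hi)
  vert_face : ∀ p q i hi, (σ p (q + 1)).Smooth (σ p q) ((X.vert p).face q i hi)
  vert_degen : ∀ p q i hi, (σ p q).Smooth (σ p (q + 1)) ((X.vert p).degen q i hi)
  horiz_face_last : ∀ p q, (σ (p + 1) q).Submersion (σ p q) ((X.horiz q).face p (p + 1) le_rfl)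

variable {X σ} {P : Type u} {π : SmoothStructure P} {t : P}

/-- A germ of families is smooth if its entries are. -/
theorem near_family_iff {r : ℕ} {c : P → Family obj r} : π.Near (familySmooth σ r) c t ↔
    ∀ p q h, π.Near (σ p q) (fun t => (c t).entry p q h) t :=
  near_pi_iff.trans ⟨fun h p q e => h ⟨(p, q), Finset.HasAntidiagonal.mem_antidiagonal.2 e⟩,
    fun h ⟨(p, q), e⟩ => h p q (Finset.HasAntidiagonal.mem_antidiagonal.1 e)⟩

/-- The family `x` with its entry in position `(p, q)` replaced by `a`. -/
def Family.set {r : ℕ} (x : Family obj r) (p q : ℕ) (h : p + q = r) (a : obj p q) : Family obj r :=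
  Function.update x ⟨(p, q), Finset.HasAntidiagonal.mem_antidiagonal.2 h⟩ a

theorem Family.entry_set_self {r : ℕ} (x : Family obj r) (p q : ℕ) (h : p + q = r) (a : obj p q) :
    (x.set p q h a).entry p q h = a :=
  Function.update_self (β := fun a : Index r => obj a.1.1 a.1.2) _ _ _

theorem Family.entry_set_of_ne {r : ℕ} (x : Family obj r) (p q : ℕ) (h : p + q = r) (a : obj p q)
    (p' q' : ℕ) (h' : p' + q' = r) (hp : p' ≠ p) :
    (x.set p q h a).entry p' q' h' = x.entry p' q' h' :=
  Function.update_of_ne (fun e => hp (congrArg (fun a : Index r => a.1.1) e)) _ _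

theorem Family.set_entry {r : ℕ} (x : Family obj r) (p q : ℕ) (h : p + q = r) :
    x.set p q h (x.entry p q h) = x :=
  Function.update_eq_self _ _

theorem near_set {r : ℕ} (x : Family obj r) (p q : ℕ) (h : p + q = r) {s : P → obj p q}
    (hs : π.Near (σ p q) s t) : π.Near (familySmooth σ r) (fun t => x.set p q h (s t)) t :=
  near_update (ι := Index r) (α := fun a => σ a.1.1 a.1.2) x hs

namespace IsSmooth

/-- The equations `v_0 (x_p) = h_{p+1} (x_{p+1})` are imposed one at a time, in increasing order of
`p`: the entry `x_{p+1}` can be varied as long as only the earlier equations are imposed. -/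
theorem isSubmanifold_barSet_lt (hX : X.IsSmooth σ) (r j : ℕ) : (familySmooth σ r).IsSubmanifold
    {x | ∀ (p q : ℕ) (h : p + (q + 1) = r), p < j →
      (X.vert p).face q 0 (by omega) (x.entry p (q + 1) h) =
        (X.horiz q).face p (p + 1) le_rfl (x.entry (p + 1) q (by omega))} := by
  induction j with
  | zero =>
    convert isSubmanifold_univ _ using 1
    exact eq_univ_of_forall fun g p q h hp => by omega
  | succ j ih =>
    rcases Nat.lt_or_ge j r with hj | hj
    swap
    · convert ih using 1
      ext x
      exact ⟨fun hx p q h hp => hx p q h (by omega), fun hx p q h hp => hx p q h (by omega)⟩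
    obtain ⟨q, hq⟩ : ∃ q, r = j + (q + 1) := ⟨r - (j + 1), by omega⟩
    subst hq
    have hval := ih.smooth_val
    have hentry : ∀ p q h, ((familySmooth σ _).sub _).Smooth (σ p q) fun x => x.1.entry p q h :=
      fun p q h => smooth_of_near fun x => near_family_iff.1 (hval.near x) p q h
    have := ih.equalizer (τ := σ j q)
      (f := fun x => (X.horiz q).face j (j + 1) le_rfl (x.1.entry (j + 1) q (by omega)))
      (g := fun x => (X.vert j).face q 0 (by omega) (x.1.entry j (q + 1) rfl))
      ((hX.horiz_face _ _ _ _).comp (hentry _ _ (by omega)))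
      ((hX.vert_face _ _ _ _).comp (hentry _ _ rfl))
      fun x hx => by
        obtain ⟨s, h1, h2, h3⟩ := (hX.horiz_face_last j q).exists_section
          (x.1.entry (j + 1) q (by omega))
        refine ⟨fun z => ⟨x.1.set (j + 1) q (by omega) (s z), fun p q' h hp => ?_⟩,
          ih.near_iff.2 (near_set _ (j + 1) q (by omega) h1), Subtype.ext ?_,
          h3.mono fun z hz => ⟨?_, ?_⟩⟩
        · rw [Family.entry_set_of_ne _ _ _ _ _ _ _ _ (by omega),
            Family.entry_set_of_ne _ _ _ _ _ _ _ _ (by omega)]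
          exact x.2 p q' h hp
        · simp only [h2]
          exact Family.set_entry _ _ _ _
        · simp only [Family.entry_set_self, hz]
        · simp only
          rw [Family.entry_set_of_ne _ _ _ _ _ _ _ _ (by omega)]
    convert this using 1
    ext x
    refine ⟨fun hx => ⟨fun p q h hp => hx p q h (by omega), (hx _ _ rfl (by omega)).symm⟩,
      fun ⟨h1, h2⟩ p q' h hp => ?_⟩
    rcases (Nat.le_of_lt_succ hp).eq_or_lt with rfl | h'
    · obtain rfl : q = q' := by omega
      exact h2.symm
    · exact h1 p q' h h'

theorem barIsSmooth (hX : X.IsSmooth σ) : X.BarIsSmooth σ := by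
  intro r
  convert hX.isSubmanifold_barSet_lt r r using 1
  ext x
  exact ⟨fun h p q e _ => h p q e, fun h p q e => h p q e (by omega)⟩

/-- A germ of maps into the bar construction is smooth if its entries are. -/
theorem near_bar_iff (hX : X.IsSmooth σ) {r : ℕ} {c : P → X.Bar r} :
    π.Near (X.barSmooth σ r) c t ↔ ∀ p q h, π.Near (σ p q) (fun t => (c t).1.entry p q h) t :=
  ((hX.barIsSmooth r).near_iff).trans near_family_iff

theorem smooth_barFace (hX : X.IsSmooth σ) (r i : ℕ) (hi : i ≤ r + 1) :
    (X.barSmooth σ (r + 1)).Smooth (X.barSmooth σ r) (X.bar.face r i hi) := by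
  refine smooth_of_near fun x => hX.near_bar_iff.2 fun p q h => ?_
  have hx := hX.near_bar_iff.1 (near_id (X.barSmooth σ (r + 1)) x)
  rcases Nat.lt_or_ge p i with h' | h'
  · exact ((hX.vert_face p q (i - p) (by omega)).near_comp (hx p (q + 1) (by omega))).congr
      (.of_forall fun y => entry_barFace_of_lt hi y.1 h h')
  · exact ((hX.horiz_face p q i (by omega)).near_comp (hx (p + 1) q (by omega))).congr
      (.of_forall fun y => entry_barFace_of_ge hi y.1 h h')

theorem smooth_barDegen (hX : X.IsSmooth σ) (r i : ℕ) (hi : i ≤ r) :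
    (X.barSmooth σ r).Smooth (X.barSmooth σ (r + 1)) (X.bar.degen r i hi) := by
  refine smooth_of_near fun x => hX.near_bar_iff.2 fun p q h => ?_
  have hx := hX.near_bar_iff.1 (near_id (X.barSmooth σ r) x)
  rcases Nat.lt_or_ge i p with h' | h'
  · obtain ⟨p, rfl⟩ : ∃ l, p = l + 1 := ⟨p - 1, by omega⟩
    exact ((hX.horiz_degen p q i (by omega)).near_comp (hx p q (by omega))).congr
      (.of_forall fun y => entry_barDegen_of_gt hi y.1 h (by omega))
  · obtain ⟨q, rfl⟩ : ∃ l, q = l + 1 := ⟨q - 1, by omega⟩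
    exact ((hX.vert_degen p q (i - p) (by omega)).near_comp (hx p q (by omega))).congr
      (.of_forall fun y => entry_barDegen_of_le hi y.1 h h')

theorem embedding_barDegen (hX : X.IsSmooth σ) (r i : ℕ) (hi : i ≤ r) :
    (X.barSmooth σ r).Embedding (X.barSmooth σ (r + 1)) (X.bar.degen r i hi) :=
  embedding_of_leftInverse (hX.smooth_barDegen r i hi) (hX.smooth_barFace r i (by omega))
    (X.bar.face_degen_self r i hi)

end IsSmooth

end BisimplicialStructure

theorem SimplicialStructure.face_surjective {obj : ℕ → Type u} (S : SimplicialStructure obj)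
    (n i : ℕ) (hi : i ≤ n + 1) : Function.Surjective (S.face n i hi) := by
  intro x
  rcases Nat.lt_or_ge n i with h | h
  · obtain rfl : i = n + 1 := by omega
    exact ⟨S.degen n n le_rfl x, S.face_degen_succ n n le_rfl x⟩
  · exact ⟨S.degen n i h x, S.face_degen_self n i h x⟩

theorem DoubleLieGroupoid.nerve_isSmooth {D H V M : Type u} (𝒟 : DoubleLieGroupoid D H V M) :
    𝒟.nerve.IsSmooth 𝒟.nerveSmooth :=
  ⟨𝒟.smooth_horiz_face, 𝒟.smooth_horiz_degen, 𝒟.smooth_vert_face, 𝒟.smooth_vert_degen,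
    𝒟.submersion_horiz_face_last⟩

/-! ### First and last arrows of strings -/

namespace Gpd

variable {G X : Type u} {γ : Gpd G X}

/-- The first arrow of a string. -/
def first {n : ℕ} (a : γ.Nerve (n + 1)) : G := a.1 0

/-- The last arrow of a string. -/
def last {n : ℕ} (a : γ.Nerve (n + 1)) : G := a.1 (Fin.last n)

/-- The object at which a string begins, that is, the target of its first arrow. -/
def head : {n : ℕ} → γ.Nerve n → X
  | 0, x => x
  | _ + 1, a => γ.tgt (first a)

/-- The object at which a string ends, that is, the source of its last arrow. -/
def tail : {n : ℕ} → γ.Nerve n → X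
  | 0, x => x
  | _ + 1, a => γ.src (last a)

theorem nerve_ext {n : ℕ} {a b : γ.Nerve (n + 1)}
    (h : ∀ k (hk : k < n + 1), a.1 ⟨k, hk⟩ = b.1 ⟨k, hk⟩) : a = b :=
  Subtype.ext (funext fun ⟨k, hk⟩ => h k hk)

theorem ext_first {n : ℕ} {a b : γ.Nerve (n + 1)} (h : first a = first b)
    (h' : γ.face n 0 (Nat.zero_le _) a = γ.face n 0 (Nat.zero_le _) b) : a = b := by
  refine nerve_ext fun k hk => ?_
  cases k with
  | zero => exact h
  | succ k =>
    obtain ⟨n, rfl⟩ : ∃ l, n = l + 1 := ⟨n - 1, by omega⟩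
    rw [← face_zero_apply a k (by omega), ← face_zero_apply b k (by omega), h']

theorem ext_last {n : ℕ} {a b : γ.Nerve (n + 1)} (h : last a = last b)
    (h' : γ.face n (n + 1) le_rfl a = γ.face n (n + 1) le_rfl b) : a = b := by
  refine nerve_ext fun k hk => ?_
  rcases Nat.lt_or_ge k n with hk' | hk'
  · obtain ⟨n, rfl⟩ : ∃ l, n = l + 1 := ⟨n - 1, by omega⟩
    rw [← face_last_apply a k (by omega), ← face_last_apply b k (by omega), h']
  · obtain rfl : k = n := by omega
    exact h

theorem last_face_of_lt {n : ℕ} (a : γ.Nerve (n + 2)) (i : ℕ) (hi : i < n + 1) :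
    last (γ.face (n + 1) i (by omega) a) = last a := by
  show γ.faceFun i a.1 a.2 ⟨n, _⟩ = _
  simp only [faceFun, if_neg (show ¬ n + 1 < i by omega), if_neg (show ¬ n + 1 = i by omega)]
  rfl

theorem last_face_self {n : ℕ} (a : γ.Nerve (n + 2)) :
    last (γ.face (n + 1) (n + 1) (by omega) a) =
      γ.pmul (last (γ.face (n + 1) (n + 2) le_rfl a)) (last a) := by
  have h : last (γ.face (n + 1) (n + 2) le_rfl a) = a.1 ⟨n, by omega⟩ :=
    face_last_apply a n (by omega)
  have h' : γ.src (last (γ.face (n + 1) (n + 2) le_rfl a)) = γ.tgt (last a) := by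
    rw [h]; exact a.2 n (by omega)
  rw [pmul_eq h']
  refine Eq.trans ?_ (γ.mul_congr h rfl h').symm
  show γ.faceFun (n + 1) a.1 a.2 ⟨n, _⟩ = _
  simp only [faceFun, if_neg (show ¬ n + 1 < n + 1 by omega)]
  rfl

theorem first_face_of_lt {n : ℕ} (a : γ.Nerve (n + 2)) (i : ℕ) (hi : i ≤ n + 2) (h : 1 < i) :
    first (γ.face (n + 1) i hi a) = first a :=
  if_pos (show 0 + 1 < i by omega)

theorem first_face_one {n : ℕ} (a : γ.Nerve (n + 2)) :
    first (γ.face (n + 1) 1 (by omega) a) =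
      γ.pmul (first a) (first (γ.face (n + 1) 0 (by omega) a)) := by
  have h : first (γ.face (n + 1) 0 (by omega) a) = a.1 ⟨1, by omega⟩ :=
    face_zero_apply a 0 (by omega)
  have h' : γ.src (first a) = γ.tgt (first (γ.face (n + 1) 0 (by omega) a)) := by
    rw [h]; exact a.2 0 (by omega)
  rw [pmul_eq h']
  exact (γ.mul_congr rfl h h').symm

theorem src_first {n : ℕ} (a : γ.Nerve (n + 1)) :
    γ.src (first a) = head (γ.face n 0 (Nat.zero_le _) a) := by
  cases n with
  | zero => rfl
  | succ n => exact (a.2 0 (by omega)).trans (congrArg γ.tgt (face_zero_apply a 0 _).symm)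

theorem tgt_last {n : ℕ} (a : γ.Nerve (n + 1)) :
    γ.tgt (last a) = tail (γ.face n (n + 1) le_rfl a) := by
  cases n with
  | zero => rfl
  | succ n => exact (a.2 n (by omega)).symm.trans (congrArg γ.src (face_last_apply a n _).symm)

/-- A string of arrows can be extended by an arrow in front. -/
theorem exists_cons {n : ℕ} (g : G) (a : γ.Nerve n) (h : γ.src g = head a) :
    ∃ b : γ.Nerve (n + 1), first b = g ∧ γ.face n 0 (Nat.zero_le _) b = a := by
  cases n with
  | zero => exact ⟨⟨fun _ => g, composable_const g⟩, rfl, h⟩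
  | succ n =>
    have hc : γ.Composable (Fin.cons g a.1 : Fin (n + 2) → G) := fun k hk => by
      cases k with
      | zero => exact h
      | succ k => exact a.2 k (by omega)
    exact ⟨⟨_, hc⟩, rfl, nerve_ext fun k hk => face_zero_apply ⟨_, hc⟩ k hk⟩

/-- A string of arrows can be extended by an arrow at the end. -/
theorem exists_snoc {n : ℕ} (a : γ.Nerve n) (g : G) (h : tail a = γ.tgt g) :
    ∃ b : γ.Nerve (n + 1), last b = g ∧ γ.face n (n + 1) le_rfl b = a := by
  cases n with
  | zero => exact ⟨⟨fun _ => g, composable_const g⟩, rfl, h.symm⟩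
  | succ n =>
    refine ⟨⟨_, snoc_composable a.2 h⟩, snoc_last a.1 g (n + 1) rfl, nerve_ext fun k hk => ?_⟩
    exact (face_last_apply _ k hk).trans (snoc_of_lt _ _ k hk)

/-- The string obtained from the string `R` of length `n = p + q` by dropping its first `p` arrows.
-/
def drop {n : ℕ} (R : γ.Nerve n) : (p q : ℕ) → p + q = n → γ.Nerve q
  | 0, q, h => cast (congrArg γ.Nerve ((Nat.zero_add q).symm.trans h).symm) R
  | p + 1, q, h => γ.face q 0 (Nat.zero_le _) (drop R p (q + 1) (by omega))

end Gpd

namespace Gpd.IsLie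

open SmoothStructure

variable {G X : Type u} {γ : Gpd G X} {σG : SmoothStructure G} {σX : SmoothStructure X}
  {P : Type u} {π : SmoothStructure P} {p : P}

theorem near_of_first (hγ : γ.IsLie σG σX) {n : ℕ} {c : P → γ.Nerve (n + 1)}
    (h : π.Near σG (fun p => first (c p)) p)
    (h' : π.Near (γ.nerveSmooth σG σX n) (fun p => γ.face n 0 (Nat.zero_le _) (c p)) p) :
    π.Near (γ.nerveSmooth σG σX (n + 1)) c p := by
  refine hγ.near_nerve_iff.2 fun ⟨k, hk⟩ => ?_
  cases k with
  | zero => exact h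
  | succ k =>
    obtain ⟨n, rfl⟩ : ∃ l, n = l + 1 := ⟨n - 1, by omega⟩
    exact (hγ.near_apply h' ⟨k, by omega⟩).congr
      (.of_forall fun p => (face_zero_apply (c p) k (by omega)).symm)

theorem near_of_last (hγ : γ.IsLie σG σX) {n : ℕ} {c : P → γ.Nerve (n + 1)}
    (h : π.Near σG (fun p => last (c p)) p)
    (h' : π.Near (γ.nerveSmooth σG σX n) (fun p => γ.face n (n + 1) le_rfl (c p)) p) :
    π.Near (γ.nerveSmooth σG σX (n + 1)) c p := by
  refine hγ.near_nerve_iff.2 fun ⟨k, hk⟩ => ?_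
  rcases Nat.lt_or_ge k n with hk' | hk'
  · obtain ⟨n, rfl⟩ : ∃ l, n = l + 1 := ⟨n - 1, by omega⟩
    exact (hγ.near_apply h' ⟨k, by omega⟩).congr
      (.of_forall fun p => (face_last_apply (c p) k (by omega)).symm)
  · obtain rfl : k = n := by omega
    exact h

end Gpd.IsLie

/-! ### The corner square of a simplex of the bar construction -/

namespace DoubleGpd

open Gpd

variable {D H V M : Type u} {𝒟 : DoubleGpd D H V M} {r s p q : ℕ}

/-- The entry of a simplex of the bar construction in position `(p, q)`, as a string of `q`-strings
in `D`. -/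
def ent (x : 𝒟.nerve.Bar r) (p q : ℕ) (h : p + q = r) : (𝒟.level q).Nerve p := x.1.entry p q h

/-- The first row of the array in position `(p + 1, q)`. -/
def row (x : 𝒟.nerve.Bar r) (p q : ℕ) (h : p + 1 + q = r) : 𝒟.DH.Nerve q :=
  first (ent x (p + 1) q h)

/-- The string in `V` which is the entry in position `(0, r)`. -/
def str (x : 𝒟.nerve.Bar r) : 𝒟.VM.Nerve r := ent x 0 r (Nat.zero_add r)

/-- The last arrow in `V` of a simplex. -/
def th (x : 𝒟.nerve.Bar (s + 1)) : V := last (str x)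

/-- The first arrow in `H` of a simplex. -/
def et (x : 𝒟.nerve.Bar (s + 1)) : H := row x s 0 rfl

/-- The corner square of a simplex: the last square in the single row of the array in
position `(1, s + 1)`. -/
def sq (x : 𝒟.nerve.Bar (s + 2)) : D := last (row x 0 (s + 1) (by omega))

/-- The vertex of a `0`-simplex. -/
def pt (x : 𝒟.nerve.Bar 0) : M := str x

theorem bar_ext {x y : 𝒟.nerve.Bar r} (h : ∀ p q e, ent x p q e = ent y p q e) : x = y :=
  Subtype.ext (BisimplicialStructure.Family.ext h)

theorem ent_face_of_lt (x : 𝒟.nerve.Bar (r + 1)) (i : ℕ) (hi : i ≤ r + 1) (e : p + q = r)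
    (h : p < i) : ent (𝒟.nerve.bar.face r i hi x) p q e =
      (𝒟.faceHom q (i - p) (by omega)).map p (ent x p (q + 1) (by omega)) :=
  BisimplicialStructure.entry_barFace_of_lt hi x.1 e h

theorem ent_face_of_ge (x : 𝒟.nerve.Bar (r + 1)) (i : ℕ) (hi : i ≤ r + 1) (e : p + q = r)
    (h : i ≤ p) : ent (𝒟.nerve.bar.face r i hi x) p q e =
      (𝒟.level q).face p i (by omega) (ent x (p + 1) q (by omega)) :=
  BisimplicialStructure.entry_barFace_of_ge hi x.1 e h

theorem map_ent (x : 𝒟.nerve.Bar r) (h : p + (q + 1) = r) :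
    (𝒟.faceHom q 0 (Nat.zero_le _)).map p (ent x p (q + 1) h) =
      (𝒟.level q).face p (p + 1) le_rfl (ent x (p + 1) q (by omega)) :=
  x.2 p q h

/-- The rows of the arrays in a simplex arise from one another by dropping the first square. -/
theorem row_succ (x : 𝒟.nerve.Bar r) (h : p + 1 + 1 + q = r) :
    row x (p + 1) q h = 𝒟.DH.face q 0 (Nat.zero_le _) (row x p (q + 1) (by omega)) :=
  ((congrArg first (map_ent x (p := p + 1) (q := q) (by omega))).trans
    (first_face_of_lt _ _ _ (by omega))).symm

theorem face_str (x : 𝒟.nerve.Bar (q + 1)) :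
    𝒟.VM.face q 0 (Nat.zero_le _) (str x) = 𝒟.tgtV.map q (row x 0 q (by omega)) :=
  map_ent x (p := 0) (q := q) (by omega)

theorem row_face_of_lt (x : 𝒟.nerve.Bar (r + 1)) (i : ℕ) (hi : i ≤ r + 1) (e : p + 1 + q = r)
    (h : p + 1 < i) : row (𝒟.nerve.bar.face r i hi x) p q e =
      𝒟.DH.face q (i - (p + 1)) (by omega) (row x p (q + 1) (by omega)) :=
  congrArg first (ent_face_of_lt x i hi e h)

theorem row_face_of_ge (x : 𝒟.nerve.Bar (r + 1)) (i : ℕ) (hi : i ≤ r + 1) (e : p + 1 + q = r)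
    (h1 : 1 < i) (h : i ≤ p + 1) : row (𝒟.nerve.bar.face r i hi x) p q e =
      row x (p + 1) q (by omega) :=
  (congrArg first (ent_face_of_ge x i hi e h)).trans (first_face_of_lt _ _ _ h1)

theorem row_face_one (x : 𝒟.nerve.Bar (r + 1)) (e : p + 1 + q = r) :
    row (𝒟.nerve.bar.face r 1 (by omega) x) p q e =
      (𝒟.level q).pmul (row x (p + 1) q (by omega))
        (row (𝒟.nerve.bar.face r 0 (by omega) x) p q e) := by
  have h := congrArg first (ent_face_of_ge x 1 (by omega) e (by omega))
  rw [first_face_one] at h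
  rw [row, h, row, row, ent_face_of_ge x 0 (by omega) e (by omega)]

theorem str_face (x : 𝒟.nerve.Bar (r + 1)) (i : ℕ) (hi : i ≤ r + 1) (h : 0 < i) :
    str (𝒟.nerve.bar.face r i hi x) = 𝒟.VM.face r i hi (str x) :=
  ent_face_of_lt x i hi (p := 0) (Nat.zero_add r) h

theorem str_face_zero (x : 𝒟.nerve.Bar (r + 1)) :
    str (𝒟.nerve.bar.face r 0 (Nat.zero_le _) x) = 𝒟.srcV.map r (row x 0 r (by omega)) :=
  ent_face_of_ge x 0 (Nat.zero_le _) (p := 0) (Nat.zero_add r) le_rfl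

theorem src_row_succ (x : 𝒟.nerve.Bar (r + 1)) (e : p + 1 + q = r) :
    𝒟.srcV.map q (row x (p + 1) q (by omega)) =
      𝒟.tgtV.map q (row (𝒟.nerve.bar.face r 0 (Nat.zero_le _) x) p q e) := by
  rw [row, row, ent_face_of_ge x 0 (Nat.zero_le _) e (Nat.zero_le _)]
  exact src_first (γ := 𝒟.level q) _

/-- All rows of positive length in a simplex end with the corner square. -/
theorem last_row (x : 𝒟.nerve.Bar (s + 2)) (h : p + 1 + (q + 1) = s + 2) :
    last (row x p (q + 1) h) = sq x := by
  induction p generalizing q with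
  | zero =>
    obtain rfl : q = s := by omega
    rfl
  | succ p ih =>
    rw [row_succ, last_face_of_lt _ _ (by omega), ih]

theorem last_levelMul {n : ℕ} {a b : 𝒟.DH.Nerve (n + 1)}
    (h : (𝒟.level (n + 1)).src a = (𝒟.level (n + 1)).tgt b) :
    last ((𝒟.level (n + 1)).pmul a b) = 𝒟.DV.pmul (last a) (last b) := by
  rw [pmul_eq h]
  exact (pmul_eq (γ := 𝒟.DV) (g := last a) (h := last b)
    (congrFun (congrArg Subtype.val h) (Fin.last n))).symm

/-- The four sides of the corner square of `x` are `th (f_0 x)`, `th x`, `et x` and `et (f_r x)`;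
see also `tgtV_sq`, `srcH_sq` and `tgtH_sq`. -/
theorem srcV_sq (x : 𝒟.nerve.Bar (s + 2)) :
    𝒟.DV.src (sq x) = th (𝒟.nerve.bar.face (s + 1) 0 (Nat.zero_le _) x) :=
  (congrArg last (str_face_zero x)).symm

theorem tgtV_sq (x : 𝒟.nerve.Bar (s + 2)) : 𝒟.DV.tgt (sq x) = th x :=
  (congrArg last (face_str x)).symm.trans (last_face_of_lt _ _ (by omega))

theorem srcH_sq (x : 𝒟.nerve.Bar (s + 2)) : 𝒟.DH.src (sq x) = et x := by
  rw [et, row_succ, ← last_row x (p := s) (q := 0) (by omega)]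
  rfl

theorem tgtH_sq (x : 𝒟.nerve.Bar (s + 2)) :
    𝒟.DH.tgt (sq x) = et (𝒟.nerve.bar.face (s + 1) (s + 2) le_rfl x) := by
  rw [et, row_face_of_lt _ _ _ _ (by omega), ← last_row x (p := s) (q := 0) (by omega)]
  have : s + 2 - (s + 1) = 1 := by omega
  simp only [this]
  rfl

theorem sq_face_of_lt (x : 𝒟.nerve.Bar (s + 3)) (i : ℕ) (h1 : 1 < i) (h2 : i < s + 2) :
    sq (𝒟.nerve.bar.face (s + 2) i (by omega) x) = sq x := by
  rw [sq, row_face_of_lt _ _ _ _ (by omega), last_face_of_lt _ _ (by omega)]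
  rfl

/-- The face `f_1` composes the corner square vertically with the one of `f_0 x`. -/
theorem sq_face_one (x : 𝒟.nerve.Bar (s + 3)) :
    sq (𝒟.nerve.bar.face (s + 2) 1 (by omega) x) =
      𝒟.DV.pmul (sq x) (sq (𝒟.nerve.bar.face (s + 2) 0 (by omega) x)) := by
  rw [sq, row_face_one]
  refine (last_levelMul (n := s) (src_row_succ x (p := 0) (q := s + 1) (by omega))).trans ?_
  rw [last_row]
  rfl

/-- The last inner face composes the corner square horizontally with the one of the last face. -/
theorem sq_face_pred (x : 𝒟.nerve.Bar (s + 3)) :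
    sq (𝒟.nerve.bar.face (s + 2) (s + 2) (by omega) x) =
      𝒟.DH.pmul (sq (𝒟.nerve.bar.face (s + 2) (s + 3) le_rfl x)) (sq x) := by
  rw [sq, row_face_of_lt _ _ _ _ (by omega), sq, row_face_of_lt _ _ _ _ (by omega)]
  exact last_face_self _

theorem th_face_of_lt (x : 𝒟.nerve.Bar (s + 2)) (i : ℕ) (h1 : 0 < i) (h2 : i < s + 1) :
    th (𝒟.nerve.bar.face (s + 1) i (by omega) x) = th x := by
  rw [th, str_face _ _ _ h1, last_face_of_lt _ _ h2, th]

theorem th_face_pred (x : 𝒟.nerve.Bar (s + 2)) :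
    th (𝒟.nerve.bar.face (s + 1) (s + 1) (by omega) x) =
      𝒟.VM.pmul (th (𝒟.nerve.bar.face (s + 1) (s + 2) le_rfl x)) (th x) := by
  rw [th, str_face _ _ _ (by omega), last_face_self, th, str_face _ _ _ (by omega), th]

theorem et_face_of_lt (x : 𝒟.nerve.Bar (s + 2)) (i : ℕ) (h1 : 1 < i) (h2 : i < s + 2) :
    et (𝒟.nerve.bar.face (s + 1) i (by omega) x) = et x := by
  rw [et, row_face_of_ge _ _ _ _ h1 (by omega), et]

theorem et_face_one (x : 𝒟.nerve.Bar (s + 2)) :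
    et (𝒟.nerve.bar.face (s + 1) 1 (by omega) x) =
      𝒟.HM.pmul (et x) (et (𝒟.nerve.bar.face (s + 1) 0 (by omega) x)) :=
  row_face_one x _

theorem src_th_eq_tgt_et (x : 𝒟.nerve.Bar 1) : 𝒟.VM.src (th x) = 𝒟.HM.tgt (et x) :=
  face_str x

theorem pt_face_zero (x : 𝒟.nerve.Bar 1) :
    pt (𝒟.nerve.bar.face 0 0 (by omega) x) = 𝒟.HM.src (et x) :=
  str_face_zero x

theorem pt_face_one (x : 𝒟.nerve.Bar 1) :
    pt (𝒟.nerve.bar.face 0 1 (by omega) x) = 𝒟.VM.tgt (th x) :=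
  str_face x 1 (by omega) (by omega)

end DoubleGpd

/-! ### Gluing simplices along the corner square -/

namespace Gpd

variable {G X G' X' : Type u} {γ : Gpd G X} {γ' : Gpd G' X'}

theorem head_map (φ : Hom γ γ') {n : ℕ} (a : γ.Nerve n) : head (φ.map n a) = φ.obj (head a) := by
  cases n with
  | zero => rfl
  | succ n => exact φ.tgt_arr _

theorem head_face_last {n : ℕ} (a : γ.Nerve (n + 1)) :
    head (γ.face n (n + 1) le_rfl a) = head a := by
  cases n with
  | zero => rfl
  | succ n => exact congrArg γ.tgt (first_face_of_lt a _ _ (by omega))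

theorem face_last_face_zero {n : ℕ} (a : γ.Nerve (n + 2)) :
    γ.face n (n + 1) le_rfl (γ.face (n + 1) 0 (Nat.zero_le _) a) =
      γ.face n 0 (Nat.zero_le _) (γ.face (n + 1) (n + 2) le_rfl a) :=
  (γ.face_face n 0 (n + 1) (Nat.zero_le _) le_rfl a).symm

end Gpd

namespace DoubleGpd

open Gpd

variable {D H V M : Type u} {𝒟 : DoubleGpd D H V M} {r s p q : ℕ}

theorem row_face_last (x : 𝒟.nerve.Bar (s + 2)) :
    row (𝒟.nerve.bar.face (s + 1) (s + 2) le_rfl x) 0 s (by omega) =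
      𝒟.DH.face s (s + 1) le_rfl (row x 0 (s + 1) (by omega)) :=
  row_face_of_lt x (s + 2) le_rfl (p := 0) (by omega) (by omega)

/-- A simplex is determined by its first face, its last face and its corner square. -/
theorem ext_of_sq {x y : 𝒟.nerve.Bar (s + 2)}
    (h0 : 𝒟.nerve.bar.face (s + 1) 0 (Nat.zero_le _) x =
      𝒟.nerve.bar.face (s + 1) 0 (Nat.zero_le _) y)
    (h1 : 𝒟.nerve.bar.face (s + 1) (s + 2) le_rfl x = 𝒟.nerve.bar.face (s + 1) (s + 2) le_rfl y)
    (h : sq x = sq y) : x = y := by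
  have hrow : ∀ p q (e : p + 1 + q = s + 2), row x p q e = row y p q e := by
    intro p
    induction p with
    | zero =>
      intro q e
      obtain rfl : q = s + 1 := by omega
      exact ext_last h (by rw [← row_face_last, ← row_face_last, h1])
    | succ p ih =>
      intro q e
      rw [row_succ, row_succ, ih]
  refine bar_ext fun p q e => ?_
  cases p with
  | zero =>
    obtain rfl : q = s + 2 := by omega
    refine ext_last (γ := 𝒟.VM) (a := str x) (b := str y) ?_ ?_
    · exact (tgtV_sq x).symm.trans ((congrArg _ h).trans (tgtV_sq y))
    · rw [← str_face _ _ _ (by omega), ← str_face _ _ _ (by omega), h1]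
  | succ p =>
    refine ext_first (hrow p q e) ?_
    rw [← ent_face_of_ge x 0 (by omega) (by omega) (by omega),
      ← ent_face_of_ge y 0 (by omega) (by omega) (by omega), h0]

theorem tail_row (w : 𝒟.nerve.Bar (s + 1)) : tail (row w 0 s (by omega)) = et w := by
  cases s with
  | zero => rfl
  | succ s => exact srcH_sq w

theorem src_th (w : 𝒟.nerve.Bar (s + 1)) : 𝒟.VM.src (th w) = 𝒟.HM.tgt (et w) := by
  cases s with
  | zero => exact src_th_eq_tgt_et w
  | succ s => rw [← tgtV_sq, ← srcH_sq, 𝒟.tgt_src]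

/-- A simplex with prescribed first face `u`, last face `w` and corner square `Q` exists as soon as
these data fit together. -/
theorem exists_of_sq {u w : 𝒟.nerve.Bar (s + 1)} {Q : D}
    (h : 𝒟.nerve.bar.face s (s + 1) le_rfl u = 𝒟.nerve.bar.face s 0 (Nat.zero_le _) w)
    (hs : 𝒟.DV.src Q = th u) (ht : 𝒟.DH.tgt Q = et w) :
    ∃ x : 𝒟.nerve.Bar (s + 2), 𝒟.nerve.bar.face (s + 1) 0 (Nat.zero_le _) x = u ∧
      𝒟.nerve.bar.face (s + 1) (s + 2) le_rfl x = w ∧ sq x = Q := by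
  -- `R` is the row in position `(1, s + 1)`, and `S` the string in position `(0, s + 2)`
  obtain ⟨R, hR, hR'⟩ := exists_snoc (row w 0 s (by omega)) Q ((tail_row w).trans ht.symm)
  obtain ⟨S, hS, hS'⟩ := exists_snoc (str w) (𝒟.DV.tgt Q)
    ((src_th w).trans (by rw [← ht, 𝒟.tgt_tgt]))
  have hRu : 𝒟.srcV.map (s + 1) R = str u := by
    refine ext_last ((congrArg 𝒟.DV.src hR).trans hs) ?_
    rw [← Hom.map_face, hR', ← str_face_zero, ← h, str_face _ _ _ (by omega)]
  -- the rows of the other arrays are forced to be the strings `drop R p q`; they match `u`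
  have hhead : ∀ p q (e : p + q = s + 1), 𝒟.srcV.map q (drop R p q e) = head (ent u p q e) := by
    intro p
    induction p with
    | zero =>
      intro q e
      obtain rfl : q = s + 1 := by omega
      exact hRu
    | succ p ih =>
      intro q e
      rw [drop, Hom.map_face, ih, ← head_face_last, ← map_ent, head_map]
      rfl
  choose A hA hA' using fun p q (e : p + q = s + 1) =>
    exists_cons (γ := 𝒟.level q) (drop R p q e) (ent u p q e) (hhead p q e)
  let f : ∀ p q, p + q = s + 2 → 𝒟.Nerve p q
    | 0, q, e => cast (congrArg 𝒟.VM.Nerve (e.symm.trans (Nat.zero_add q))) S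
    | p + 1, q, e => A p q (by omega)
  have hf : BisimplicialStructure.Family.mk f ∈ 𝒟.nerve.barSet (s + 2) := by
    intro p q e
    cases p with
    | zero =>
      obtain rfl : q = s + 1 := by omega
      refine Eq.trans ?_ (congrArg (𝒟.tgtV.map (s + 1)) (hA 0 (s + 1) (by omega))).symm
      refine ext_last (γ := 𝒟.VM) (a := 𝒟.VM.face (s + 1) 0 (by omega) S) ?_ ?_
      · rw [last_face_of_lt _ _ (by omega), hS]
        exact (congrArg 𝒟.DV.tgt hR).symm
      · rw [face_last_face_zero, hS', ← Hom.map_face]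
        exact (face_str w).trans (congrArg _ hR'.symm)
    | succ p =>
      refine ext_first (γ := 𝒟.level q) (a := (𝒟.faceHom q 0 (by omega)).map (p + 1)
        (A p (q + 1) (by omega))) (b := (𝒟.level q).face (p + 1) (p + 2) le_rfl
        (A (p + 1) q (by omega))) ?_ ?_
      · rw [first_face_of_lt _ _ _ (by omega), hA]
        exact congrArg (𝒟.DH.face q 0 (Nat.zero_le _)) (hA p (q + 1) (by omega))
      · rw [← Hom.map_face, hA', ← face_last_face_zero,
          hA', map_ent]
  let x : 𝒟.nerve.Bar (s + 2) := ⟨_, hf⟩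
  have hx : ∀ p q (e : p + 1 + q = s + 2), ent x (p + 1) q e = A p q (by omega) :=
    fun p q e => rfl
  have hx0 : str x = S := rfl
  have h0 : 𝒟.nerve.bar.face (s + 1) 0 (Nat.zero_le _) x = u := by
    refine bar_ext fun p q e => ?_
    rw [ent_face_of_ge _ _ _ _ (by omega), hx, hA']
  -- without its last arrow, the row `drop R p` is the corresponding row of `w`
  have hrow : ∀ p q (e : p + 1 + q = s + 1),
      𝒟.DH.face q (q + 1) le_rfl (drop R p (q + 1) (by omega)) = row w p q e := by
    intro p
    induction p with
    | zero =>
      intro q e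
      obtain rfl : q = s := by omega
      exact hR'
    | succ p ih =>
      intro q e
      rw [drop, face_last_face_zero, ih, row_succ]
  refine ⟨x, h0, bar_ext fun p q e => ?_, (congrArg last (hA 0 (s + 1) (by omega))).trans hR⟩
  cases p with
  | zero =>
    obtain rfl : q = s + 1 := by omega
    exact (str_face x _ _ (by omega)).trans hS'
  | succ p =>
    have hi : s + 2 - (p + 1) = q + 1 := by omega
    rw [ent_face_of_lt _ _ _ _ (by omega), hx]
    simp only [hi]
    refine ext_first ?_ ?_
    · exact (congrArg (𝒟.DH.face q (q + 1) le_rfl) (hA p (q + 1) (by omega))).trans (hrow p q e)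
    · rw [← Hom.map_face, hA', ← ent_face_of_ge w 0 (by omega) (by omega) (by omega), ← h,
        ent_face_of_lt u _ _ _ (by omega)]
      have hi' : s + 1 - p = q + 1 := by omega
      simp only [hi']

end DoubleGpd

/-! ### Horns in dimension at least three -/

namespace SimplicialStructure

variable {obj : ℕ → Type u} (S : SimplicialStructure obj)

/-- The elements `y i`, for the indices `i ≤ m + 1` with `T i`, have compatible faces, so that they
form a partial horn (a horn if exactly one index is missing). The values of `y` at the other indices
are irrelevant. -/
def Matching : (m : ℕ) → (T : ℕ → Prop) → (ℕ → obj m) → Prop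
  | 0, _, _ => True
  | m + 1, T, y => ∀ (i j : ℕ) (hij : i ≤ j) (hj : j ≤ m + 1), T i → T (j + 1) →
      S.face m i (by omega) (y (j + 1)) = S.face m j hj (y i)

variable {S} {n i j : ℕ} {x : obj (n + 2)} {a b : obj (n + 1)}

/-- If a simplex `x` has the face `a` with index `i`, then its face with a larger index has the same
`i`-th face as any `b` which matches `a`. -/
theorem face_eq_of_lower (hij : i ≤ j) (hj : j ≤ n + 1) (h : S.face (n + 1) i (by omega) x = a)
    (e : S.face n i (by omega) b = S.face n j hj a) :
    S.face n i (by omega) (S.face (n + 1) (j + 1) (by omega) x) = S.face n i (by omega) b := by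
  rw [S.face_face n i j hij hj, h, e]

/-- The same as `face_eq_of_lower`, with the known face of `x` being the one with the larger index.
-/
theorem face_eq_of_upper (hij : i ≤ j) (hj : j ≤ n + 1)
    (h : S.face (n + 1) (j + 1) (by omega) x = b)
    (e : S.face n i (by omega) b = S.face n j hj a) :
    S.face n j hj (S.face (n + 1) i (by omega) x) = S.face n j hj a := by
  rw [← S.face_face n i j hij hj, h, e]

end SimplicialStructure

namespace DoubleGpd

open Gpd SimplicialStructure

variable {D H V M : Type u} {𝒟 : DoubleGpd D H V M} {s : ℕ}

theorem src_et (x : 𝒟.nerve.Bar (s + 2)) :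
    𝒟.HM.src (et x) = 𝒟.HM.tgt (et (𝒟.nerve.bar.face (s + 1) 0 (by omega) x)) :=
  src_row_succ x (p := s) (q := 0) (by omega)

theorem src_th_face (x : 𝒟.nerve.Bar (s + 2)) :
    𝒟.VM.src (th (𝒟.nerve.bar.face (s + 1) (s + 2) le_rfl x)) = 𝒟.VM.tgt (th x) := by
  rw [th, str_face _ _ _ (by omega)]
  exact (tgt_last (str x)).symm

/-- For a simplex of dimension at least three, the corner square is determined by the faces `f_0`
and `f_1`. -/
theorem sq_eq_one (x : 𝒟.nerve.Bar (s + 3)) :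
    sq x = 𝒟.DV.pmul (sq (𝒟.nerve.bar.face (s + 2) 1 (by omega) x))
      (𝒟.DV.inv (sq (𝒟.nerve.bar.face (s + 2) 0 (by omega) x))) := by
  rw [sq_face_one, pmul_inv_cancel]
  rw [srcV_sq, tgtV_sq]

/-- For a simplex of dimension at least three, the corner square is determined by the last two
faces. -/
theorem sq_eq_pred (x : 𝒟.nerve.Bar (s + 3)) :
    sq x = 𝒟.DH.pmul (𝒟.DH.inv (sq (𝒟.nerve.bar.face (s + 2) (s + 3) le_rfl x)))
      (sq (𝒟.nerve.bar.face (s + 2) (s + 2) (by omega) x)) := by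
  rw [sq_face_pred, inv_pmul_cancel]
  rw [srcH_sq, tgtH_sq]

theorem sq_face_zero_eq (x : 𝒟.nerve.Bar (s + 3)) :
    sq (𝒟.nerve.bar.face (s + 2) 0 (by omega) x) =
      𝒟.DV.pmul (𝒟.DV.inv (sq x)) (sq (𝒟.nerve.bar.face (s + 2) 1 (by omega) x)) := by
  rw [sq_face_one, inv_pmul_cancel]
  rw [srcV_sq, tgtV_sq]

theorem sq_face_last_eq (x : 𝒟.nerve.Bar (s + 3)) :
    sq (𝒟.nerve.bar.face (s + 2) (s + 3) le_rfl x) =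
      𝒟.DH.pmul (sq (𝒟.nerve.bar.face (s + 2) (s + 2) (by omega) x)) (𝒟.DH.inv (sq x)) := by
  rw [sq_face_pred, pmul_inv_cancel]
  rw [srcH_sq, tgtH_sq]

section Uniqueness

variable {x y : 𝒟.nerve.Bar (s + 3)}

/-- The face `f_0` is determined by `f_1`, the last face and the corner square. -/
theorem ext_of_face_one_last_sq
    (h1 : 𝒟.nerve.bar.face (s + 2) 1 (by omega) x = 𝒟.nerve.bar.face (s + 2) 1 (by omega) y)
    (h2 : 𝒟.nerve.bar.face (s + 2) (s + 3) le_rfl x = 𝒟.nerve.bar.face (s + 2) (s + 3) le_rfl y)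
    (h : sq x = sq y) : x = y := by
  refine ext_of_sq (ext_of_sq ?_ ?_ ?_) h2 h
  · rw [← 𝒟.nerve.bar.face_face (s + 1) 0 0 le_rfl (by omega), h1,
      𝒟.nerve.bar.face_face (s + 1) 0 0 le_rfl (by omega)]
  · rw [← 𝒟.nerve.bar.face_face (s + 1) 0 (s + 2) (by omega) (by omega), h2,
      𝒟.nerve.bar.face_face (s + 1) 0 (s + 2) (by omega) (by omega)]
  · rw [sq_face_zero_eq, sq_face_zero_eq, h, h1]

/-- The last face is determined by `f_0`, the last inner face and the corner square. -/
theorem ext_of_face_zero_pred_sq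
    (h1 : 𝒟.nerve.bar.face (s + 2) 0 (by omega) x = 𝒟.nerve.bar.face (s + 2) 0 (by omega) y)
    (h2 : 𝒟.nerve.bar.face (s + 2) (s + 2) (by omega) x =
      𝒟.nerve.bar.face (s + 2) (s + 2) (by omega) y)
    (h : sq x = sq y) : x = y := by
  refine ext_of_sq h1 (ext_of_sq ?_ ?_ ?_) h
  · rw [𝒟.nerve.bar.face_face (s + 1) 0 (s + 2) (by omega) (by omega), h1,
      𝒟.nerve.bar.face_face (s + 1) 0 (s + 2) (by omega) (by omega)]
  · rw [𝒟.nerve.bar.face_face (s + 1) (s + 2) (s + 2) (by omega) (by omega), h2,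
      𝒟.nerve.bar.face_face (s + 1) (s + 2) (s + 2) (by omega) (by omega)]
  · rw [sq_face_last_eq, sq_face_last_eq, h, h2]

/-- A simplex of dimension at least three is determined by its outer faces and one inner face. -/
theorem ext_of_inner (h1 : 𝒟.nerve.bar.face (s + 2) 0 (by omega) x =
      𝒟.nerve.bar.face (s + 2) 0 (by omega) y)
    (h2 : 𝒟.nerve.bar.face (s + 2) (s + 3) le_rfl x = 𝒟.nerve.bar.face (s + 2) (s + 3) le_rfl y)
    (j : ℕ) (hj : 0 < j) (hj' : j < s + 3)
    (h : 𝒟.nerve.bar.face (s + 2) j (by omega) x = 𝒟.nerve.bar.face (s + 2) j (by omega) y) :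
    x = y := by
  refine ext_of_sq h1 h2 ?_
  obtain rfl | rfl | ⟨h3, h4⟩ : j = 1 ∨ j = s + 2 ∨ 1 < j ∧ j < s + 2 := by omega
  · rw [sq_eq_one, sq_eq_one, h, h1]
  · rw [sq_eq_pred, sq_eq_pred, h, h2]
  · rw [← sq_face_of_lt x j h3 h4, ← sq_face_of_lt y j h3 h4, h]

/-- The horn maps of the bar construction are injective in dimensions at least three. -/
theorem ext_of_horn (k : ℕ) (h : ∀ (i : ℕ) (hi : i ≤ s + 3), i ≠ k →
    𝒟.nerve.bar.face (s + 2) i hi x = 𝒟.nerve.bar.face (s + 2) i hi y) : x = y := by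
  rcases eq_or_ne k 0 with rfl | h0
  · refine ext_of_face_one_last_sq (h _ _ (by omega)) (h _ _ (by omega)) ?_
    rw [sq_eq_pred, sq_eq_pred, h _ _ (by omega), h _ _ (by omega)]
  rcases eq_or_ne k (s + 3) with rfl | h1
  · refine ext_of_face_zero_pred_sq (h _ _ (by omega)) (h _ _ (by omega)) ?_
    rw [sq_eq_one, sq_eq_one, h _ _ (by omega), h _ _ (by omega)]
  rcases eq_or_ne k 1 with rfl | h2
  · exact ext_of_inner (h _ _ (by omega)) (h _ _ (by omega)) (s + 2) (by omega) (by omega)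
      (h _ _ (by omega))
  · exact ext_of_inner (h _ _ (by omega)) (h _ _ (by omega)) 1 (by omega) (by omega)
      (h _ _ (by omega))

end Uniqueness

/-- An edge is a pair consisting of an arrow in `V` and an arrow in `H`. -/
theorem ext_one {x y : 𝒟.nerve.Bar 1} (h : th x = th y) (h' : et x = et y) : x = y := by
  refine bar_ext fun p q e => ?_
  obtain ⟨rfl, rfl⟩ | ⟨rfl, rfl⟩ : (p = 0 ∧ q = 1) ∨ (p = 1 ∧ q = 0) := by omega
  · refine nerve_ext (γ := 𝒟.VM) (n := 0) fun k hk => ?_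
    obtain rfl : k = 0 := by omega
    exact h
  · refine nerve_ext (γ := 𝒟.level 0) (n := 0) fun k hk => ?_
    obtain rfl : k = 0 := by omega
    exact h'

section Existence

variable {y : ℕ → 𝒟.nerve.Bar (s + 2)}

/-- Inner horns containing `f_1`: both outer faces are given, and the corner square is computed from
`f_0` and `f_1`. -/
theorem exists_filler_of_ne_one {k : ℕ} (hk : k ≠ 0) (hk' : k < s + 3) (hk1 : k ≠ 1)
    (hy : 𝒟.nerve.bar.Matching (s + 2) (· ≠ k) y) :
    ∃ x : 𝒟.nerve.Bar (s + 3), ∀ (i : ℕ) (hi : i ≤ s + 3), i ≠ k →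
      𝒟.nerve.bar.face (s + 2) i hi x = y i := by
  have e1 := hy 0 0 le_rfl (by omega) hk.symm hk1.symm
  have e2 := hy 1 (s + 2) (by omega) (by omega) hk1.symm hk'.ne'
  have e3 := hy 0 (s + 2) (by omega) (by omega) hk.symm hk'.ne'
  have c1 : 𝒟.DV.src (sq (y 1)) = 𝒟.DV.src (sq (y 0)) := by rw [srcV_sq, srcV_sq, e1]
  obtain ⟨x, h1, h2, h3⟩ := exists_of_sq (u := y 0) (w := y (s + 3))
    (Q := 𝒟.DV.pmul (sq (y 1)) (𝒟.DV.inv (sq (y 0)))) e3.symm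
    (by rw [src_pmul_inv c1, tgtV_sq]) (by
      refine (𝒟.tgtH.map_pmul (by rw [tgt_inv, c1])).trans ?_
      rw [Hom.map_inv]
      show 𝒟.HM.pmul (𝒟.DH.tgt _) (𝒟.HM.inv (𝒟.DH.tgt _)) = _
      rw [tgtH_sq, tgtH_sq, ← e2, ← e3, et_face_one, pmul_inv_cancel (src_et _)])
  have f1 : 𝒟.nerve.bar.face (s + 2) 1 (by omega) x = y 1 := by
    refine ext_of_sq (face_eq_of_lower le_rfl (by omega) h1 e1)
      (face_eq_of_upper (by omega) (by omega) h2 e2) ?_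
    rw [sq_face_one, h3, h1, pmul_inv_cancel' c1]
  refine ⟨x, fun i hi hik => ?_⟩
  obtain rfl | rfl | rfl | ⟨h4, h5⟩ : i = 0 ∨ i = 1 ∨ i = s + 3 ∨ 1 < i ∧ i < s + 3 := by omega
  · exact h1
  · exact f1
  · exact h2
  obtain ⟨s, rfl⟩ : ∃ l, s = l + 1 := ⟨s - 1, by omega⟩
  obtain ⟨i, rfl⟩ : ∃ l, i = l + 1 := ⟨i - 1, by omega⟩
  exact ext_of_inner
    (face_eq_of_lower (by omega) (by omega) h1 (hy 0 i (by omega) (by omega) hk.symm hik))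
    (face_eq_of_upper (by omega) (by omega) h2 (hy (i + 1) _ (by omega) (by omega) hik hk'.ne'))
    1 (by omega) (by omega)
    (face_eq_of_lower (by omega) (by omega) f1 (hy 1 i (by omega) (by omega) hk1.symm hik))

/-- Inner horns lacking `f_1`: both outer faces are given, and the corner square is computed from
the last two faces. -/
theorem exists_filler_of_eq_one (hy : 𝒟.nerve.bar.Matching (s + 2) (· ≠ 1) y) :
    ∃ x : 𝒟.nerve.Bar (s + 3), ∀ (i : ℕ) (hi : i ≤ s + 3), i ≠ 1 →
      𝒟.nerve.bar.face (s + 2) i hi x = y i := by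
  have e1 := hy (s + 2) (s + 2) le_rfl (by omega) (by omega) (by omega)
  have e2 := hy 0 (s + 1) (by omega) (by omega) (by omega) (by omega)
  have e3 := hy 0 (s + 2) (by omega) (by omega) (by omega) (by omega)
  have c1 : 𝒟.DH.tgt (sq (y (s + 3))) = 𝒟.DH.tgt (sq (y (s + 2))) := by
    rw [tgtH_sq, tgtH_sq, e1]
  obtain ⟨x, h1, h2, h3⟩ := exists_of_sq (u := y 0) (w := y (s + 3))
    (Q := 𝒟.DH.pmul (𝒟.DH.inv (sq (y (s + 3)))) (sq (y (s + 2)))) e3.symm (by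
      refine (𝒟.srcV.map_pmul (by rw [src_inv, c1])).trans ?_
      rw [Hom.map_inv]
      show 𝒟.VM.pmul (𝒟.VM.inv (𝒟.DV.src _)) (𝒟.DV.src _) = _
      rw [srcV_sq, srcV_sq, e2, e3, th_face_pred, inv_pmul_cancel (src_th_face _)])
    (by rw [tgt_inv_pmul, srcH_sq])
  have f1 : 𝒟.nerve.bar.face (s + 2) (s + 2) (by omega) x = y (s + 2) := by
    refine ext_of_sq (face_eq_of_lower (by omega) (by omega) h1 e2)
      (face_eq_of_upper le_rfl (by omega) h2 e1) ?_
    rw [sq_face_pred, h3, h2, inv_pmul_cancel' c1]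
  refine ⟨x, fun i hi hik => ?_⟩
  obtain rfl | rfl | rfl | ⟨h4, h5⟩ : i = 0 ∨ i = s + 2 ∨ i = s + 3 ∨ 1 < i ∧ i < s + 2 := by omega
  · exact h1
  · exact f1
  · exact h2
  obtain ⟨s, rfl⟩ : ∃ l, s = l + 1 := ⟨s - 1, by omega⟩
  obtain ⟨i, rfl⟩ : ∃ l, i = l + 1 := ⟨i - 1, by omega⟩
  exact ext_of_inner
    (face_eq_of_lower (by omega) (by omega) h1 (hy 0 i (by omega) (by omega) (by omega) hik))
    (face_eq_of_upper (by omega) (by omega) h2 (hy (i + 1) _ (by omega) (by omega) hik (by omega)))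
    (s + 2) (by omega) (by omega)
    (face_eq_of_upper (by omega) (by omega) f1 (hy (i + 1) _ (by omega) (by omega) hik (by omega)))

/-- The relation between the last arrows in `V` of three of the faces in a horn. -/
theorem th_of_matching (hy : 𝒟.nerve.bar.Matching (s + 2) (· ≠ 0) y) :
    𝒟.VM.src (th (y (s + 3))) = 𝒟.VM.tgt (th (y 1)) ∧
      th (y (s + 2)) = 𝒟.VM.pmul (th (y (s + 3))) (th (y 1)) := by
  have e1 := hy 1 (s + 1) (by omega) (by omega) (by omega) (by omega)
  have e2 := hy 1 (s + 2) (by omega) (by omega) (by omega) (by omega)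
  have e3 := th_face_pred (y 1)
  have e4 := src_th_face (y 1)
  rw [← e1, ← e2] at e3
  rw [← e2] at e4
  have e5 := hy (s + 2) (s + 2) le_rfl (by omega) (by omega) (by omega)
  cases s with
  | zero =>
    have e6 := src_th_face (y 2)
    have e7 := src_th_face (y 3)
    rw [th_face_pred, th_face_pred, e5] at e3
    rw [th_face_pred, src_pmul e7] at e4
    refine ⟨e4, ?_⟩
    rw [e5] at e7
    rw [pmul_assoc e7 e4] at e3
    rw [← inv_pmul_cancel e6, e3, inv_pmul_cancel (by rw [tgt_pmul, e7])]
  | succ s =>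
    rw [th_face_of_lt _ _ (by omega) (by omega), th_face_of_lt _ _ (by omega) (by omega)] at e3
    rw [th_face_of_lt _ _ (by omega) (by omega)] at e4
    exact ⟨e4, e3⟩

/-- The relation between the first arrows in `H` of three of the faces in a horn. -/
theorem et_of_matching (hy : 𝒟.nerve.bar.Matching (s + 2) (· ≠ s + 3) y) :
    𝒟.HM.src (et (y (s + 2))) = 𝒟.HM.tgt (et (y 0)) ∧
      et (y 1) = 𝒟.HM.pmul (et (y (s + 2))) (et (y 0)) := by
  have e1 := hy 1 (s + 1) (by omega) (by omega) (by omega) (by omega)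
  have e2 := hy 0 (s + 1) (by omega) (by omega) (by omega) (by omega)
  have e3 := et_face_one (y (s + 2))
  have e4 := src_et (y (s + 2))
  rw [e1, e2] at e3
  rw [e2] at e4
  cases s with
  | zero =>
    have e5 := hy 0 0 le_rfl (by omega) (by omega) (by omega)
    have e6 := src_et (y 0)
    have e7 := src_et (y 1)
    rw [et_face_one, et_face_one, e5] at e3
    rw [et_face_one, tgt_pmul] at e4
    refine ⟨e4, ?_⟩
    rw [e5] at e7
    rw [← pmul_assoc e4 e6] at e3
    rw [← pmul_inv_cancel e7, e3, pmul_inv_cancel (by rw [src_pmul e4, e6])]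
  | succ s =>
    rw [et_face_of_lt _ _ (by omega) (by omega), et_face_of_lt _ _ (by omega) (by omega)] at e3
    rw [et_face_of_lt _ _ (by omega) (by omega)] at e4
    exact ⟨e4, e3⟩

/-- Outer horns lacking `f_0`: the corner square `Q` is computed from the last two faces. The
missing face is glued first, from its own outer faces and the square `Q⁻¹ · sq (y 1)`. In dimension
three the faces are triangles, to which `ext_of_face_one_last_sq` does not apply, so that the edge
`f_0 f_2 x` is compared directly. -/
theorem exists_filler_zero (hy : 𝒟.nerve.bar.Matching (s + 2) (· ≠ 0) y) :
    ∃ x : 𝒟.nerve.Bar (s + 3), ∀ (i : ℕ) (hi : i ≤ s + 3), i ≠ 0 →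
      𝒟.nerve.bar.face (s + 2) i hi x = y i := by
  have e1 := hy (s + 2) (s + 2) le_rfl (by omega) (by omega) (by omega)
  have e2 := hy 1 (s + 2) (by omega) (by omega) (by omega) (by omega)
  have e3 := hy 1 (s + 1) (by omega) (by omega) (by omega) (by omega)
  have c1 : 𝒟.DH.tgt (sq (y (s + 3))) = 𝒟.DH.tgt (sq (y (s + 2))) := by
    rw [tgtH_sq, tgtH_sq, e1]
  have c1' : 𝒟.DH.src (𝒟.DH.inv (sq (y (s + 3)))) = 𝒟.DH.tgt (sq (y (s + 2))) := by
    rw [src_inv, c1]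
  obtain ⟨c2, c3⟩ := th_of_matching hy
  let Q := 𝒟.DH.pmul (𝒟.DH.inv (sq (y (s + 3)))) (sq (y (s + 2)))
  have hQV : 𝒟.DV.tgt Q = 𝒟.DV.tgt (sq (y 1)) := by
    refine (𝒟.tgtV.map_pmul c1').trans ?_
    rw [Hom.map_inv]
    show 𝒟.VM.pmul (𝒟.VM.inv (𝒟.DV.tgt _)) (𝒟.DV.tgt _) = _
    rw [tgtV_sq, tgtV_sq, tgtV_sq, c3, inv_pmul_cancel c2]
  have hQs : 𝒟.DV.src Q = 𝒟.VM.pmul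
      (𝒟.VM.inv (th (𝒟.nerve.bar.face (s + 1) 0 (by omega) (y (s + 3)))))
      (th (𝒟.nerve.bar.face (s + 1) 0 (by omega) (y (s + 2)))) := by
    refine (𝒟.srcV.map_pmul c1').trans ?_
    rw [Hom.map_inv]
    show 𝒟.VM.pmul (𝒟.VM.inv (𝒟.DV.src _)) (𝒟.DV.src _) = _
    rw [srcV_sq, srcV_sq]
  have hQH : 𝒟.DH.tgt Q = et (y (s + 3)) := by rw [tgt_inv_pmul, srcH_sq]
  have hQH' : 𝒟.DH.src Q = et (y (s + 2)) := by rw [src_inv_pmul c1, srcH_sq]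
  have hQc : 𝒟.DV.src (𝒟.DV.inv Q) = 𝒟.DV.tgt (sq (y 1)) := by rw [src_inv, hQV]
  obtain ⟨u, h1, h2, h3⟩ := exists_of_sq
    (u := 𝒟.nerve.bar.face (s + 1) 0 (by omega) (y 1))
    (w := 𝒟.nerve.bar.face (s + 1) 0 (by omega) (y (s + 3)))
    (Q := 𝒟.DV.pmul (𝒟.DV.inv Q) (sq (y 1)))
    (by rw [← 𝒟.nerve.bar.face_face s 0 0 le_rfl (by omega), e2,
        𝒟.nerve.bar.face_face s 0 (s + 1) (by omega) le_rfl])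
    (by rw [src_inv_pmul hQV, srcV_sq]) (by
      refine (𝒟.tgtH.map_pmul hQc).trans ?_
      rw [Hom.map_inv]
      show 𝒟.HM.pmul (𝒟.HM.inv (𝒟.DH.tgt _)) (𝒟.DH.tgt _) = _
      rw [hQH, tgtH_sq, ← e2, et_face_one, inv_pmul_cancel (src_et _)])
  obtain ⟨x, h4, h5, h6⟩ := exists_of_sq (u := u) (w := y (s + 3)) (Q := Q) h2
    (by rw [← tgtV_sq, h3, tgt_inv_pmul]) hQH
  have f1 : 𝒟.nerve.bar.face (s + 2) 1 (by omega) x = y 1 := by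
    refine ext_of_sq ?_ (face_eq_of_upper (by omega) (by omega) h5 e2) ?_
    · rw [𝒟.nerve.bar.face_face (s + 1) 0 0 le_rfl (by omega), h4, h1]
    · rw [sq_face_one, h6, h4, h3, inv_pmul_cancel' hQV]
  have f2 : sq (𝒟.nerve.bar.face (s + 2) (s + 2) (by omega) x) = sq (y (s + 2)) := by
    rw [sq_face_pred, h6, h5, inv_pmul_cancel' c1]
  have f3 : 𝒟.nerve.bar.face (s + 2) (s + 2) (by omega) x = y (s + 2) := by
    cases s with
    | zero =>
      refine ext_of_sq ?_ (face_eq_of_upper le_rfl (by omega) h5 e1) f2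
      rw [𝒟.nerve.bar.face_face 1 0 1 (by omega) (by omega), h4]
      refine ext_one ?_ ?_
      · rw [th_face_pred, h2, ← tgtV_sq, h3, tgt_inv_pmul, hQs, inv_pmul_cancel']
        rw [← srcV_sq, ← srcV_sq, ← 𝒟.src_tgt, ← 𝒟.src_tgt, c1]
      · have e3 : 𝒟.nerve.bar.face (0 + 1) 1 (by omega) (y (0 + 2)) =
            𝒟.nerve.bar.face (0 + 1) 1 (by omega) (y 1) := e3
        have e4 := congrArg (fun z => 𝒟.HM.tgt (et z)) e3
        simp only [et_face_one, tgt_pmul] at e4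
        rw [et_face_one, ← srcH_sq, h3, h1]
        refine (congrArg (𝒟.HM.pmul · _) (𝒟.srcH.map_pmul hQc)).trans ?_
        rw [Hom.map_inv]
        show 𝒟.HM.pmul (𝒟.HM.pmul (𝒟.HM.inv (𝒟.DH.src _)) (𝒟.DH.src _)) _ = _
        rw [hQH', srcH_sq, pmul_assoc (by rw [src_inv, e4]) (src_et _), ← et_face_one, ← e3,
          et_face_one, inv_pmul_cancel (src_et _)]
    | succ s =>
      exact ext_of_face_one_last_sq (face_eq_of_lower (by omega) (by omega) f1 e3)
        (face_eq_of_upper le_rfl (by omega) h5 e1) f2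
  refine ⟨x, fun i hi hik => ?_⟩
  obtain rfl | rfl | rfl | ⟨h7, h8⟩ : i = 1 ∨ i = s + 2 ∨ i = s + 3 ∨ 1 < i ∧ i < s + 2 := by omega
  · exact f1
  · exact f3
  · exact h5
  obtain ⟨s, rfl⟩ : ∃ l, s = l + 1 := ⟨s - 1, by omega⟩
  obtain ⟨i, rfl⟩ : ∃ l, i = l + 1 := ⟨i - 1, by omega⟩
  have g1 := face_eq_of_lower (by omega) (by omega) f1
    (hy 1 i (by omega) (by omega) (by omega) hik)
  have g2 := face_eq_of_upper (by omega) (by omega) f3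
    (hy (i + 1) _ (by omega) (by omega) hik (by omega))
  have g3 := face_eq_of_upper (by omega) (by omega) h5
    (hy (i + 1) _ (by omega) (by omega) hik (by omega))
  refine ext_of_face_one_last_sq g1 g3 ?_
  rw [sq_eq_pred, g2, g3, ← sq_eq_pred]

/-- Outer horns lacking the last face, filled like those lacking `f_0` with the roles of `H` and `V`
interchanged. -/
theorem exists_filler_last (hy : 𝒟.nerve.bar.Matching (s + 2) (· ≠ s + 3) y) :
    ∃ x : 𝒟.nerve.Bar (s + 3), ∀ (i : ℕ) (hi : i ≤ s + 3), i ≠ s + 3 →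
      𝒟.nerve.bar.face (s + 2) i hi x = y i := by
  have e1 := hy 0 0 le_rfl (by omega) (by omega) (by omega)
  have e2 := hy 0 (s + 1) (by omega) (by omega) (by omega) (by omega)
  have e3 := hy 1 (s + 1) (by omega) (by omega) (by omega) (by omega)
  have c1 : 𝒟.DV.src (sq (y 1)) = 𝒟.DV.src (sq (y 0)) := by rw [srcV_sq, srcV_sq, e1]
  have c1' : 𝒟.DV.src (sq (y 1)) = 𝒟.DV.tgt (𝒟.DV.inv (sq (y 0))) := by rw [tgt_inv, c1]
  obtain ⟨c2, c3⟩ := et_of_matching hy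
  let Q := 𝒟.DV.pmul (sq (y 1)) (𝒟.DV.inv (sq (y 0)))
  have hQH : 𝒟.DH.src (sq (y (s + 2))) = 𝒟.DH.src Q := by
    refine Eq.symm ((𝒟.srcH.map_pmul c1').trans ?_)
    rw [Hom.map_inv]
    show 𝒟.HM.pmul (𝒟.DH.src _) (𝒟.HM.inv (𝒟.DH.src _)) = _
    rw [srcH_sq, srcH_sq, srcH_sq, c3, pmul_inv_cancel c2]
  have hQt : 𝒟.DH.tgt Q = 𝒟.HM.pmul
      (et (𝒟.nerve.bar.face (s + 1) (s + 2) le_rfl (y 1)))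
      (𝒟.HM.inv (et (𝒟.nerve.bar.face (s + 1) (s + 2) le_rfl (y 0)))) := by
    refine (𝒟.tgtH.map_pmul c1').trans ?_
    rw [Hom.map_inv]
    show 𝒟.HM.pmul (𝒟.DH.tgt _) (𝒟.HM.inv (𝒟.DH.tgt _)) = _
    rw [tgtH_sq, tgtH_sq]
  have hQV : 𝒟.DV.src Q = th (y 0) := by rw [src_pmul_inv c1, tgtV_sq]
  have hQV' : 𝒟.DV.tgt Q = th (y 1) := by rw [tgt_pmul, tgtV_sq]
  have hQc : 𝒟.DH.src (sq (y (s + 2))) = 𝒟.DH.tgt (𝒟.DH.inv Q) := by rw [tgt_inv, hQH]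
  obtain ⟨w, h1, h2, h3⟩ := exists_of_sq
    (u := 𝒟.nerve.bar.face (s + 1) (s + 2) le_rfl (y 0))
    (w := 𝒟.nerve.bar.face (s + 1) (s + 2) le_rfl (y (s + 2)))
    (Q := 𝒟.DH.pmul (sq (y (s + 2))) (𝒟.DH.inv Q))
    (by rw [𝒟.nerve.bar.face_face s (s + 1) (s + 1) le_rfl le_rfl, ← e2,
        𝒟.nerve.bar.face_face s 0 (s + 1) (by omega) le_rfl]) (by
      refine (𝒟.srcV.map_pmul hQc).trans ?_
      rw [Hom.map_inv]
      show 𝒟.VM.pmul (𝒟.DV.src _) (𝒟.VM.inv (𝒟.DV.src _)) = _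
      rw [hQV, srcV_sq, e2, th_face_pred, pmul_inv_cancel (src_th_face _)])
    (by rw [tgt_pmul, tgtH_sq])
  obtain ⟨x, h4, h5, h6⟩ := exists_of_sq (u := y 0) (w := w) (Q := Q) h1.symm hQV
    (by rw [← srcH_sq, h3, src_pmul hQc, src_inv])
  have f1 : 𝒟.nerve.bar.face (s + 2) (s + 2) (by omega) x = y (s + 2) := by
    refine ext_of_sq (face_eq_of_lower (by omega) (by omega) h4 e2) ?_ ?_
    · rw [← 𝒟.nerve.bar.face_face (s + 1) (s + 2) (s + 2) le_rfl (by omega), h5, h2]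
    · rw [sq_face_pred, h6, h5, h3, pmul_inv_cancel' hQH]
  have f2 : sq (𝒟.nerve.bar.face (s + 2) 1 (by omega) x) = sq (y 1) := by
    rw [sq_face_one, h6, h4, pmul_inv_cancel' c1]
  have f3 : 𝒟.nerve.bar.face (s + 2) 1 (by omega) x = y 1 := by
    cases s with
    | zero =>
      refine ext_of_sq (face_eq_of_lower le_rfl (by omega) h4 e1) ?_ f2
      rw [← 𝒟.nerve.bar.face_face 1 1 2 (by omega) (by omega), h5]
      refine ext_one ?_ ?_
      · have e4 := congrArg (fun z => 𝒟.VM.src (th z)) e3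
        simp only [th_face_pred, src_pmul (src_th_face _)] at e4
        rw [th_face_pred, ← tgtV_sq, h3, h2]
        refine (congrArg (𝒟.VM.pmul _) (𝒟.tgtV.map_pmul hQc)).trans ?_
        rw [Hom.map_inv]
        show 𝒟.VM.pmul _ (𝒟.VM.pmul (𝒟.DV.tgt _) (𝒟.VM.inv (𝒟.DV.tgt _))) = _
        rw [hQV', tgtV_sq, ← pmul_assoc (src_th_face _) (by rw [tgt_inv, e4]), ← th_face_pred, e3,
          th_face_pred, pmul_inv_cancel (src_th_face _)]
      · rw [et_face_one, h1, ← srcH_sq, h3, src_pmul hQc, src_inv, hQt, pmul_inv_cancel']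
        rw [← tgtH_sq, ← tgtH_sq, 𝒟.src_tgt, 𝒟.src_tgt, c1]
    | succ s =>
      exact ext_of_face_zero_pred_sq (face_eq_of_lower le_rfl (by omega) h4 e1)
        (face_eq_of_upper (by omega) (by omega) f1 e3) f2
  refine ⟨x, fun i hi hik => ?_⟩
  obtain rfl | rfl | rfl | ⟨h7, h8⟩ : i = 0 ∨ i = 1 ∨ i = s + 2 ∨ 1 < i ∧ i < s + 2 := by omega
  · exact h4
  · exact f3
  · exact f1
  obtain ⟨s, rfl⟩ : ∃ l, s = l + 1 := ⟨s - 1, by omega⟩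
  obtain ⟨i, rfl⟩ : ∃ l, i = l + 1 := ⟨i - 1, by omega⟩
  have g1 := face_eq_of_lower (by omega) (by omega) h4
    (hy 0 i (by omega) (by omega) (by omega) hik)
  have g2 := face_eq_of_lower (by omega) (by omega) f3
    (hy 1 i (by omega) (by omega) (by omega) hik)
  have g3 := face_eq_of_upper (by omega) (by omega) f1
    (hy (i + 1) _ (by omega) (by omega) hik (by omega))
  refine ext_of_face_zero_pred_sq g1 g3 ?_
  rw [sq_eq_one, g2, g1, ← sq_eq_one]

/-- All horns of the bar construction have fillers in dimensions at least three. -/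
theorem exists_filler {k : ℕ} (hk : k ≤ s + 3) (hy : 𝒟.nerve.bar.Matching (s + 2) (· ≠ k) y) :
    ∃ x : 𝒟.nerve.Bar (s + 3), ∀ (i : ℕ) (hi : i ≤ s + 3), i ≠ k →
      𝒟.nerve.bar.face (s + 2) i hi x = y i := by
  obtain rfl | rfl | rfl | ⟨h0, h1, h2⟩ :
    k = 0 ∨ k = 1 ∨ k = s + 3 ∨ k ≠ 0 ∧ k < s + 3 ∧ k ≠ 1 := by omega
  · exact exists_filler_zero hy
  · exact exists_filler_of_eq_one hy
  · exact exists_filler_last hy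
  · exact exists_filler_of_ne_one h0 h1 h2 hy

end Existence

end DoubleGpd

/-! ### Simplices of dimension at most two -/

namespace DoubleGpd

open Gpd SimplicialStructure

variable {D H V M : Type u} {𝒟 : DoubleGpd D H V M}

/-- A vertex is a point of `M`. -/
theorem ext_zero {x y : 𝒟.nerve.Bar 0} (h : pt x = pt y) : x = y := by
  refine bar_ext fun p q e => ?_
  obtain ⟨rfl, rfl⟩ : p = 0 ∧ q = 0 := by omega
  exact h

/-- Any pair of arrows in `V` and `H` with `s θ = t η` is an edge. -/
theorem exists_one {θ : V} {η : H} (h : 𝒟.VM.src θ = 𝒟.HM.tgt η) :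
    ∃ x : 𝒟.nerve.Bar 1, th x = θ ∧ et x = η := by
  let f : ∀ p q, p + q = 1 → 𝒟.Nerve p q
    | 0, q, e => cast (congrArg 𝒟.VM.Nerve (e.symm.trans (Nat.zero_add q)))
        (⟨fun _ => θ, composable_const θ⟩ : 𝒟.VM.Nerve 1)
    | p + 1, q, e => cast (congrArg₂ 𝒟.Nerve (show 0 + 1 = p + 1 by omega) (show 0 = q by omega))
        (⟨fun _ => η, composable_const (γ := 𝒟.level 0) η⟩ : (𝒟.level 0).Nerve 1)
  refine ⟨⟨.mk f, fun p q e => ?_⟩, rfl, rfl⟩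
  obtain ⟨rfl, rfl⟩ : p = 0 ∧ q = 0 := by omega
  exact h

section Uniqueness

variable {x y : 𝒟.nerve.Bar 2}

theorem et_face_zero_eq (x : 𝒟.nerve.Bar 2) : et (𝒟.nerve.bar.face 1 0 (by omega) x) =
    𝒟.HM.pmul (𝒟.HM.inv (𝒟.DH.src (sq x))) (et (𝒟.nerve.bar.face 1 1 (by omega) x)) := by
  rw [et_face_one, srcH_sq, inv_pmul_cancel (src_et x)]

theorem th_face_two_eq (x : 𝒟.nerve.Bar 2) : th (𝒟.nerve.bar.face 1 2 (by omega) x) =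
    𝒟.VM.pmul (th (𝒟.nerve.bar.face 1 1 (by omega) x)) (𝒟.VM.inv (𝒟.DV.tgt (sq x))) := by
  rw [th_face_pred, tgtV_sq, pmul_inv_cancel (src_th_face x)]

/-- A triangle is determined by its corner square and the faces `f_1` and `f_2`. -/
theorem ext_two_of_one_two
    (h1 : 𝒟.nerve.bar.face 1 1 (by omega) x = 𝒟.nerve.bar.face 1 1 (by omega) y)
    (h2 : 𝒟.nerve.bar.face 1 2 (by omega) x = 𝒟.nerve.bar.face 1 2 (by omega) y)
    (h : sq x = sq y) : x = y := by
  refine ext_of_sq (ext_one ?_ ?_) h2 h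
  · rw [← srcV_sq, ← srcV_sq, h]
  · rw [et_face_zero_eq, et_face_zero_eq, h, h1]

/-- A triangle is determined by its corner square and the faces `f_0` and `f_1`. -/
theorem ext_two_of_zero_one
    (h1 : 𝒟.nerve.bar.face 1 0 (by omega) x = 𝒟.nerve.bar.face 1 0 (by omega) y)
    (h2 : 𝒟.nerve.bar.face 1 1 (by omega) x = 𝒟.nerve.bar.face 1 1 (by omega) y)
    (h : sq x = sq y) : x = y := by
  refine ext_of_sq h1 (ext_one ?_ ?_) h
  · rw [th_face_two_eq, th_face_two_eq, h, h2]
  · rw [← tgtH_sq, ← tgtH_sq, h]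

end Uniqueness

section Existence

variable {y₀ y₁ y₂ : 𝒟.nerve.Bar 1} {Q : D}

/-- Fillers of a horn lacking `f_0` are squares with prescribed vertical and horizontal targets. -/
theorem exists_two_of_one_two
    (h : 𝒟.nerve.bar.face 0 1 (by omega) y₂ = 𝒟.nerve.bar.face 0 1 (by omega) y₁)
    (h1 : 𝒟.DV.tgt Q = 𝒟.VM.pmul (𝒟.VM.inv (th y₂)) (th y₁)) (h2 : 𝒟.DH.tgt Q = et y₂) :
    ∃ x : 𝒟.nerve.Bar 2, 𝒟.nerve.bar.face 1 1 (by omega) x = y₁ ∧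
      𝒟.nerve.bar.face 1 2 (by omega) x = y₂ ∧ sq x = Q := by
  have e1 : 𝒟.VM.tgt (th y₂) = 𝒟.VM.tgt (th y₁) := by rw [← pt_face_one, ← pt_face_one, h]
  have e2 : 𝒟.HM.tgt (𝒟.DH.src Q) = 𝒟.HM.tgt (et y₁) := by
    rw [𝒟.tgt_src, h1, src_inv_pmul e1, src_th]
  obtain ⟨u, h3, h4⟩ := exists_one (𝒟 := 𝒟) (θ := 𝒟.DV.src Q)
    (η := 𝒟.HM.pmul (𝒟.HM.inv (𝒟.DH.src Q)) (et y₁)) (by rw [tgt_inv_pmul, 𝒟.src_src])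
  obtain ⟨x, h5, h6, h7⟩ := exists_of_sq (u := u) (w := y₂) (Q := Q)
    (ext_zero (by rw [pt_face_one, pt_face_zero, h3, ← h2, 𝒟.src_tgt])) h3.symm h2
  refine ⟨x, ext_one ?_ ?_, h6, h7⟩
  · rw [th_face_pred, h6, ← tgtV_sq, h7, h1, inv_pmul_cancel' e1]
  · rw [et_face_one, h5, ← srcH_sq, h7, h4, inv_pmul_cancel' e2]

/-- Fillers of a horn lacking `f_2` are squares with prescribed vertical and horizontal sources. -/
theorem exists_two_of_zero_one
    (h : 𝒟.nerve.bar.face 0 0 (by omega) y₁ = 𝒟.nerve.bar.face 0 0 (by omega) y₀)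
    (h1 : 𝒟.DV.src Q = th y₀) (h2 : 𝒟.DH.src Q = 𝒟.HM.pmul (et y₁) (𝒟.HM.inv (et y₀))) :
    ∃ x : 𝒟.nerve.Bar 2, 𝒟.nerve.bar.face 1 0 (by omega) x = y₀ ∧
      𝒟.nerve.bar.face 1 1 (by omega) x = y₁ ∧ sq x = Q := by
  have e1 : 𝒟.HM.src (et y₁) = 𝒟.HM.src (et y₀) := by rw [← pt_face_zero, ← pt_face_zero, h]
  have e2 : 𝒟.VM.src (th y₁) = 𝒟.VM.src (𝒟.DV.tgt Q) := by
    rw [← 𝒟.tgt_src, h2, tgt_pmul, src_th]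
  obtain ⟨w, h3, h4⟩ := exists_one (𝒟 := 𝒟) (θ := 𝒟.VM.pmul (th y₁) (𝒟.VM.inv (𝒟.DV.tgt Q)))
    (η := 𝒟.DH.tgt Q) (by rw [src_pmul_inv e2, 𝒟.tgt_tgt])
  obtain ⟨x, h5, h6, h7⟩ := exists_of_sq (u := y₀) (w := w) (Q := Q)
    (ext_zero (by rw [pt_face_one, pt_face_zero, h4, ← h1, 𝒟.src_tgt])) h1 h4.symm
  refine ⟨x, h5, ext_one ?_ ?_, h7⟩
  · rw [th_face_pred, h6, ← tgtV_sq, h7, h3, pmul_inv_cancel' e2]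
  · rw [et_face_one, h5, ← srcH_sq, h7, h2, pmul_inv_cancel' e1]

end Existence

end DoubleGpd

/-! ### Smooth germs in the bar construction -/

namespace SimplicialStructure

/-- Smooth families of partial horns, with prescribed filler at one point, have smooth families of
fillers near that point. Here the faces with index `i` such that `T i` are prescribed. -/
def HasLocalFillers {obj : ℕ → Type u} (S : SimplicialStructure obj)
    (σ : ∀ n, SmoothStructure (obj n)) (m : ℕ) (T : ℕ → Prop) : Prop :=
  ∀ (P : Type u) (π : SmoothStructure P) (p : P) (y : ℕ → P → obj m) (x : obj (m + 1)),
    (∀ i, i ≤ m + 1 → T i → π.Near (σ m) (y i) p) →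
    (∀ i hi, T i → S.face m i hi x = y i p) →
    (∀ᶠ p' in π.nhds p, S.Matching m T fun i => y i p') →
    ∃ c : P → obj (m + 1), π.Near (σ (m + 1)) c p ∧ c p = x ∧
      ∀ᶠ p' in π.nhds p, ∀ i hi, T i → S.face m i hi (c p') = y i p'

end SimplicialStructure

namespace SmoothStructure

instance {X : Type u} (σ : SmoothStructure X) (x : X) : (σ.nhds x).NeBot :=
  let := σ.top
  inferInstanceAs (_root_.nhds x).NeBot

end SmoothStructure

namespace DoubleLieGroupoid

open Gpd DoubleGpd SmoothStructure SimplicialStructure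

variable {D H V M : Type u} (𝒟 : DoubleLieGroupoid D H V M) {r s : ℕ}
  {P : Type u} {π : SmoothStructure P} {p : P}

/-- The smooth structures on the levels of the bar construction. -/
noncomputable abbrev barS (r : ℕ) : SmoothStructure (𝒟.nerve.Bar r) :=
  𝒟.nerve.barSmooth 𝒟.nerveSmooth r

variable {𝒟}

theorem near_bar_iff {c : P → 𝒟.nerve.Bar r} : π.Near (𝒟.barS r) c p ↔
    ∀ i j h, π.Near (𝒟.nerveSmooth i j) (fun p => ent (c p) i j h) p :=
  𝒟.nerve_isSmooth.near_bar_iff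

theorem near_face {c : P → 𝒟.nerve.Bar (r + 1)} (hc : π.Near (𝒟.barS (r + 1)) c p) (i : ℕ)
    (hi : i ≤ r + 1) : π.Near (𝒟.barS r) (fun p => 𝒟.nerve.bar.face r i hi (c p)) p :=
  (𝒟.nerve_isSmooth.smooth_barFace r i hi).near_comp hc

theorem near_str {c : P → 𝒟.nerve.Bar r} (hc : π.Near (𝒟.barS r) c p) :
    π.Near (𝒟.VM.nerveSmooth 𝒟.σV 𝒟.σM r) (fun p => str (c p)) p :=
  near_bar_iff.1 hc 0 r (Nat.zero_add r)

theorem near_row {c : P → 𝒟.nerve.Bar r} (hc : π.Near (𝒟.barS r) c p) (i j : ℕ)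
    (h : i + 1 + j = r) :
    π.Near (𝒟.DH.nerveSmooth 𝒟.σD 𝒟.σH j) (fun p => row (c p) i j h) p :=
  (𝒟.level_isLie j).near_apply (near_bar_iff.1 hc (i + 1) j h) 0

theorem near_th {c : P → 𝒟.nerve.Bar (s + 1)} (hc : π.Near (𝒟.barS (s + 1)) c p) :
    π.Near 𝒟.σV (fun p => th (c p)) p :=
  𝒟.lieVM.near_apply (near_str hc) _

theorem near_et {c : P → 𝒟.nerve.Bar (s + 1)} (hc : π.Near (𝒟.barS (s + 1)) c p) :
    π.Near 𝒟.σH (fun p => et (c p)) p :=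
  near_row hc s 0 rfl

theorem near_sq {c : P → 𝒟.nerve.Bar (s + 2)} (hc : π.Near (𝒟.barS (s + 2)) c p) :
    π.Near 𝒟.σD (fun p => sq (c p)) p :=
  𝒟.lieDH.near_apply (near_row hc 0 (s + 1) (by omega)) _

theorem near_pt {c : P → 𝒟.nerve.Bar 0} (hc : π.Near (𝒟.barS 0) c p) :
    π.Near 𝒟.σM (fun p => pt (c p)) p :=
  near_str hc

theorem near_of_th_et {c : P → 𝒟.nerve.Bar 1} (h : π.Near 𝒟.σV (fun p => th (c p)) p)
    (h' : π.Near 𝒟.σH (fun p => et (c p)) p) : π.Near (𝒟.barS 1) c p := by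
  refine near_bar_iff.2 fun i j e => ?_
  obtain ⟨rfl, rfl⟩ | ⟨rfl, rfl⟩ : (i = 0 ∧ j = 1) ∨ (i = 1 ∧ j = 0) := by omega
  · refine 𝒟.lieVM.near_nerve_iff.2 fun k => ?_
    obtain rfl : k = 0 := Fin.ext (Nat.lt_one_iff.1 k.2)
    exact h
  · refine (𝒟.level_isLie 0).near_nerve_iff.2 fun k => ?_
    obtain rfl : k = 0 := Fin.ext (Nat.lt_one_iff.1 k.2)
    exact h'

/-- A germ of maps into the bar construction is smooth if its first face, its last face and its
corner square are. -/
theorem near_of_sq {c : P → 𝒟.nerve.Bar (s + 2)}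
    (h0 : π.Near (𝒟.barS (s + 1)) (fun p => 𝒟.nerve.bar.face (s + 1) 0 (Nat.zero_le _) (c p)) p)
    (h1 : π.Near (𝒟.barS (s + 1)) (fun p => 𝒟.nerve.bar.face (s + 1) (s + 2) le_rfl (c p)) p)
    (h : π.Near 𝒟.σD (fun p => sq (c p)) p) : π.Near (𝒟.barS (s + 2)) c p := by
  have hrow : ∀ i j (e : i + 1 + j = s + 2),
      π.Near (𝒟.DH.nerveSmooth 𝒟.σD 𝒟.σH j) (fun p => row (c p) i j e) p := by
    intro i
    induction i with
    | zero =>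
      intro j e
      obtain rfl : j = s + 1 := by omega
      exact 𝒟.lieDH.near_of_last h ((near_row h1 0 s (by omega)).congr
        (.of_forall fun p => (row_face_last (c p)).symm))
    | succ i ih =>
      intro j e
      exact ((𝒟.lieDH.smooth_face j 0 (by omega)).near_comp (ih (j + 1) (by omega))).congr
        (.of_forall fun p => row_succ (c p) e)
  refine near_bar_iff.2 fun i j e => ?_
  cases i with
  | zero =>
    obtain rfl : j = s + 2 := by omega
    refine 𝒟.lieVM.near_of_last (c := fun p => str (c p)) ?_ ?_
    · exact (𝒟.lieDV.near_tgt h).congr (.of_forall fun p => (tgtV_sq (c p)).symm)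
    · exact (near_str h1).congr (.of_forall fun p => (str_face (c p) _ _ (by omega)).symm)
  | succ i =>
    refine (𝒟.level_isLie j).near_of_first (hrow i j e) ?_
    exact (near_bar_iff.1 h0 i j (by omega)).congr
      (.of_forall fun p => (ent_face_of_ge (c p) 0 (by omega) (by omega) (by omega)).symm)

section Near

variable {c : P → 𝒟.nerve.Bar (s + 3)}

theorem near_sq_of_one
    (h0 : π.Near (𝒟.barS (s + 2)) (fun p => 𝒟.nerve.bar.face (s + 2) 0 (by omega) (c p)) p)
    (h1 : π.Near (𝒟.barS (s + 2)) (fun p => 𝒟.nerve.bar.face (s + 2) 1 (by omega) (c p)) p) :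
    π.Near 𝒟.σD (fun p => sq (c p)) p :=
  (𝒟.lieDV.near_pmul (near_sq h1) (𝒟.lieDV.near_inv (near_sq h0)) (.of_forall fun p => by
    rw [tgt_inv, srcV_sq, srcV_sq, 𝒟.nerve.bar.face_face (s + 1) 0 0 le_rfl (by omega)])).congr
    (.of_forall fun p => sq_eq_one (c p))

theorem near_sq_of_pred
    (h0 : π.Near (𝒟.barS (s + 2)) (fun p => 𝒟.nerve.bar.face (s + 2) (s + 3) le_rfl (c p)) p)
    (h1 : π.Near (𝒟.barS (s + 2)) (fun p => 𝒟.nerve.bar.face (s + 2) (s + 2) (by omega) (c p)) p) :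
    π.Near 𝒟.σD (fun p => sq (c p)) p :=
  (𝒟.lieDH.near_pmul (𝒟.lieDH.near_inv (near_sq h0)) (near_sq h1) (.of_forall fun p => by
    rw [src_inv, tgtH_sq, tgtH_sq, 𝒟.nerve.bar.face_face (s + 1) (s + 2) (s + 2) le_rfl
      (by omega)])).congr (.of_forall fun p => sq_eq_pred (c p))

/-- In dimensions at least three, a germ of maps into the bar construction is smooth if all but one
of its faces are. -/
theorem near_of_horn (k : ℕ) (h : ∀ (i : ℕ) (hi : i ≤ s + 3), i ≠ k →
    π.Near (𝒟.barS (s + 2)) (fun p => 𝒟.nerve.bar.face (s + 2) i hi (c p)) p) :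
    π.Near (𝒟.barS (s + 3)) c p := by
  rcases eq_or_ne k 0 with rfl | h0
  · have h1 := h 1 (by omega) (by omega)
    have h2 := h (s + 3) (by omega) (by omega)
    have hs := near_sq_of_pred h2 (h (s + 2) (by omega) (by omega))
    refine near_of_sq (near_of_sq ?_ ?_ ?_) h2 hs
    · exact (near_face h1 0 (by omega)).congr
        (.of_forall fun p => (𝒟.nerve.bar.face_face (s + 1) 0 0 le_rfl (by omega) _).symm)
    · exact (near_face h2 0 (by omega)).congr
        (.of_forall fun p => (𝒟.nerve.bar.face_face (s + 1) 0 (s + 2) (by omega) (by omega) _).symm)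
    · exact (𝒟.lieDV.near_pmul (𝒟.lieDV.near_inv hs) (near_sq h1) (.of_forall fun p => by
        rw [src_inv, sq_face_one, tgt_pmul])).congr (.of_forall fun p => sq_face_zero_eq (c p))
  rcases eq_or_ne k (s + 3) with rfl | h0'
  · have h1 := h 0 (by omega) (by omega)
    have h2 := h (s + 2) (by omega) (by omega)
    have hs := near_sq_of_one h1 (h 1 (by omega) (by omega))
    refine near_of_sq h1 (near_of_sq ?_ ?_ ?_) hs
    · exact (near_face h1 (s + 2) (by omega)).congr
        (.of_forall fun p => 𝒟.nerve.bar.face_face (s + 1) 0 (s + 2) (by omega) (by omega) _)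
    · exact (near_face h2 (s + 2) (by omega)).congr
        (.of_forall fun p => 𝒟.nerve.bar.face_face (s + 1) (s + 2) (s + 2) (by omega) (by omega) _)
    · exact (𝒟.lieDH.near_pmul (near_sq h2) (𝒟.lieDH.near_inv hs) (.of_forall fun p => by
        rw [tgt_inv, sq_face_pred, src_pmul (by rw [srcH_sq, tgtH_sq])])).congr
        (.of_forall fun p => sq_face_last_eq (c p))
  refine near_of_sq (h _ _ h0.symm) (h _ _ h0'.symm) ?_
  rcases eq_or_ne k 1 with rfl | h2
  · exact near_sq_of_pred (h _ _ (by omega)) (h _ _ (by omega))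
  · exact near_sq_of_one (h _ _ (by omega)) (h _ _ (by omega))

end Near

section Near

variable {c : P → 𝒟.nerve.Bar 2}

theorem near_two_of_one_two (h : π.Near 𝒟.σD (fun p => sq (c p)) p)
    (h1 : π.Near (𝒟.barS 1) (fun p => 𝒟.nerve.bar.face 1 1 (by omega) (c p)) p)
    (h2 : π.Near (𝒟.barS 1) (fun p => 𝒟.nerve.bar.face 1 2 (by omega) (c p)) p) :
    π.Near (𝒟.barS 2) c p := by
  refine near_of_sq (near_of_th_et ?_ ?_) h2 h
  · exact (𝒟.lieDV.near_src h).congr (.of_forall fun p => (srcV_sq (c p)).symm)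
  · exact (𝒟.lieHM.near_pmul (𝒟.lieHM.near_inv (𝒟.lieDH.near_src h)) (near_et h1)
      (.of_forall fun p => by rw [src_inv, et_face_one, tgt_pmul, srcH_sq])).congr
      (.of_forall fun p => et_face_zero_eq (c p))

theorem near_two_of_zero_one (h : π.Near 𝒟.σD (fun p => sq (c p)) p)
    (h0 : π.Near (𝒟.barS 1) (fun p => 𝒟.nerve.bar.face 1 0 (by omega) (c p)) p)
    (h1 : π.Near (𝒟.barS 1) (fun p => 𝒟.nerve.bar.face 1 1 (by omega) (c p)) p) :
    π.Near (𝒟.barS 2) c p := by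
  refine near_of_sq h0 (near_of_th_et ?_ ?_) h
  · exact (𝒟.lieVM.near_pmul (near_th h1) (𝒟.lieVM.near_inv (𝒟.lieDV.near_tgt h))
      (.of_forall fun p => by rw [tgt_inv, th_face_pred, src_pmul (src_th_face _), tgtV_sq])).congr
      (.of_forall fun p => th_face_two_eq (c p))
  · exact (𝒟.lieDH.near_tgt h).congr (.of_forall fun p => (tgtH_sq (c p)).symm)

end Near

end DoubleLieGroupoid

/-! ### Local fillers for horns -/

namespace DoubleLieGroupoid

open Gpd DoubleGpd SmoothStructure SimplicialStructure

variable {D H V M : Type u} (𝒟 : DoubleLieGroupoid D H V M) {s : ℕ}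

/-- Given the target of an edge, its arrows in `V` and `H` are lifted one after the other along the
target maps. -/
theorem hasLocalFillers_zero_zero : 𝒟.nerve.bar.HasLocalFillers 𝒟.barS 0 (· ≠ 0) := by
  intro P π p y x hy hx _
  have hx1 := hx 1 le_rfl (by omega)
  obtain ⟨a, h1, h2, h3⟩ := 𝒟.lieVM.tgt_submersion.exists_lift
    (near_pt (hy 1 le_rfl (by omega))) (th x) (by rw [← hx1, pt_face_one])
  obtain ⟨b, h4, h5, h6⟩ := 𝒟.lieHM.tgt_submersion.exists_lift (𝒟.lieVM.near_src h1) (et x)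
    (by rw [h2, src_th])
  obtain ⟨c, hc⟩ := (h6.mono fun p' h => exists_one h.symm).choice
  have h7 := eventually_self hc
  refine ⟨c, near_of_th_et (h1.congr (hc.mono fun p' h => h.1))
    (h4.congr (hc.mono fun p' h => h.2)),
    ext_one (h7.1.trans h2) (h7.2.trans h5), ?_⟩
  filter_upwards [h3, hc] with p' h8 h9 i hi hi0
  obtain rfl : i = 1 := by omega
  exact ext_zero (by rw [pt_face_one, h9.1, h8])

/-- Given the source of an edge, its arrows in `H` and `V` are lifted one after the other along the
source maps. -/
theorem hasLocalFillers_zero_one : 𝒟.nerve.bar.HasLocalFillers 𝒟.barS 0 (· ≠ 1) := by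
  intro P π p y x hy hx _
  have hx0 := hx 0 (by omega) (by omega)
  obtain ⟨b, h1, h2, h3⟩ := 𝒟.lieHM.src_submersion.exists_lift
    (near_pt (hy 0 (by omega) (by omega))) (et x) (by rw [← hx0, pt_face_zero])
  obtain ⟨a, h4, h5, h6⟩ := 𝒟.lieVM.src_submersion.exists_lift (𝒟.lieHM.near_tgt h1) (th x)
    (by rw [h2, src_th])
  obtain ⟨c, hc⟩ := (h6.mono fun p' h => exists_one h).choice
  have h7 := eventually_self hc
  refine ⟨c, near_of_th_et (h4.congr (hc.mono fun p' h => h.1))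
    (h1.congr (hc.mono fun p' h => h.2)),
    ext_one (h7.1.trans h5) (h7.2.trans h2), ?_⟩
  filter_upwards [h3, hc] with p' h8 h9 i hi hi0
  obtain rfl : i = 0 := by omega
  exact ext_zero (by rw [pt_face_zero, h9.2, h8])

/-- The corner square of a filler is a lift of a pair of targets. -/
theorem hasLocalFillers_one_zero : 𝒟.nerve.bar.HasLocalFillers 𝒟.barS 1 (· ≠ 0) := by
  intro P π p y x hy hx hm
  have hx1 := hx 1 (by omega) (by omega)
  have hx2 := hx 2 (by omega) (by omega)
  have hy1 := hy 1 (by omega) (by omega)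
  have hy2 := hy 2 (by omega) (by omega)
  have hm' : ∀ᶠ p' in π.nhds p, 𝒟.nerve.bar.face 0 1 (by omega) (y 2 p') =
      𝒟.nerve.bar.face 0 1 (by omega) (y 1 p') :=
    hm.mono fun p' h => h 1 1 le_rfl le_rfl (by omega) (by omega)
  have hm1 : ∀ᶠ p' in π.nhds p, 𝒟.VM.tgt (th (y 2 p')) = 𝒟.VM.tgt (th (y 1 p')) :=
    hm'.mono fun p' h => by rw [← pt_face_one, ← pt_face_one, h]
  obtain ⟨δ, h1, h2, h3⟩ := 𝒟.exists_square_tgtV_tgtH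
    (𝒟.lieVM.near_pmul (𝒟.lieVM.near_inv (near_th hy2)) (near_th hy1)
      (hm1.mono fun p' h => by rw [src_inv, h])) (near_et hy2)
    (hm1.mono fun p' h => by rw [tgt_inv_pmul, src_th]) (sq x)
    (by rw [← hx1, ← hx2, th_face_pred, inv_pmul_cancel (src_th_face x), tgtV_sq])
    (by rw [← hx2, tgtH_sq])
  obtain ⟨c, hc⟩ := ((hm'.and h3).mono fun p' h => exists_two_of_one_two h.1 h.2.1 h.2.2).choice
  have h4 := eventually_self hc
  refine ⟨c, near_two_of_one_two (h1.congr (hc.mono fun p' h => h.2.2))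
    (hy1.congr (hc.mono fun p' h => h.1)) (hy2.congr (hc.mono fun p' h => h.2.1)),
    ext_two_of_one_two (h4.1.trans hx1.symm) (h4.2.1.trans hx2.symm) (h4.2.2.trans h2), ?_⟩
  refine hc.mono fun p' h i hi hi0 => ?_
  obtain rfl | rfl : i = 1 ∨ i = 2 := by omega
  · exact h.1
  · exact h.2.1

/-- The corner square of a filler is a lift of a vertical source and a horizontal target. -/
theorem hasLocalFillers_one_one : 𝒟.nerve.bar.HasLocalFillers 𝒟.barS 1 (· ≠ 1) := by
  intro P π p y x hy hx hm
  have hx0 := hx 0 (by omega) (by omega)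
  have hx2 := hx 2 (by omega) (by omega)
  have hy0 := hy 0 (by omega) (by omega)
  have hy2 := hy 2 (by omega) (by omega)
  have hm' : ∀ᶠ p' in π.nhds p, 𝒟.nerve.bar.face 0 0 (by omega) (y 2 p') =
      𝒟.nerve.bar.face 0 1 (by omega) (y 0 p') :=
    hm.mono fun p' h => h 0 1 (by omega) le_rfl (by omega) (by omega)
  obtain ⟨δ, h1, h2, h3⟩ := 𝒟.exists_square_srcV_tgtH (near_th hy0) (near_et hy2)
    (hm'.mono fun p' h => by rw [← pt_face_zero, ← pt_face_one, h]) (sq x)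
    (by rw [← hx0, srcV_sq]) (by rw [← hx2, tgtH_sq])
  obtain ⟨c, hc⟩ := ((hm'.and h3).mono fun p' h => exists_of_sq h.1.symm h.2.1 h.2.2).choice
  have h4 := eventually_self hc
  refine ⟨c, near_of_sq (hy0.congr (hc.mono fun p' h => h.1))
    (hy2.congr (hc.mono fun p' h => h.2.1)) (h1.congr (hc.mono fun p' h => h.2.2)),
    ext_of_sq (h4.1.trans hx0.symm) (h4.2.1.trans hx2.symm) (h4.2.2.trans h2), ?_⟩
  refine hc.mono fun p' h i hi hi0 => ?_
  obtain rfl | rfl : i = 0 ∨ i = 2 := by omega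
  · exact h.1
  · exact h.2.1

/-- The corner square of a filler is a lift of a pair of sources. -/
theorem hasLocalFillers_one_two : 𝒟.nerve.bar.HasLocalFillers 𝒟.barS 1 (· ≠ 2) := by
  intro P π p y x hy hx hm
  have hx0 := hx 0 (by omega) (by omega)
  have hx1 := hx 1 (by omega) (by omega)
  have hy0 := hy 0 (by omega) (by omega)
  have hy1 := hy 1 (by omega) (by omega)
  have hm' : ∀ᶠ p' in π.nhds p, 𝒟.nerve.bar.face 0 0 (by omega) (y 1 p') =
      𝒟.nerve.bar.face 0 0 (by omega) (y 0 p') :=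
    hm.mono fun p' h => h 0 0 le_rfl (by omega) (by omega) (by omega)
  have hm1 : ∀ᶠ p' in π.nhds p, 𝒟.HM.src (et (y 1 p')) = 𝒟.HM.src (et (y 0 p')) :=
    hm'.mono fun p' h => by rw [← pt_face_zero, ← pt_face_zero, h]
  obtain ⟨δ, h1, h2, h3⟩ := 𝒟.exists_square_srcV_srcH (near_th hy0)
    (𝒟.lieHM.near_pmul (near_et hy1) (𝒟.lieHM.near_inv (near_et hy0))
      (hm1.mono fun p' h => by rw [tgt_inv, h]))
    (hm1.mono fun p' h => by rw [src_pmul_inv h, src_th]) (sq x) (by rw [← hx0, srcV_sq])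
    (by rw [← hx0, ← hx1, et_face_one, pmul_inv_cancel (src_et x), srcH_sq])
  obtain ⟨c, hc⟩ := ((hm'.and h3).mono fun p' h => exists_two_of_zero_one h.1 h.2.1 h.2.2).choice
  have h4 := eventually_self hc
  refine ⟨c, near_two_of_zero_one (h1.congr (hc.mono fun p' h => h.2.2))
    (hy0.congr (hc.mono fun p' h => h.1)) (hy1.congr (hc.mono fun p' h => h.2.1)),
    ext_two_of_zero_one (h4.1.trans hx0.symm) (h4.2.1.trans hx1.symm) (h4.2.2.trans h2), ?_⟩
  refine hc.mono fun p' h i hi hi0 => ?_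
  obtain rfl | rfl : i = 0 ∨ i = 1 := by omega
  · exact h.1
  · exact h.2.1

/-- In dimensions at least three the fillers are unique, and hence automatically smooth. -/
theorem hasLocalFillers_add_two {k : ℕ} (hk : k ≤ s + 3) :
    𝒟.nerve.bar.HasLocalFillers 𝒟.barS (s + 2) (· ≠ k) := by
  intro P π p y x hy hx hm
  obtain ⟨c, hc⟩ := (hm.mono fun p' h => exists_filler hk h).choice
  refine ⟨c, near_of_horn k fun i hi hik => (hy i hi hik).congr (hc.mono fun p' h => h i hi hik),
    ext_of_horn k fun i hi hik => ?_, hc⟩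
  rw [eventually_self hc i hi hik, hx i hi hik]

theorem hasLocalFillers (m k : ℕ) (hk : k ≤ m + 1) :
    𝒟.nerve.bar.HasLocalFillers 𝒟.barS m (· ≠ k) := by
  match m with
  | 0 =>
    obtain rfl | rfl : k = 0 ∨ k = 1 := by omega
    · exact 𝒟.hasLocalFillers_zero_zero
    · exact 𝒟.hasLocalFillers_zero_one
  | 1 =>
    obtain rfl | rfl | rfl : k = 0 ∨ k = 1 ∨ k = 2 := by omega
    · exact 𝒟.hasLocalFillers_one_zero
    · exact 𝒟.hasLocalFillers_one_one
    · exact 𝒟.hasLocalFillers_one_two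
  | s + 2 => exact 𝒟.hasLocalFillers_add_two hk

variable {𝒟} in
/-- If the double-source map is surjective, all horns in dimension two have fillers. -/
theorem IsFull.exists_filler_one (hf : 𝒟.IsFull) {k : ℕ} (hk : k ≤ 2) {y : ℕ → 𝒟.nerve.Bar 1}
    (hy : 𝒟.nerve.bar.Matching 1 (· ≠ k) y) :
    ∃ x : 𝒟.nerve.Bar 2, ∀ (i : ℕ) (hi : i ≤ 2), i ≠ k → 𝒟.nerve.bar.face 1 i hi x = y i := by
  obtain rfl | rfl | rfl : k = 0 ∨ k = 1 ∨ k = 2 := by omega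
  · have hm : 𝒟.nerve.bar.face 0 1 (by omega) (y 2) = 𝒟.nerve.bar.face 0 1 (by omega) (y 1) :=
      hy 1 1 le_rfl le_rfl (by omega) (by omega)
    obtain ⟨Q, h1, h2⟩ := hf.exists_tgtV_tgtH (𝒟.VM.pmul (𝒟.VM.inv (th (y 2))) (th (y 1)))
      (et (y 2)) (by rw [tgt_inv_pmul, src_th])
    obtain ⟨x, h3, h4, -⟩ := exists_two_of_one_two hm h1 h2
    refine ⟨x, fun i hi hi0 => ?_⟩
    obtain rfl | rfl : i = 1 ∨ i = 2 := by omega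
    · exact h3
    · exact h4
  · have hm : 𝒟.nerve.bar.face 0 0 (by omega) (y 2) = 𝒟.nerve.bar.face 0 1 (by omega) (y 0) :=
      hy 0 1 (by omega) le_rfl (by omega) (by omega)
    obtain ⟨Q, h1, h2⟩ := hf.exists_srcV_tgtH (th (y 0)) (et (y 2))
      (by rw [← pt_face_zero, ← pt_face_one, hm])
    obtain ⟨x, h3, h4, -⟩ := exists_of_sq hm.symm h1 h2
    refine ⟨x, fun i hi hi0 => ?_⟩
    obtain rfl | rfl : i = 0 ∨ i = 2 := by omega
    · exact h3
    · exact h4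
  · have hm : 𝒟.nerve.bar.face 0 0 (by omega) (y 1) = 𝒟.nerve.bar.face 0 0 (by omega) (y 0) :=
      hy 0 0 le_rfl (by omega) (by omega) (by omega)
    obtain ⟨Q, h1, h2⟩ := hf (th (y 0)) (𝒟.HM.pmul (et (y 1)) (𝒟.HM.inv (et (y 0))))
      (by rw [src_pmul_inv (by rw [← pt_face_zero, ← pt_face_zero, hm]), src_th])
    obtain ⟨x, h3, h4, -⟩ := exists_two_of_zero_one hm h1 h2
    refine ⟨x, fun i hi hi0 => ?_⟩
    obtain rfl | rfl : i = 0 ∨ i = 1 := by omega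
    · exact h3
    · exact h4

end DoubleLieGroupoid

/-! ### Local fillers for partial horns -/

namespace SimplicialStructure

open SmoothStructure

variable {obj : ℕ → Type u} {S : SimplicialStructure obj} {σ : ∀ n, SmoothStructure (obj n)}

theorem HasLocalFillers.of_iff {m : ℕ} {T T' : ℕ → Prop} (h : S.HasLocalFillers σ m T)
    (hT : ∀ i, i ≤ m + 1 → (T i ↔ T' i)) : S.HasLocalFillers σ m T' := by
  intro P π p y x hy hx hm
  obtain ⟨c, h1, h2, h3⟩ := h P π p y x (fun i hi hi' => hy i hi ((hT i hi).1 hi'))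
    (fun i hi hi' => hx i hi ((hT i hi).1 hi')) (hm.mono fun p' h => by
      cases m with
      | zero => trivial
      | succ m =>
        exact fun i j hij hj hi hj' =>
          h i j hij hj ((hT i (by omega)).1 hi) ((hT (j + 1) (by omega)).1 hj'))
  exact ⟨c, h1, h2, h3.mono fun p' h i hi hi' => h i hi ((hT i hi).2 hi')⟩

/-- The faces which a simplex must have in order to be the face with index `j` of a simplex whose
other faces are `y`. There are no faces with index `i > m + 1`; the last branch only makes the
function total when `j = m + 2`. -/
def linkFace (S : SimplicialStructure obj) {m : ℕ} (j : ℕ) (hj : j ≤ m + 2) (y : ℕ → obj (m + 1))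
    (i : ℕ) : obj m :=
  if i < j then S.face m (j - 1) (by omega) (y i)
  else if h : j ≤ m + 1 then S.face m j h (y (i + 1)) else S.face m 0 (by omega) (y i)

theorem linkFace_of_lt {m j : ℕ} (hj : j ≤ m + 2) (y : ℕ → obj (m + 1)) {i : ℕ} (h : i < j) :
    S.linkFace j hj y i = S.face m (j - 1) (by omega) (y i) := if_pos h

theorem linkFace_of_ge {m j : ℕ} (hj : j ≤ m + 1) (y : ℕ → obj (m + 1)) {i : ℕ} (h : j ≤ i) :
    S.linkFace j (by omega) y i = S.face m j hj (y (i + 1)) :=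
  (if_neg (by omega)).trans (dif_pos hj)

/-- The faces required of the missing face with index `j` form a partial horn. Its indices are those
of `T`, shifted down beyond `j`. -/
theorem matching_linkFace {m j : ℕ} (hj : j ≤ m + 2) {T : ℕ → Prop} {y : ℕ → obj (m + 1)}
    (hy : S.Matching (m + 1) T y) :
    S.Matching m (fun i => if i < j then T i else T (i + 1)) (S.linkFace j hj y) := by
  cases m with
  | zero => trivial
  | succ m =>
    intro a b hab hb ha hb'
    obtain h | ⟨h1, h2⟩ | h : b + 1 < j ∨ (a < j ∧ j ≤ b + 1) ∨ j ≤ a := by omega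
    · rw [if_pos (by omega)] at ha
      rw [if_pos (by omega)] at hb'
      rw [linkFace_of_lt _ _ (by omega), linkFace_of_lt _ _ (by omega),
        S.face_face' (j := j - 2) (l := a) (by omega) (by omega) rfl (by omega) (by omega)
          (h3 := by omega) (h4 := by omega), hy a b hab (by omega) ha hb',
        S.face_face' (j := j - 2) (l := b) (by omega) (by omega) rfl (by omega) (by omega)
          (h3 := by omega) (h4 := by omega)]
    · rw [if_pos (by omega)] at ha
      rw [if_neg (by omega)] at hb'
      rw [linkFace_of_ge (by omega) _ (by omega), linkFace_of_lt _ _ (by omega),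
        S.face_face' (j := j - 1) (l := a) (by omega) (by omega) rfl (by omega) (by omega)
          (h3 := by omega) (h4 := by omega), hy a (b + 1) (by omega) (by omega) ha hb',
        S.face_face (n := m) (i := j - 1) (j := b) (by omega) (by omega)]
    · rw [if_neg (by omega)] at ha hb'
      rw [linkFace_of_ge (by omega) _ (by omega), linkFace_of_ge (by omega) _ (by omega),
        ← S.face_face (n := m) (i := j) (j := a) (by omega) (by omega),
        hy (a + 1) (b + 1) (by omega) (by omega) ha hb',
        S.face_face (n := m) (i := j) (j := b) (by omega) (by omega)]

open Classical in
/-- A missing face of a partial horn can be found first, as a filler of a partial horn of lower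
dimension. -/
theorem HasLocalFillers.of_insert (hσ : ∀ n i hi, (σ (n + 1)).Smooth (σ n) (S.face n i hi))
    {m j : ℕ} {T : ℕ → Prop} (hj : j ≤ m + 1) (hT : ¬ T j)
    (hlow : ∀ n, m = n + 1 → S.HasLocalFillers σ n (fun i => if i < j then T i else T (i + 1)))
    (h : S.HasLocalFillers σ m (fun i => T i ∨ i = j)) : S.HasLocalFillers σ m T := by
  intro P π p y x hy hx hm
  -- the missing face with index `j`
  obtain ⟨z, hz, hzp, hz'⟩ : ∃ z : P → obj m, π.Near (σ m) z p ∧ z p = S.face m j hj x ∧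
      ∀ᶠ p' in π.nhds p, S.Matching m (fun i => T i ∨ i = j)
        (fun i => if i = j then z p' else y i p') := by
    cases m with
    | zero => exact ⟨fun _ => _, near_const _ _ _ _, rfl, .of_forall fun _ => trivial⟩
    | succ m =>
      have hn : ∀ i, i ≤ m + 1 → (if i < j then T i else T (i + 1)) →
          π.Near (σ m) (fun p' => S.linkFace j hj (fun i => y i p') i) p := by
        intro i hi hi'
        by_cases hij : i < j
        · rw [if_pos hij] at hi'
          exact ((hσ m (j - 1) (by omega)).near_comp (hy i (by omega) hi')).congr
            (.of_forall fun p' => linkFace_of_lt hj _ hij)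
        · rw [if_neg hij] at hi'
          exact ((hσ m j (by omega)).near_comp (hy (i + 1) (by omega) hi')).congr
            (.of_forall fun p' => linkFace_of_ge (by omega) _ (by omega))
      have hf : ∀ i hi, (if i < j then T i else T (i + 1)) →
          S.face m i hi (S.face (m + 1) j hj x) = S.linkFace j hj (fun i => y i p) i := by
        intro i hi hi'
        by_cases hij : i < j
        · rw [if_pos hij] at hi'
          rw [linkFace_of_lt _ _ hij, ← hx i (by omega) hi',
            S.face_face' (j := j - 1) (l := i) (by omega) (by omega) rfl (by omega) (by omega)
              (h3 := by omega) (h4 := by omega)]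
        · rw [if_neg hij] at hi'
          rw [linkFace_of_ge (by omega) _ (by omega), ← hx (i + 1) (by omega) hi',
            S.face_face (n := m) (i := j) (j := i) (by omega) (by omega)]
      obtain ⟨z, h1, h2, h3⟩ := hlow m rfl P π p _ _ hn hf
        (hm.mono fun p' h => matching_linkFace hj h)
      refine ⟨z, h1, h2, ?_⟩
      filter_upwards [hm, h3] with p' h4 h5 a b hab hb ha hb'
      by_cases haj : a = j
      · subst haj
        have hb'' : T (b + 1) := hb'.resolve_right (by omega)
        have h6 := h5 b (by omega) (by rwa [if_neg (by omega)])
        rw [linkFace_of_ge (by omega) _ (by omega)] at h6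
        simp only [if_pos, if_neg (show ¬ b + 1 = a by omega)]
        exact h6.symm
      · have ha' : T a := ha.resolve_right haj
        by_cases hbj : b + 1 = j
        · subst hbj
          have h6 := h5 a (by omega) (by rwa [if_pos (by omega)])
          rw [linkFace_of_lt _ _ (by omega)] at h6
          simp only [if_pos, if_neg haj]
          exact h6
        · simp only [if_neg haj, if_neg hbj]
          exact h4 a b hab hb ha' (hb'.resolve_right hbj)
  obtain ⟨c, h1, h2, h3⟩ := h P π p (fun i p' => if i = j then z p' else y i p') x
    (fun i hi hi' => by
      by_cases hij : i = j
      · simpa only [if_pos hij] using hz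
      · simpa only [if_neg hij] using hy i hi (hi'.resolve_right hij))
    (fun i hi hi' => by
      by_cases hij : i = j
      · subst hij
        simp only [if_pos, hzp]
      · simp only [if_neg hij]
        exact hx i hi (hi'.resolve_right hij)) hz'
  refine ⟨c, h1, h2, h3.mono fun p' h4 i hi hi' => ?_⟩
  have h5 := h4 i hi (.inl hi')
  have hij : i ≠ j := fun e => hT (e ▸ hi')
  rwa [if_neg hij] at h5

/-- Local fillers for horns yield local fillers for all partial horns. -/
theorem hasLocalFillers_of_horns (hσ : ∀ n i hi, (σ (n + 1)).Smooth (σ n) (S.face n i hi))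
    (h : ∀ m k, k ≤ m + 1 → S.HasLocalFillers σ m (· ≠ k)) (m : ℕ) :
    ∀ (T : ℕ → Prop) (k : ℕ), k ≤ m + 1 → ¬ T k → S.HasLocalFillers σ m T := by
  induction m using Nat.strong_induction_on with
  | _ m ih =>
  intro T k hk hT
  -- induction on a finite set containing the indices, apart from `k`, of the faces not prescribed
  have key : ∀ (F : Finset ℕ) (T : ℕ → Prop), ¬ T k →
      (∀ i, i ≤ m + 1 → i ≠ k → ¬ T i → i ∈ F) → S.HasLocalFillers σ m T := by
    intro F
    induction F using Finset.induction_on with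
    | empty =>
      intro T hT hF
      refine (h m k hk).of_iff fun i hi => ⟨fun hik => ?_, fun hi' e => hT (e ▸ hi')⟩
      by_contra hi'
      exact Finset.notMem_empty _ (hF i hi hik hi')
    | insert j F _ ihF =>
      intro T hT hF
      by_cases hj : j ≤ m + 1 ∧ j ≠ k ∧ ¬ T j
      · obtain ⟨hj, hjk, hTj⟩ := hj
        refine HasLocalFillers.of_insert hσ hj hTj (fun n hn => ?_) (ihF _ ?_ ?_)
        · rcases Nat.lt_or_ge k j with hkj | hkj
          · exact ih n (by omega) _ k (by omega) (by rwa [if_pos hkj])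
          · refine ih n (by omega) _ (k - 1) (by omega) ?_
            rwa [if_neg (by omega), Nat.sub_add_cancel (by omega)]
        · exact fun hk' => hk'.elim hT hjk.symm
        · intro i hi hik hi'
          refine (Finset.mem_insert.1 (hF i hi hik fun hi'' => hi' (.inl hi''))).resolve_left ?_
          exact fun e => hi' (.inr e)
      · refine ihF T hT fun i hi hik hi' => (Finset.mem_insert.1 (hF i hi hik hi')).resolve_left ?_
        rintro rfl
        exact hj ⟨hi, hik, hi'⟩
  exact key (Finset.range (m + 2)) T hT fun i hi _ _ => Finset.mem_range.2 (by omega)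

end SimplicialStructure

/-! ### Spaces of partial horns -/

namespace SimplicialStructure

open SmoothStructure

variable {obj : ℕ → Type u} (S : SimplicialStructure obj) (σ : ∀ n, SmoothStructure (obj n))

/-- The partial horns: tuples of simplices `x_i`, for the indices `i` with `T i`, which satisfy the
equations between the faces of a simplex. -/
def partialHornSet : (m : ℕ) → (T : Fin (m + 2) → Prop) → Set ({i : Fin (m + 2) // T i} → obj m)
  | 0, _ => Set.univ
  | m + 1, T => {x | ∀ (i j : {i : Fin (m + 3) // T i}) (hij : i.1.1 < j.1.1),
      S.face m i.1.1 (by omega) (x j) = S.face m (j.1.1 - 1) (by omega) (x i)}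

theorem hornSet_eq (m : ℕ) (k : Fin (m + 2)) :
    S.hornSet m k = S.partialHornSet m (· ≠ k) := by
  cases m <;> rfl

/-- The entries of a partial horn, as a family indexed by all natural numbers, with the value `x₀`
at the indices without an entry. -/
noncomputable def hornFamily {m : ℕ} {T : Fin (m + 2) → Prop} (x : {i : Fin (m + 2) // T i} → obj m)
    (x₀ : obj m) (i : ℕ) : obj m :=
  open Classical in if h : ∃ h : i < m + 2, T ⟨i, h⟩ then x ⟨⟨i, h.1⟩, h.2⟩ else x₀

variable {S σ}

theorem hornFamily_apply {m : ℕ} {T : Fin (m + 2) → Prop} (x : {i : Fin (m + 2) // T i} → obj m)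
    (x₀ : obj m) (i : ℕ) (h : i < m + 2) (h' : T ⟨i, h⟩) :
    hornFamily x x₀ i = x ⟨⟨i, h⟩, h'⟩ :=
  dif_pos ⟨h, h'⟩

theorem matching_hornFamily {m : ℕ} {T : Fin (m + 2) → Prop}
    {x : {i : Fin (m + 2) // T i} → obj m} (hx : x ∈ S.partialHornSet m T) (x₀ : obj m) :
    S.Matching m (fun i => ∃ h : i < m + 2, T ⟨i, h⟩) (hornFamily x x₀) := by
  cases m with
  | zero => trivial
  | succ m =>
    rintro i j hij hj ⟨h1, h2⟩ ⟨h3, h4⟩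
    rw [hornFamily_apply _ _ _ h1 h2, hornFamily_apply _ _ _ h3 h4]
    exact hx ⟨⟨i, h1⟩, h2⟩ ⟨⟨j + 1, h3⟩, h4⟩ (Nat.lt_succ_of_le hij)

theorem near_hornFamily {m : ℕ} {T : Fin (m + 2) → Prop} [Fintype {i // T i}] {P : Type u}
    {π : SmoothStructure P} {p : P} {c : P → {i : Fin (m + 2) // T i} → obj m}
    (hc : π.Near (pi fun _ => σ m) c p) (x₀ : obj m) (i : ℕ) :
    π.Near (σ m) (fun p => hornFamily (c p) x₀ i) p := by
  by_cases h : ∃ h : i < m + 2, T ⟨i, h⟩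
  · exact (near_pi_iff.1 hc ⟨⟨i, h.1⟩, h.2⟩).congr
      (.of_forall fun p => hornFamily_apply _ _ _ h.1 h.2)
  · exact (near_const _ _ x₀ _).congr (.of_forall fun p => dif_neg h)

theorem face_mem_partialHornSet {m : ℕ} (T : Fin (m + 2) → Prop) (x : obj (m + 1)) :
    (fun i => S.face m i.1.1 (by omega) x) ∈ S.partialHornSet m T := by
  cases m with
  | zero => trivial
  | succ m => exact fun i j hij => S.face_face' (by omega) (by omega) rfl _ _

/-- Near any simplex, a smooth family of partial horns can be filled. -/
theorem exists_filler_near {m : ℕ} {T : Fin (m + 2) → Prop} [Fintype {i // T i}]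
    (hF : S.HasLocalFillers σ m (fun i => ∃ h : i < m + 2, T ⟨i, h⟩))
    (hs : (pi fun _ : {i : Fin (m + 2) // T i} => σ m).IsSubmanifold (S.partialHornSet m T))
    (x : obj (m + 1)) (z : S.partialHornSet m T)
    (hz : ∀ i : {i : Fin (m + 2) // T i}, S.face m i.1.1 (by omega) x = z.1 i) :
    ∃ c : S.partialHornSet m T → obj (m + 1),
      ((pi fun _ : {i : Fin (m + 2) // T i} => σ m).sub (S.partialHornSet m T)).Near
        (σ (m + 1)) c z ∧ c z = x ∧
      ∀ᶠ z' in ((pi fun _ : {i : Fin (m + 2) // T i} => σ m).sub (S.partialHornSet m T)).nhds z,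
        ∀ i : {i : Fin (m + 2) // T i}, S.face m i.1.1 (by omega) (c z') = z'.1 i := by
  obtain ⟨c, h1, h2, h3⟩ := hF _ ((pi fun _ => σ m).sub (S.partialHornSet m T)) z
    (fun i z => hornFamily z.1 (S.face m 0 (by omega) x) i) x
    (fun i _ _ => near_hornFamily (hs.smooth_val.near z) _ i)
    (fun i hi ⟨h, h'⟩ => (hz ⟨⟨i, h⟩, h'⟩).trans (hornFamily_apply _ _ _ h h').symm)
    (.of_forall fun z => matching_hornFamily z.2 _)
  exact ⟨c, h1, h2, h3.mono fun z' h i => (h i.1.1 (by omega) ⟨i.1.2, i.2⟩).trans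
    (hornFamily_apply _ _ _ i.1.2 i.2)⟩

open Classical in
/-- The equations are imposed in increasing order of the larger index: those with larger index `j`
equate a part of the boundary of `x_j` with a partial horn which depends on the previous entries,
and the local fillers of such partial horns show that `x_j` can be varied. -/
theorem isSubmanifold_partialHornSet (hσ : ∀ n i hi, (σ (n + 1)).Smooth (σ n) (S.face n i hi))
    (hF : ∀ m (T : ℕ → Prop) (k : ℕ), k ≤ m + 1 → ¬ T k → S.HasLocalFillers σ m T) (m : ℕ) :
    ∀ (T : Fin (m + 2) → Prop) [Fintype {i // T i}] (k : Fin (m + 2)), ¬ T k →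
      (pi fun _ : {i : Fin (m + 2) // T i} => σ m).IsSubmanifold (S.partialHornSet m T) := by
  induction m with
  | zero => exact fun T _ k hk => isSubmanifold_univ _
  | succ m ih =>
  intro T _ k hk
  have key : ∀ j : ℕ, (pi fun _ : {i : Fin (m + 3) // T i} => σ (m + 1)).IsSubmanifold
      {x | ∀ (a b : {i : Fin (m + 3) // T i}) (_ : a.1.1 < b.1.1), b.1.1 < j →
        S.face m a.1.1 (by omega) (x b) = S.face m (b.1.1 - 1) (by omega) (x a)} := by
    intro j
    induction j with
    | zero =>
      convert isSubmanifold_univ _ using 1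
      exact eq_univ_of_forall fun x a b _ hb => absurd hb (by omega)
    | succ j ihj =>
      by_cases hj : ∃ h : j < m + 3, j ≠ 0 ∧ T ⟨j, h⟩
      swap
      · convert ihj using 1
        ext x
        refine ⟨fun hx a b hab hb => hx a b hab (by omega), fun hx a b hab hb => ?_⟩
        refine hx a b hab (lt_of_le_of_ne (by omega) ?_)
        rintro rfl
        exact hj ⟨b.1.2, by omega, b.2⟩
      obtain ⟨hj, hj0, hTj⟩ := hj
      obtain ⟨j, rfl⟩ : ∃ l, j = l + 1 := ⟨j - 1, by omega⟩
      let b : {i : Fin (m + 3) // T i} := ⟨⟨j + 1, hj⟩, hTj⟩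
      -- the new equations prescribe the faces of `x b` with the indices `i < b` in `T`
      let T' : Fin (m + 2) → Prop := fun i => i.1 < j + 1 ∧ T ⟨i.1, by omega⟩
      let e : {i : Fin (m + 2) // T' i} → {i : Fin (m + 3) // T i} :=
        fun i => ⟨⟨i.1.1, by omega⟩, i.2.2⟩
      -- these are not all faces of `x b`: if `b` is the last index, the missing one `k` is smaller
      obtain ⟨k', hk'⟩ : ∃ k' : Fin (m + 2), ¬ T' k' := by
        by_cases h : j + 1 < m + 2
        · exact ⟨⟨j + 1, h⟩, fun h' => absurd h'.1 (by simp)⟩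
        · have hk2 : k.1 < m + 2 := by
            refine lt_of_le_of_ne (by omega) fun h' => hk ?_
            have : k = ⟨j + 1, hj⟩ := Fin.ext (by simp only; omega)
            rwa [this]
          exact ⟨⟨k.1, hk2⟩, fun h' => hk h'.2⟩
      have hZ := ih T' k' hk'
      have hF' : S.HasLocalFillers σ m (fun i => ∃ h : i < m + 2, T' ⟨i, h⟩) :=
        hF m _ k'.1 (by omega) fun ⟨_, h⟩ => hk' h
      have hval := ihj.smooth_val
      have hev := fun i => (smooth_apply (fun _ => σ (m + 1)) i).comp hval
      have := ihj.equalizer (τ := (pi fun _ => σ m).sub (S.partialHornSet m T'))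
        (f := fun x => ⟨_, face_mem_partialHornSet T' (x.1 b)⟩)
        (g := fun x => ⟨fun i => S.face m j (by omega) (x.1 (e i)), by
          cases m with
          | zero => trivial
          | succ m =>
            intro i i' hii
            have hi' := i'.2.1
            have h1 := x.2 (e i) (e i') hii hi'
            obtain ⟨j, rfl⟩ : ∃ l, j = l + 1 := ⟨j - 1, by omega⟩
            rw [S.face_face (n := m) (i := i.1.1) (j := j) (by omega) (by omega), h1]
            exact (S.face_face (n := m) (i := i'.1.1 - 1) (j := j) (by omega) (by omega) _).symm⟩)
        (hZ.smooth_iff.2 (smooth_of_near fun x => near_pi_iff.2 fun i =>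
          (hσ m i.1.1 (by omega)).near_comp ((hev b).near x)))
        (hZ.smooth_iff.2 (smooth_of_near fun x => near_pi_iff.2 fun i =>
          (hσ m j (by omega)).near_comp ((hev (e i)).near x))) fun x hx => by
          obtain ⟨c, h1, h2, h3⟩ := exists_filler_near hF' hZ (x.1 b)
            ⟨_, face_mem_partialHornSet T' (x.1 b)⟩ fun i => rfl
          have hne : ∀ a : {i : Fin (m + 3) // T i}, a.1.1 < j + 1 → a ≠ b := by
            rintro a ha rfl
            exact absurd ha (by simp [b])
          refine ⟨fun z => ⟨Function.update x.1 b (c z), fun a a' h h' => ?_⟩,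
            ihj.near_iff.2 (near_update _ h1), Subtype.ext ?_, h3.mono fun z hz => ⟨?_, ?_⟩⟩
          · rw [Function.update_of_ne (hne a (by omega)), Function.update_of_ne (hne a' h')]
            exact x.2 a a' h h'
          · simp only [h2, Function.update_eq_self]
          · refine Subtype.ext (funext fun i => ?_)
            simp only [Function.update_self]
            exact hz i
          · refine Subtype.ext (funext fun i => ?_)
            simp only
            rw [Function.update_of_ne (hne (e i) i.2.1)]
      convert this using 1
      ext x
      refine ⟨fun hx => ⟨fun a b hab hb => hx a b hab (by omega), Subtype.ext (funext fun i =>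
        hx (e i) b i.2.1 (Nat.lt_succ_self _))⟩, fun ⟨h1, h2⟩ a b' hab hb => ?_⟩
      rcases (Nat.le_of_lt_succ hb).eq_or_lt with hb' | hb'
      · obtain rfl : b' = b := Subtype.ext (Fin.ext hb')
        have h3 : a.1.1 < j + 1 := hab
        exact congrFun (congrArg Subtype.val h2) ⟨⟨a.1.1, by omega⟩, h3, a.2⟩
      · exact h1 a b' hab hb'
  convert key (m + 3) using 1
  ext x
  exact ⟨fun hx a b hab _ => hx a b hab, fun hx a b hab => hx a b hab b.1.2⟩

end SimplicialStructure

/-! ### Face maps and horn maps -/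

namespace SimplicialStructure

open SmoothStructure

variable {obj : ℕ → Type u} {S : SimplicialStructure obj} {σ : ∀ n, SmoothStructure (obj n)}

/-- A local section of a face map is a local filler of a partial horn with a single entry. -/
theorem face_submersion (hσ : ∀ n i hi, (σ (n + 1)).Smooth (σ n) (S.face n i hi))
    (hF : ∀ m (T : ℕ → Prop) (k : ℕ), k ≤ m + 1 → ¬ T k → S.HasLocalFillers σ m T) (m i : ℕ)
    (hi : i ≤ m + 1) : (σ (m + 1)).Submersion (σ m) (S.face m i hi) := by
  refine submersion_of_sections (hσ m i hi) fun x => ?_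
  obtain ⟨k, hk, hki⟩ : ∃ k, k ≤ m + 1 ∧ k ≠ i := by
    rcases Nat.eq_zero_or_pos i with rfl | h
    · exact ⟨1, by omega, by omega⟩
    · exact ⟨0, by omega, by omega⟩
  obtain ⟨c, h1, h2, h3⟩ := hF m (· = i) k hk hki (obj m) (σ m) (S.face m i hi x) (fun _ z => z) x
    (fun _ _ _ => near_id _ _) (fun j hj e => by subst e; rfl) (.of_forall fun z => by
      cases m with
      | zero => trivial
      | succ m => exact fun a b hab _ ha hb => absurd hab (by omega))
  exact ⟨c, h1, h2, h3.mono fun z h => h i hi rfl⟩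

theorem hornsAreSmooth (hσ : ∀ n i hi, (σ (n + 1)).Smooth (σ n) (S.face n i hi))
    (hF : ∀ m (T : ℕ → Prop) (k : ℕ), k ≤ m + 1 → ¬ T k → S.HasLocalFillers σ m T) :
    S.HornsAreSmooth σ := by
  intro m k
  rw [hornSet_eq]
  exact isSubmanifold_partialHornSet hσ hF m _ k (not_not.2 rfl)

/-- A local section of a horn map is a local filler of the tautological family of horns. -/
theorem horn_submersion (hσ : ∀ n i hi, (σ (n + 1)).Smooth (σ n) (S.face n i hi))
    (hF : ∀ m (T : ℕ → Prop) (k : ℕ), k ≤ m + 1 → ¬ T k → S.HasLocalFillers σ m T) (m : ℕ)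
    (k : Fin (m + 2)) : (σ (m + 1)).Submersion (S.hornSmooth σ m k) (S.hornMap m k) := by
  have hs := hornsAreSmooth hσ hF m k
  refine submersion_of_sections (hs.smooth_iff.2 (smooth_of_near fun x => near_pi_iff.2 fun i =>
    (hσ m i.1.1 (by omega)).near x)) fun x => ?_
  have hF' : S.HasLocalFillers σ m (fun i => ∃ h : i < m + 2, (⟨i, h⟩ : Fin (m + 2)) ≠ k) :=
    hF m _ k.1 (by omega) fun ⟨_, h⟩ => h rfl
  have hs' := isSubmanifold_partialHornSet hσ hF m (· ≠ k) k (not_not.2 rfl)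
  obtain ⟨c, h1, h2, h3⟩ := exists_filler_near hF' hs' x
    ⟨_, face_mem_partialHornSet (· ≠ k) x⟩ fun i => rfl
  cases m <;> exact ⟨c, h1, h2, h3.mono fun z h => Subtype.ext (funext h)⟩

/-- The horn map is surjective if all horns, presented as families indexed by the natural numbers,
have fillers. -/
theorem hornMap_surjective {m : ℕ} {k : Fin (m + 2)} (h : ∀ y : ℕ → obj m,
    S.Matching m (· ≠ k.1) y → ∃ x : obj (m + 1), ∀ (i : ℕ) (hi : i ≤ m + 1), i ≠ k.1 →
      S.face m i hi x = y i) : Function.Surjective (S.hornMap m k) := by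
  intro z
  obtain ⟨k', hk'⟩ : ∃ k' : Fin (m + 2), k' ≠ k := exists_ne k
  have hz : z.1 ∈ S.partialHornSet m (· ≠ k) := hornSet_eq S m k ▸ z.2
  have hm := matching_hornFamily hz (z.1 ⟨k', hk'⟩)
  obtain ⟨x, hx⟩ := h (hornFamily z.1 (z.1 ⟨k', hk'⟩)) (by
    cases m with
    | zero => trivial
    | succ m =>
      exact fun i j hij hj hi hj' => hm i j hij hj ⟨by omega, fun e => hi (congrArg Fin.val e)⟩
        ⟨by omega, fun e => hj' (congrArg Fin.val e)⟩)
  refine ⟨x, Subtype.ext (funext fun i => ?_)⟩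
  exact (hx i.1.1 (by omega) fun e => i.2 (Fin.ext e)).trans (hornFamily_apply _ _ _ i.1.2 i.2)

end SimplicialStructure

namespace DoubleLieGroupoid

open DoubleGpd SmoothStructure SimplicialStructure

variable {D H V M : Type u} (𝒟 : DoubleLieGroupoid D H V M)

theorem hasLocalFillers_of_ne (m : ℕ) (T : ℕ → Prop) (k : ℕ) (hk : k ≤ m + 1) (hT : ¬ T k) :
    𝒟.nerve.bar.HasLocalFillers 𝒟.barS m T :=
  hasLocalFillers_of_horns 𝒟.nerve_isSmooth.smooth_barFace 𝒟.hasLocalFillers m T k hk hT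

theorem isSimplicialManifold_bar : 𝒟.nerve.bar.IsSimplicialManifold 𝒟.barS :=
  ⟨face_submersion 𝒟.nerve_isSmooth.smooth_barFace 𝒟.hasLocalFillers_of_ne,
    𝒟.nerve.bar.face_surjective, 𝒟.nerve_isSmooth.embedding_barDegen⟩

theorem hornMap_injective (m : ℕ) (k : Fin (m + 2)) (hm : 2 < m + 1) :
    Function.Injective (𝒟.nerve.bar.hornMap m k) := by
  obtain ⟨s, rfl⟩ : ∃ l, m = l + 2 := ⟨m - 2, by omega⟩
  intro x y h
  refine ext_of_horn k.1 fun i hi hik => ?_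
  exact congrFun (congrArg Subtype.val h) ⟨⟨i, by omega⟩, fun e => hik (congrArg Fin.val e)⟩

variable {𝒟} in
theorem IsFull.hornMap_surjective (hf : 𝒟.IsFull) (m : ℕ) (k : Fin (m + 2)) :
    Function.Surjective (𝒟.nerve.bar.hornMap m k) := by
  refine SimplicialStructure.hornMap_surjective fun y hy => ?_
  match m with
  | 0 =>
    -- a horn of dimension one is a vertex, with index `1 - k`
    obtain ⟨x, hx⟩ := 𝒟.nerve.bar.face_surjective 0 (1 - k.1) (by omega) (y (1 - k.1))
    refine ⟨x, fun i hi hik => ?_⟩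
    obtain rfl : i = 1 - k.1 := by omega
    exact hx
  | 1 => exact hf.exists_filler_one (by omega) hy
  | s + 2 => exact exists_filler (by omega) hy

end DoubleLieGroupoid

theorem mainTheorem1 {D H V M : Type u} (𝒟 : DoubleLieGroupoid D H V M) :
    𝒟.NerveIsSmooth ∧
    𝒟.nerve.BarIsSmooth 𝒟.nerveSmooth ∧
    𝒟.nerve.bar.IsLocalLieGroupoid (𝒟.nerve.barSmooth 𝒟.nerveSmooth) 2 ∧
    (𝒟.IsFull → 𝒟.nerve.bar.IsLieGroupoid (𝒟.nerve.barSmooth 𝒟.nerveSmooth) 2) := by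
  have hh := SimplicialStructure.hornsAreSmooth 𝒟.nerve_isSmooth.smooth_barFace
    𝒟.hasLocalFillers_of_ne
  have hs := SimplicialStructure.horn_submersion 𝒟.nerve_isSmooth.smooth_barFace
    𝒟.hasLocalFillers_of_ne
  exact ⟨𝒟.nerveIsSmooth, 𝒟.nerve_isSmooth.barIsSmooth,
    ⟨𝒟.isSimplicialManifold_bar, hh, hs, 𝒟.hornMap_injective,
      fun m k hm => (hs m k).etale (𝒟.hornMap_injective m k hm)⟩,
    fun hf => ⟨𝒟.isSimplicialManifold_bar, hh, hf.hornMap_surjective, hs,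
      fun m k hm => (hs m k).diffeo ⟨𝒟.hornMap_injective m k hm, hf.hornMap_surjective m k⟩⟩⟩
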